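/- Conventions. All structures $\mathfrak A$ are finite with at least two elements; $\tau$ is a relational vocabulary, $A$ is the universe of $\mathfrak A$. A distribution on $A^n$ is a map $f\colon A^n\to[0,1]$ with $\sum_{\vec a}f(\vec a)=1$. A probabilistic team $\mathbb X$ over variables $x_1,\dots,x_n$ with values in $A$ assigns weights to the assignments $s\colon\{x_1,\dots,x_n\}\to A$ and is either a distribution or the empty team (all weights $0$); its support is $\{s : \mathbb X(s)>0\}$. Team logics. ${\rm FO}(\approx,\mathrm{dep})$ is first-order logic in negation normal form (atoms $x=y$, $R(\vec x)$ and their negations; $\wedge,\vee,\exists x,\forall x$) extended by marginal identity atoms $\vec x\approx\vec y$ (with $|\vec x|=|\vec y|$) and dependence atoms $\mathrm{dep}(\vec x,y)$; ${\rm FO}(\approx)$ is the fragment without dependence atoms. Satisfaction $\mathfrak A\models_{\mathbb X}\phi$: a literal holds iff it holds under every $s$ in the support; $\vec x\approx\vec y$ holds iff $\sum_{s(\vec x)=\vec a}\mathbb X(s)=\sum_{s(\vec y)=\vec a}\mathbb X(s)$ for all tuples $\vec a$; $\mathrm{dep}(\vec x,y)$ holds iff any $s,s'$ in the support with $s(\vec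 x)=s'(\vec x)$ have $s(y)=s'(y)$; $\wedge$ is as usual; $\psi\vee\theta$ holds iff $\mathbb X=\alpha\mathbb Y+(1-\alpha)\mathbb Z$ for some $\alpha\in[0,1]$ and probabilistic teams $\mathbb Y,\mathbb Z$ satisfying $\psi$ and $\theta$, respectively; $\exists x\,\psi$ ($x$ a fresh variable) holds iff some probabilistic team $\mathbb Y$ over the variables of $\mathbb X$ and $x$, whose projection to the variables of $\mathbb X$ is $\mathbb X$, satisfies $\psi$; $\forall x\,\psi$ holds iff the team $\mathbb X[A/x]$, $\mathbb X[A/x](s(a/x))=\mathbb X(s)/|A|$, satisfies $\psi$. Second-order logics. Numerical terms are built from real constants $c$, $f(\vec x)$ with $f$ a function symbol or function variable, and the operations $+$, $\times$ and $\mathrm{SUM}_{\vec y}$, where $\mathrm{SUM}_{\vec y}\,i$ is the sum of the values of $i$ over all values of $\vec y$ in $A$. ${\rm ESO}_{[0,1]}[E,O,C]$ has the formulae built from literals $x=y$, $\neg x=y$, $R(\vec x)$, $\neg R(\vec x)$ and numerical atoms $i\mathrel e j$, $\neg\, i\mathrel e j$ with $e\in E$ and terms using only operations in $O$ and constants in $C$,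 by $\wedge,\vee,\exists x,\forall x$ and $\exists f$, where $\exists f$ quantifies over functions $A^{\mathrm{ar}(f)}\to[0,1]$. The loose fragment disallows negated numerical atoms. A formula is almost conjunctive if in each of its subformulae $\psi_1\vee\psi_2$ at least one of $\psi_1,\psi_2$ contains no numerical term. It has prefix $\ddot\exists^*\forall^*$ if it is a (possibly empty) block of existential function quantifiers, followed by a (possibly empty) block of first-order universal quantifiers, followed by a quantifier-free formula. Comparison. Let $n\ge 0$ and let $f$ be an $n$-ary function symbol. Consider structures $(\mathfrak A,f^{\mathfrak A})$ of vocabulary $\tau\cup\{f\}$ in which $f^{\mathfrak A}$ is a distribution on $A^n$. A team formula $\phi$ with free variables among $x_1,\dots,x_n$ defines the class of those $(\mathfrak A,f^{\mathfrak A})$ with $\mathfrak A\models_{\mathbb X}\phi$ for the team $\mathbb X(s)=f^{\mathfrak A}(s(x_1),\dots,s(x_n))$; a second-order formula $\psi$ over $\tau\cup\{f\}$ without free first-order variables defines the class of those $(\mathfrak A,f^{\mathfrak A})$ that satisfy $\psi$. A team logic $\mathcal L$ and a second-order logic $\mathcal L'$ are equally expressive, $\mathcal L\equiv\mathcal L'$,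 if for all $\tau$ and $n$ the classes defined by formulae of $\mathcal L$ are exactly the classes defined by formulae of $\mathcal L'$. Theorem. (i) ${\rm FO}(\approx,\mathrm{dep})$ is equally expressive as the loose fragment of ${\rm ESO}_{[0,1]}[=,+,0,1]$. (ii) ${\rm FO}(\approx)$ is equally expressive as the set of almost conjunctive formulae with prefix $\ddot\exists^*\forall^*$ in the loose fragment of ${\rm ESO}_{[0,1]}[=,\mathrm{SUM},0,1]$. -/

import Mathlib

universe u v w

namespace ProbTeam

/-! ### Existential second-order logic over the reals

Formulae are well-scoped: `Γ : List ℕ` is the finite functional vocabulary `σ` (the list of the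
arities of its symbols, quantified function variables in front), `n` is the number of first-order
variables in scope, and a first-order quantifier adds the variable with the last index. -/

/-- `FVar Γ k`: the function symbols of arity `k` in the functional vocabulary `Γ`. -/
inductive FVar : List ℕ → ℕ → Type
  | here {k : ℕ} {Γ : List ℕ} : FVar (k :: Γ) k
  | there {k m : ℕ} {Γ : List ℕ} (f : FVar Γ k) : FVar (m :: Γ) k

/-- Interpretations of the function symbols in `Γ` by real-valued functions on tuples over `A`. -/
def FEnv (Γ : List ℕ) (A : Type u) : Type u :=
  (k : ℕ) → FVar Γ k → (Fin k → A) → ℝ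

/-- The interpretation of the empty functional vocabulary. -/
def FEnv.nil {A : Type u} : FEnv [] A :=
  fun _ f => nomatch f

/-- Expansion of an interpretation by a function `h` for one more symbol. -/
def FEnv.cons {Γ : List ℕ} {A : Type u} {m : ℕ} (h : (Fin m → A) → ℝ) (ρ : FEnv Γ A) :
    FEnv (m :: Γ) A
  | _, .here => h
  | _, .there f => ρ _ f

/-- The operations on numerical terms. -/
inductive NumOp : Type
  | plus
  | times
  | SUM

/-- The comparison relations between numerical terms. -/
inductive NumRel : Type
  | eq
  | lt
  | le

/-- The relation on the reals denoted by a comparison symbol. -/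
def NumRel.Holds : NumRel → ℝ → ℝ → Prop
  | .eq, a, b => a = b
  | .lt, a, b => a < b
  | .le, a, b => a ≤ b

/-- Numerical terms `i ::= c | f(x⃗) | i + i | i × i | SUM_{y⃗} i`; the term `SUM k i` binds the
last `k` variables of `i`. -/
inductive NumTerm (Γ : List ℕ) : ℕ → Type
  | const {n : ℕ} (c : ℝ) : NumTerm Γ n
  | app {n k : ℕ} (f : FVar Γ k) (x : Fin k → Fin n) : NumTerm Γ n
  | plus {n : ℕ} (i j : NumTerm Γ n) : NumTerm Γ n
  | times {n : ℕ} (i j : NumTerm Γ n) : NumTerm Γ n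
  | SUM {n : ℕ} (k : ℕ) (i : NumTerm Γ (n + k)) : NumTerm Γ n

/-- The value of a numerical term under the assignment `s`. -/
def NumTerm.eval {Γ : List ℕ} {A : Type u} [Fintype A] (ρ : FEnv Γ A) :
    {n : ℕ} → NumTerm Γ n → (Fin n → A) → ℝ
  | _, .const c, _ => c
  | _, .app f x, s => ρ _ f (fun l => s (x l))
  | _, .plus i j, s => i.eval ρ s + j.eval ρ s
  | _, .times i j, s => i.eval ρ s * j.eval ρ s
  | _, .SUM k i, s => ∑ a : Fin k → A, i.eval ρ (Fin.append s a)

/-- The term uses only operations from `O` and constants from `C`. -/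
def NumTerm.Over {Γ : List ℕ} (O : Set NumOp) (C : Set ℝ) : {n : ℕ} → NumTerm Γ n → Prop
  | _, .const c => c ∈ C
  | _, .app _ _ => True
  | _, .plus i j => NumOp.plus ∈ O ∧ i.Over O C ∧ j.Over O C
  | _, .times i j => NumOp.times ∈ O ∧ i.Over O C ∧ j.Over O C
  | _, .SUM _ i => NumOp.SUM ∈ O ∧ i.Over O C

/-- Formulae of existential second-order logic over the reals, of relational vocabulary `τ` and
functional vocabulary `Γ`, with `n` first-order variables in scope. -/
inductive ESO (τ : FirstOrder.Language.{v, w}) : List ℕ → ℕ → Type w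
  | eq {Γ : List ℕ} {n : ℕ} (x y : Fin n) : ESO τ Γ n
  | neq {Γ : List ℕ} {n : ℕ} (x y : Fin n) : ESO τ Γ n
  | num {Γ : List ℕ} {n : ℕ} (e : NumRel) (i j : NumTerm Γ n) : ESO τ Γ n
  | nnum {Γ : List ℕ} {n : ℕ} (e : NumRel) (i j : NumTerm Γ n) : ESO τ Γ n
  | rel {Γ : List ℕ} {n k : ℕ} (R : τ.Relations k) (x : Fin k → Fin n) : ESO τ Γ n
  | nrel {Γ : List ℕ} {n k : ℕ} (R : τ.Relations k) (x : Fin k → Fin n) : ESO τ Γ n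
  | and {Γ : List ℕ} {n : ℕ} (φ ψ : ESO τ Γ n) : ESO τ Γ n
  | or {Γ : List ℕ} {n : ℕ} (φ ψ : ESO τ Γ n) : ESO τ Γ n
  | ex {Γ : List ℕ} {n : ℕ} (φ : ESO τ Γ (n + 1)) : ESO τ Γ n
  | all {Γ : List ℕ} {n : ℕ} (φ : ESO τ Γ (n + 1)) : ESO τ Γ n
  | exF {Γ : List ℕ} {n : ℕ} (k : ℕ) (φ : ESO τ (k :: Γ) n) : ESO τ Γ n

namespace ESO

variable {τ : FirstOrder.Language.{v, w}}

/-- Satisfaction for `ESO_S`: function quantifiers range over the functions `A^k → S`. -/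
def Sat {A : Type u} [τ.Structure A] [Fintype A] (S : Set ℝ) :
    {Γ : List ℕ} → {n : ℕ} → ESO τ Γ n → FEnv Γ A → (Fin n → A) → Prop
  | _, _, .eq x y, _, s => s x = s y
  | _, _, .neq x y, _, s => s x ≠ s y
  | _, _, .num e i j, ρ, s => e.Holds (i.eval ρ s) (j.eval ρ s)
  | _, _, .nnum e i j, ρ, s => ¬ e.Holds (i.eval ρ s) (j.eval ρ s)
  | _, _, .rel R x, _, s => FirstOrder.Language.Structure.RelMap R (fun l => s (x l))
  | _, _, .nrel R x, _, s => ¬ FirstOrder.Language.Structure.RelMap R (fun l => s (x l))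
  | _, _, .and φ ψ, ρ, s => φ.Sat S ρ s ∧ ψ.Sat S ρ s
  | _, _, .or φ ψ, ρ, s => φ.Sat S ρ s ∨ ψ.Sat S ρ s
  | _, n, .ex φ, ρ, s => ∃ a : A, φ.Sat S ρ (Fin.snoc (α := fun _ : Fin (n + 1) => A) s a)
  | _, n, .all φ, ρ, s => ∀ a : A, φ.Sat S ρ (Fin.snoc (α := fun _ : Fin (n + 1) => A) s a)
  | _, _, .exF k φ, ρ, s =>
      ∃ h : (Fin k → A) → ℝ, (∀ a, h a ∈ S) ∧ φ.Sat S (FEnv.cons h ρ) s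

/-- Membership in `ESO[O, E, C]`: numerical terms are built with operations from `O` and constants
from `C`, and are compared by relations from `E`. -/
def Over (O : Set NumOp) (E : Set NumRel) (C : Set ℝ) :
    {Γ : List ℕ} → {n : ℕ} → ESO τ Γ n → Prop
  | _, _, .eq _ _ => True
  | _, _, .neq _ _ => True
  | _, _, .num e i j => e ∈ E ∧ i.Over O C ∧ j.Over O C
  | _, _, .nnum e i j => e ∈ E ∧ i.Over O C ∧ j.Over O C
  | _, _, .rel _ _ => True
  | _, _, .nrel _ _ => True
  | _, _, .and φ ψ => φ.Over O E C ∧ ψ.Over O E C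
  | _, _, .or φ ψ => φ.Over O E C ∧ ψ.Over O E C
  | _, _, .ex φ => φ.Over O E C
  | _, _, .all φ => φ.Over O E C
  | _, _, .exF _ φ => φ.Over O E C

/-- Loose formulae: no negated numerical atoms. -/
def Loose : {Γ : List ℕ} → {n : ℕ} → ESO τ Γ n → Prop
  | _, _, .eq _ _ => True
  | _, _, .neq _ _ => True
  | _, _, .num _ _ _ => True
  | _, _, .nnum _ _ _ => False
  | _, _, .rel _ _ => True
  | _, _, .nrel _ _ => True
  | _, _, .and φ ψ => φ.Loose ∧ ψ.Loose
  | _, _, .or φ ψ => φ.Loose ∧ ψ.Loose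
  | _, _, .ex φ => φ.Loose
  | _, _, .all φ => φ.Loose
  | _, _, .exF _ φ => φ.Loose

/-- No numerical term occurs in the formula. -/
def NumFree : {Γ : List ℕ} → {n : ℕ} → ESO τ Γ n → Prop
  | _, _, .eq _ _ => True
  | _, _, .neq _ _ => True
  | _, _, .num _ _ _ => False
  | _, _, .nnum _ _ _ => False
  | _, _, .rel _ _ => True
  | _, _, .nrel _ _ => True
  | _, _, .and φ ψ => φ.NumFree ∧ ψ.NumFree
  | _, _, .or φ ψ => φ.NumFree ∧ ψ.NumFree
  | _, _, .ex φ => φ.NumFree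
  | _, _, .all φ => φ.NumFree
  | _, _, .exF _ φ => φ.NumFree

/-- Almost conjunctive formulae: in every disjunctive subformula, one of the two disjuncts contains
no numerical term. -/
def AlmostConjunctive : {Γ : List ℕ} → {n : ℕ} → ESO τ Γ n → Prop
  | _, _, .eq _ _ => True
  | _, _, .neq _ _ => True
  | _, _, .num _ _ _ => True
  | _, _, .nnum _ _ _ => True
  | _, _, .rel _ _ => True
  | _, _, .nrel _ _ => True
  | _, _, .and φ ψ => φ.AlmostConjunctive ∧ ψ.AlmostConjunctive
  | _, _, .or φ ψ =>
      (φ.NumFree ∨ ψ.NumFree) ∧ φ.AlmostConjunctive ∧ ψ.AlmostConjunctive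
  | _, _, .ex φ => φ.AlmostConjunctive
  | _, _, .all φ => φ.AlmostConjunctive
  | _, _, .exF _ φ => φ.AlmostConjunctive

/-- Formulae without quantifiers of either kind. -/
def QFree : {Γ : List ℕ} → {n : ℕ} → ESO τ Γ n → Prop
  | _, _, .eq _ _ => True
  | _, _, .neq _ _ => True
  | _, _, .num _ _ _ => True
  | _, _, .nnum _ _ _ => True
  | _, _, .rel _ _ => True
  | _, _, .nrel _ _ => True
  | _, _, .and φ ψ => φ.QFree ∧ ψ.QFree
  | _, _, .or φ ψ => φ.QFree ∧ ψ.QFree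
  | _, _, .ex _ => False
  | _, _, .all _ => False
  | _, _, .exF _ _ => False

/-- Prefix form with quantifier prefix `∀*` (first-order universal quantifiers). -/
inductive PrefixAll : {Γ : List ℕ} → {n : ℕ} → ESO τ Γ n → Prop
  | qfree {Γ : List ℕ} {n : ℕ} {φ : ESO τ Γ n} (h : φ.QFree) : PrefixAll φ
  | all {Γ : List ℕ} {n : ℕ} {φ : ESO τ Γ (n + 1)} (h : PrefixAll φ) : PrefixAll φ.all

/-- Prefix form with quantifier prefix `∃̈*∀*`: existential function quantifiers followed by
first-order universal quantifiers. -/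
inductive PrefixExFAll : {Γ : List ℕ} → {n : ℕ} → ESO τ Γ n → Prop
  | base {Γ : List ℕ} {n : ℕ} {φ : ESO τ Γ n} (h : PrefixAll φ) : PrefixExFAll φ
  | exF {Γ : List ℕ} {n k : ℕ} {φ : ESO τ (k :: Γ) n} (h : PrefixExFAll φ) :
      PrefixExFAll (ESO.exF k φ)

end ESO

/-! ### Probabilistic team semantics -/

/-- Probabilistic teams with variable domain `x₁, …, xₙ` and value domain `A`: a team is given by
the weights of all assignments `Fin n → A` (weight `0` for assignments outside the team).  It is
either a probability distribution, or the empty team, all of whose weights are `0`. -/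
def IsProbTeam {A : Type u} [Fintype A] {n : ℕ} (X : (Fin n → A) → ℝ) : Prop :=
  X ∈ stdSimplex ℝ (Fin n → A) ∨ ∀ s, X s = 0

/-- The kinds of dependency atoms: marginal identity atoms and dependence atoms. -/
inductive AtomKind : Type
  | marginalIdentity
  | dependence

/-- First-order logic in negation normal form with marginal identity atoms `x⃗ ≈ y⃗` and
dependence atoms `dep(x⃗, y)`, with free variables among the `n` variables in scope. -/
inductive TeamForm (τ : FirstOrder.Language.{v, w}) : ℕ → Type w
  | eq {n : ℕ} (x y : Fin n) : TeamForm τ n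
  | neq {n : ℕ} (x y : Fin n) : TeamForm τ n
  | rel {n k : ℕ} (R : τ.Relations k) (x : Fin k → Fin n) : TeamForm τ n
  | nrel {n k : ℕ} (R : τ.Relations k) (x : Fin k → Fin n) : TeamForm τ n
  | marginalIdentity {n k : ℕ} (x y : Fin k → Fin n) : TeamForm τ n
  | dependence {n k : ℕ} (x : Fin k → Fin n) (y : Fin n) : TeamForm τ n
  | and {n : ℕ} (φ ψ : TeamForm τ n) : TeamForm τ n
  | or {n : ℕ} (φ ψ : TeamForm τ n) : TeamForm τ n
  | ex {n : ℕ} (φ : TeamForm τ (n + 1)) : TeamForm τ n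
  | all {n : ℕ} (φ : TeamForm τ (n + 1)) : TeamForm τ n

namespace TeamForm

variable {τ : FirstOrder.Language.{v, w}}

open Classical in
/-- Probabilistic team semantics.  Literals and dependence atoms speak about the assignments in the
support of the team; `∀` passes to the team `X[A/x]`, and `∃` to some probabilistic team whose
projection to the old variables is `X`. -/
noncomputable def Sat {A : Type u} [τ.Structure A] [Fintype A] :
    {n : ℕ} → TeamForm τ n → ((Fin n → A) → ℝ) → Prop
  | _, .eq x y, X => ∀ s, 0 < X s → s x = s y
  | _, .neq x y, X => ∀ s, 0 < X s → s x ≠ s y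
  | _, .rel R x, X => ∀ s, 0 < X s → FirstOrder.Language.Structure.RelMap R (fun l => s (x l))
  | _, .nrel R x, X => ∀ s, 0 < X s → ¬ FirstOrder.Language.Structure.RelMap R (fun l => s (x l))
  | n, .marginalIdentity (k := k) x y, X => ∀ a : Fin k → A,
      (∑ s : Fin n → A with (fun l => s (x l)) = a, X s) =
        ∑ s : Fin n → A with (fun l => s (y l)) = a, X s
  | _, .dependence x y, X => ∀ s s', 0 < X s → 0 < X s' →
      (∀ l, s (x l) = s' (x l)) → s y = s' y
  | _, .and φ ψ, X => φ.Sat X ∧ ψ.Sat X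
  | n, .or φ ψ, X => ∃ (Y Z : (Fin n → A) → ℝ) (α : ℝ),
      IsProbTeam Y ∧ IsProbTeam Z ∧ α ∈ Set.Icc (0 : ℝ) 1 ∧
        (∀ s, α * Y s + (1 - α) * Z s = X s) ∧ φ.Sat Y ∧ ψ.Sat Z
  | n, .ex φ, X => ∃ Y : (Fin (n + 1) → A) → ℝ, IsProbTeam Y ∧
      (∀ s : Fin n → A, ∑ a : A, Y (Fin.snoc (α := fun _ : Fin (n + 1) => A) s a) = X s) ∧
        φ.Sat Y
  | n, .all φ, X => φ.Sat
      (fun t : Fin (n + 1) → A => X (Fin.init (α := fun _ : Fin (n + 1) => A) t) / Fintype.card A)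

/-- All dependency atoms of the formula are of a kind in `D`. -/
def AtomsIn (D : Set AtomKind) : {n : ℕ} → TeamForm τ n → Prop
  | _, .eq _ _ => True
  | _, .neq _ _ => True
  | _, .rel _ _ => True
  | _, .nrel _ _ => True
  | _, .marginalIdentity _ _ => AtomKind.marginalIdentity ∈ D
  | _, .dependence _ _ => AtomKind.dependence ∈ D
  | _, .and φ ψ => φ.AtomsIn D ∧ ψ.AtomsIn D
  | _, .or φ ψ => φ.AtomsIn D ∧ ψ.AtomsIn D
  | _, .ex φ => φ.AtomsIn D
  | _, .all φ => φ.AtomsIn D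

end TeamForm

/-! ### Expressivity comparison -/

/-- `d[0,1]`-structures of vocabulary `τ ∪ {f}` with `f` of arity `n`: finite `τ`-structures with at
least two elements, together with a probability distribution `f` on `A^n`. -/
structure DStruc (τ : FirstOrder.Language.{v, w}) (n : ℕ) : Type (max (u + 1) v w) where
  /-- the universe of the structure -/
  A : Type u
  [str : τ.Structure A]
  [fin : Fintype A]
  [nontriv : Nontrivial A]
  /-- the interpretation of the function symbol -/
  f : (Fin n → A) → ℝ
  dist : f ∈ stdSimplex ℝ (Fin n → A)

attribute [instance] DStruc.str DStruc.fin DStruc.nontriv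

/-- The class `Struc_{d[0,1]}(φ)` of a team formula with free variables `x₁, …, xₙ`: the structures
whose distribution `f`, read as a probabilistic team, satisfies `φ`. -/
def TeamForm.Struc {τ : FirstOrder.Language.{v, w}} {n : ℕ} (φ : TeamForm τ n) : Set (DStruc.{u} τ n) :=
  {M | φ.Sat M.f}

/-- The class `Struc_{d[0,1]}(ψ)` of an `ESO_S`-formula of vocabulary `τ ∪ {f}`, `f` of arity `n`,
without free first-order variables. -/
def ESO.Struc {τ : FirstOrder.Language.{v, w}} {n : ℕ} (S : Set ℝ) (ψ : ESO τ [n] 0) :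
    Set (DStruc.{u} τ n) :=
  {M | ψ.Sat S (FEnv.cons M.f FEnv.nil) Fin.elim0}

/-- The logic `FO(D)`: first-order logic with dependency atoms of the kinds in `D`. -/
def FO (τ : FirstOrder.Language.{v, w}) (n : ℕ) (D : Set AtomKind) : Set (TeamForm τ n) :=
  {φ | φ.AtomsIn D}

/-- The loose fragment of `ESO[O, E, C]`, over the vocabulary `τ ∪ {f}` with `f` of arity `n`. -/
def LooseESO (τ : FirstOrder.Language.{v, w}) (n : ℕ) (O : Set NumOp) (E : Set NumRel) (C : Set ℝ) :
    Set (ESO τ [n] 0) :=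
  {ψ | ψ.Over O E C ∧ ψ.Loose}

/-- The almost conjunctive formulae with prefix `∃̈*∀*` in the loose fragment of `ESO[O, E, C]`. -/
def AlmostConjLooseEA (τ : FirstOrder.Language.{v, w}) (n : ℕ) (O : Set NumOp) (E : Set NumRel)
    (C : Set ℝ) : Set (ESO τ [n] 0) :=
  {ψ | ψ ∈ LooseESO τ n O E C ∧ ψ.AlmostConjunctive ∧ ψ.PrefixExFAll}

/-- A team logic and a sublogic of `ESO_S` define the same classes of `d[0,1]`-structures. -/
def Equiexpressive {τ : FirstOrder.Language.{v, w}} {n : ℕ} (L : Set (TeamForm τ n)) (S : Set ℝ)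
    (L' : Set (ESO τ [n] 0)) : Prop :=
  (∀ φ ∈ L, ∃ ψ ∈ L', TeamForm.Struc.{u} φ = ESO.Struc.{u} S ψ) ∧
    (∀ ψ ∈ L', ∃ φ ∈ L, TeamForm.Struc.{u} φ = ESO.Struc.{u} S ψ)

end ProbTeam

/-! Team semantics is homogeneous, so it extends to nonnegative weights of any total mass. A
disjunction then just splits `X = Y + Z`, the coefficients `α` and `1 - α` being absorbed in the
weights (`TeamForm.sat_iff_wsat`).

From second-order logic to teams: terms without products are affine in the functions, so they
commute with averaging. Let `v` be the tuple of team variables that holds the current first-order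
values. Every assignment contributes a crude interpretation of the function symbols (`pointEnv`),
and the team encodes at `c` the conditional expectation of these contributions given `v = c`
(`Encodes`). At a single assignment a term is, up to a positive factor depending only on the
structure, the probability of a quantifier-free event over fresh uniform variables (`repUpTo_eval`).
Marginal identity compares such probabilities conditionally on `v` (`exists_compare`), and this
yields numerical equations (`TeamDef.num`). A quantified function is encoded by the conditional
probability that two fresh variables agree (`TeamDef.exF`), and a universal quantifier adds an
independent uniform variable. An existential first-order quantifier or a disjunction of numerical
conditions makes a choice, which respects the encoding if it is a function of `v`. A dependence atom
enforces this in (i). In (ii) there are no such quantifiers, and each disjunction has a side without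
numerical terms, whose truth is already determined by `v` (`TeamDef.flat_or`).

From teams to second-order logic: the weights of a team form a function into the unit interval, and
satisfaction reduces to conjunction, function quantification, guarded equations and sums over one
variable (`SumLogic`, `SumLogic.exists_wsat`). Pointwise addition and marginals are derived from
these. Prefix formulae with `SUM` have these closure properties after prenexing
(`PrefixDef.sumLogic`). Loose formulae with `+` have them because a sum can be computed by partial
sums along a guessed linear order (`LooseDef.sum`). Only dependence atoms require a disjunction of
numerical atoms, and they are absent in (ii). -/

namespace ProbTeam

/-! ### Sums over assignments -/

section Sums

variable {A : Type u} [Fintype A]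

/-- The assignment `s` extended by the value `a` for one more variable. -/
abbrev ext {A : Type u} {n : ℕ} (s : Fin n → A) (a : A) : Fin (n + 1) → A :=
  Fin.snoc (α := fun _ : Fin (n + 1) => A) s a

/-- The restriction of an assignment to all variables but the last. -/
abbrev restr {A : Type u} {n : ℕ} (t : Fin (n + 1) → A) : Fin n → A :=
  Fin.init (α := fun _ : Fin (n + 1) => A) t

theorem sum_ext {M : Type*} [AddCommMonoid M] {n : ℕ} (F : (Fin (n + 1) → A) → M) :
    ∑ t, F t = ∑ s : Fin n → A, ∑ a, F (ext s a) := by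
  rw [← (Fin.snocEquiv (fun _ : Fin (n + 1) => A)).sum_comp F, Fintype.sum_prod_type_right]
  rfl

theorem forall_ext {A : Type u} {n : ℕ} {P : (Fin (n + 1) → A) → Prop} :
    (∀ t, P t) ↔ ∀ s a, P (ext s a) :=
  ⟨fun h s a => h _, fun h t => by simpa using h (restr t) (t (Fin.last n))⟩

theorem ext_comp_castSucc {A : Type u} {n : ℕ} (s : Fin n → A) (a : A) :
    (fun l => ext s a (Fin.castSucc l)) = s := by
  funext l; simp

/-- If `Y` projects to `X`, sums over `Y` of functions of the old variables are sums over `X`. -/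
theorem sum_mul_restr {n : ℕ} {X : (Fin n → A) → ℝ} {Y : (Fin (n + 1) → A) → ℝ}
    (h : ∀ s, ∑ a, Y (ext s a) = X s) (F : (Fin n → A) → ℝ) :
    ∑ t, Y t * F (restr t) = ∑ s, X s * F s := by
  rw [sum_ext]
  refine Finset.sum_congr rfl fun s _ => ?_
  simp [← h, Finset.sum_mul]

theorem sum_eq_of_proj {n : ℕ} {X : (Fin n → A) → ℝ} {Y : (Fin (n + 1) → A) → ℝ}
    (h : ∀ s, ∑ a, Y (ext s a) = X s) : ∑ t, Y t = ∑ s, X s := by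
  simpa using sum_mul_restr h (fun _ => 1)

/-- The weights `X[A/x]`. -/
noncomputable def unif {n : ℕ} (X : (Fin n → A) → ℝ) (t : Fin (n + 1) → A) : ℝ :=
  X (restr t) / Fintype.card A

@[simp] theorem unif_ext {n : ℕ} (X : (Fin n → A) → ℝ) (s : Fin n → A) (a : A) :
    unif X (ext s a) = X s / Fintype.card A := by
  simp [unif]

theorem unif_proj [Nonempty A] {n : ℕ} (X : (Fin n → A) → ℝ) (s : Fin n → A) :
    ∑ a, unif X (ext s a) = X s := by
  simp
  field_simp

theorem unif_nonneg {n : ℕ} {X : (Fin n → A) → ℝ} (h : ∀ s, 0 ≤ X s) (t : Fin (n + 1) → A) :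
    0 ≤ unif X t :=
  div_nonneg (h _) (Nat.cast_nonneg _)

end Sums

/-! ### Team semantics for arbitrary weights -/

namespace TeamForm

variable {τ : FirstOrder.Language.{v, w}}

open Classical in
/-- Team semantics for teams given by arbitrary nonnegative weights. -/
noncomputable def WSat {A : Type u} [τ.Structure A] [Fintype A] :
    {n : ℕ} → TeamForm τ n → ((Fin n → A) → ℝ) → Prop
  | _, .eq x y, X => ∀ s, 0 < X s → s x = s y
  | _, .neq x y, X => ∀ s, 0 < X s → s x ≠ s y
  | _, .rel R x, X => ∀ s, 0 < X s → FirstOrder.Language.Structure.RelMap R (fun l => s (x l))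
  | _, .nrel R x, X => ∀ s, 0 < X s → ¬ FirstOrder.Language.Structure.RelMap R (fun l => s (x l))
  | n, .marginalIdentity (k := k) x y, X => ∀ a : Fin k → A,
      (∑ s : Fin n → A with (fun l => s (x l)) = a, X s) =
        ∑ s : Fin n → A with (fun l => s (y l)) = a, X s
  | _, .dependence x y, X => ∀ s s', 0 < X s → 0 < X s' →
      (∀ l, s (x l) = s' (x l)) → s y = s' y
  | _, .and φ ψ, X => φ.WSat X ∧ ψ.WSat X
  | n, .or φ ψ, X => ∃ Y Z : (Fin n → A) → ℝ,
      (∀ s, 0 ≤ Y s) ∧ (∀ s, 0 ≤ Z s) ∧ (∀ s, Y s + Z s = X s) ∧ φ.WSat Y ∧ ψ.WSat Z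
  | n, .ex φ, X => ∃ Y : (Fin (n + 1) → A) → ℝ, (∀ t, 0 ≤ Y t) ∧
      (∀ s : Fin n → A, ∑ a : A, Y (ext s a) = X s) ∧ φ.WSat Y
  | _, .all φ, X => φ.WSat (unif X)

variable {A : Type u} [τ.Structure A] [Fintype A]

/-- The empty team property. It covers the degenerate disjunctions in which one part has mass zero.
-/
theorem wsat_zero {n : ℕ} (φ : TeamForm τ n) : φ.WSat (A := A) (fun _ => 0) := by
  induction φ with
  | or φ ψ ihφ ihψ => exact ⟨_, _, fun _ => le_rfl, fun _ => le_rfl, by simp, ihφ, ihψ⟩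
  | ex φ ih => exact ⟨_, fun _ => le_rfl, by simp, ih⟩
  | all φ ih =>
    simp only [WSat]
    convert ih using 2
    simp [unif]
  | and φ ψ ihφ ihψ => exact ⟨ihφ, ihψ⟩
  | _ => simp [WSat]

/-- Literals and dependence atoms see only the support, marginal identity is a homogeneous linear
equation, and the witnesses of the other clauses scale along. -/
theorem wsat_smul_of {n : ℕ} (φ : TeamForm τ n) {c : ℝ} (hc : 0 < c) {X : (Fin n → A) → ℝ}
    (h : φ.WSat X) : φ.WSat (fun s => c * X s) := by
  induction φ with
  | or φ ψ ihφ ihψ =>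
    obtain ⟨Y, Z, hY, hZ, hs, h1, h2⟩ := h
    exact ⟨_, _, fun s => mul_nonneg hc.le (hY s), fun s => mul_nonneg hc.le (hZ s),
      fun s => by rw [← mul_add, hs], ihφ h1, ihψ h2⟩
  | ex φ ih =>
    obtain ⟨Y, hY, hs, h1⟩ := h
    exact ⟨_, fun s => mul_nonneg hc.le (hY s), fun s => by rw [← Finset.mul_sum, hs], ih h1⟩
  | all φ ih =>
    have := ih h
    simp only [WSat]
    convert this using 2
    simp [unif, mul_div_assoc]
  | and φ ψ ihφ ihψ => exact ⟨ihφ h.1, ihψ h.2⟩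
  | marginalIdentity x y =>
    intro a
    rw [← Finset.mul_sum, ← Finset.mul_sum, h a]
  | _ => simpa [WSat, hc] using h

end TeamForm

theorem IsProbTeam.nonneg {A : Type u} [Fintype A] {n : ℕ} {X : (Fin n → A) → ℝ}
    (h : IsProbTeam X) (s : Fin n → A) : 0 ≤ X s := by
  rcases h with h | h
  · exact h.1 s
  · exact (h s).ge

/-- Projections preserve total mass, so witnesses for quantifiers over a probabilistic team are
automatically probabilistic teams. -/
theorem isProbTeam_of_sum {A B : Type*} [Fintype A] [Fintype B] {n m : ℕ}
    {X : (Fin n → A) → ℝ} {Y : (Fin m → B) → ℝ}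
    (h : IsProbTeam X) (hY : ∀ s, 0 ≤ Y s) (hs : ∑ s, Y s = ∑ s, X s) : IsProbTeam Y := by
  rcases h with h | h
  · exact Or.inl ⟨hY, by rw [hs, h.2]⟩
  · right
    simp only [h, Finset.sum_const_zero] at hs
    intro s
    exact (Finset.sum_eq_zero_iff_of_nonneg (fun s _ => hY s)).1 hs s (Finset.mem_univ _)

namespace TeamForm

variable {τ : FirstOrder.Language.{v, w}} {A : Type u} [τ.Structure A] [Fintype A]

/-- A set of weights of total mass at most one is a multiple of a probabilistic team satisfying the
same formulae. -/
theorem exists_isProbTeam_smul {n : ℕ} (φ : TeamForm τ n) {Y : (Fin n → A) → ℝ}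
    (hY : ∀ s, 0 ≤ Y s) (h : φ.WSat Y) :
    ∃ Y' : (Fin n → A) → ℝ, IsProbTeam Y' ∧ φ.WSat Y' ∧ ∀ s, (∑ s, Y s) * Y' s = Y s := by
  rcases (Finset.sum_nonneg fun s _ => hY s).eq_or_lt with h0 | h0
  · refine ⟨fun _ => 0, Or.inr fun _ => rfl, φ.wsat_zero, fun s => ?_⟩
    rw [mul_zero]
    exact ((Finset.sum_eq_zero_iff_of_nonneg (fun s _ => hY s)).1 h0.symm s (Finset.mem_univ _)).symm
  · refine ⟨_, Or.inl ⟨fun s => ?_, ?_⟩, φ.wsat_smul_of (inv_pos.2 h0) h, fun s => ?_⟩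
    · exact mul_nonneg (inv_pos.2 h0).le (hY s)
    · rw [← Finset.mul_sum, inv_mul_cancel₀ h0.ne']
    · rw [← mul_assoc, mul_inv_cancel₀ h0.ne', one_mul]

/-- Only disjunction needs an argument: `α` is the mass of the left part of the splitting, and both
parts are normalised by their masses. -/
theorem sat_iff_wsat [Nonempty A] {n : ℕ} (φ : TeamForm τ n) {X : (Fin n → A) → ℝ}
    (hX : IsProbTeam X) : φ.Sat X ↔ φ.WSat X := by
  induction φ with
  | and φ ψ ihφ ihψ => simp only [Sat, WSat, ihφ hX, ihψ hX]
  | or φ ψ ihφ ihψ =>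
    constructor
    · rintro ⟨Y, Z, α, hY, hZ, hα, hs, h1, h2⟩
      have key : ∀ {n : ℕ} (χ : TeamForm τ n) (c : ℝ) (W : (Fin n → A) → ℝ), 0 ≤ c → χ.WSat W →
          χ.WSat (fun s => c * W s) := by
        intro n χ c W hc hW
        rcases hc.eq_or_lt with rfl | hc
        · simpa using χ.wsat_zero
        · exact χ.wsat_smul_of hc hW
      exact ⟨_, _, fun s => mul_nonneg hα.1 (hY.nonneg s),
        fun s => mul_nonneg (sub_nonneg.2 hα.2) (hZ.nonneg s), hs,
        key φ _ _ hα.1 ((ihφ hY).1 h1), key ψ _ _ (sub_nonneg.2 hα.2) ((ihψ hZ).1 h2)⟩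
    · rintro ⟨Y, Z, hY, hZ, hs, h1, h2⟩
      obtain ⟨Y', hY', h1', hYs⟩ := exists_isProbTeam_smul φ hY h1
      obtain ⟨Z', hZ', h2', hZs⟩ := exists_isProbTeam_smul ψ hZ h2
      have hsum : ∑ s, Y s + ∑ s, Z s = ∑ s, X s := by
        rw [← Finset.sum_add_distrib]; simp [hs]
      have h0 : 0 ≤ ∑ s, Y s := Finset.sum_nonneg fun s _ => hY s
      have h0' : 0 ≤ ∑ s, Z s := Finset.sum_nonneg fun s _ => hZ s
      rcases hX with hX | hX
      · rw [hX.2] at hsum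
        refine ⟨Y', Z', ∑ s, Y s, hY', hZ', ⟨h0, by linarith⟩, fun s => ?_,
          (ihφ hY').2 h1', (ihψ hZ').2 h2'⟩
        rw [show 1 - ∑ s, Y s = ∑ s, Z s by linarith, hYs, hZs, hs]
      · have hX0 : X = fun _ => 0 := funext hX
        have hP : IsProbTeam X := Or.inr hX
        exact ⟨X, X, 0, hP, hP, ⟨le_rfl, zero_le_one⟩, by simp,
          (ihφ hP).2 (hX0 ▸ φ.wsat_zero), (ihψ hP).2 (hX0 ▸ ψ.wsat_zero)⟩
  | ex φ ih =>
    constructor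
    · rintro ⟨Y, hY, hs, h⟩
      exact ⟨Y, hY.nonneg, hs, (ih hY).1 h⟩
    · rintro ⟨Y, hY, hs, h⟩
      have hY' : IsProbTeam Y := isProbTeam_of_sum hX hY (sum_eq_of_proj hs)
      exact ⟨Y, hY', hs, (ih hY').2 h⟩
  | all φ ih =>
    exact ih (isProbTeam_of_sum hX (unif_nonneg hX.nonneg) (sum_eq_of_proj (unif_proj X)))
  | _ => exact Iff.rfl

theorem atomsIn_mono {D D' : Set AtomKind} (hD : D ⊆ D') {n : ℕ} {φ : TeamForm τ n}
    (h : φ.AtomsIn D) : φ.AtomsIn D' := by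
  induction φ with
  | marginalIdentity x y => exact hD h
  | dependence x y => exact hD h
  | and φ ψ ihφ ihψ => exact ⟨ihφ h.1, ihψ h.2⟩
  | or φ ψ ihφ ihψ => exact ⟨ihφ h.1, ihψ h.2⟩
  | ex φ ih => exact ih h
  | all φ ih => exact ih h
  | _ => trivial

end TeamForm

/-! ### Quantifier-free events -/

/-- Properties of assignments for `m` variables, uniformly in the structure. -/
abbrev Event (τ : FirstOrder.Language.{v, w}) (m : ℕ) :=
  ∀ (A : Type u) [τ.Structure A] [Fintype A] [Nontrivial A], (Fin m → A) → Prop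

/-- The events definable by quantifier-free first-order formulae. -/
inductive Flat (τ : FirstOrder.Language.{v, w}) : (m : ℕ) → Event.{u} τ m → Prop
  | top {m : ℕ} : Flat τ m (fun _ _ _ _ _ => True)
  | eq {m : ℕ} (x y : Fin m) : Flat τ m (fun _ _ _ _ s => s x = s y)
  | rel {m k : ℕ} (R : τ.Relations k) (x : Fin k → Fin m) :
      Flat τ m (fun _ _ _ _ s => FirstOrder.Language.Structure.RelMap R (fun l => s (x l)))
  | and {m : ℕ} {E F : Event.{u} τ m} (hE : Flat τ m E) (hF : Flat τ m F) :
      Flat τ m (fun A _ _ _ s => E A s ∧ F A s)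
  | not {m : ℕ} {E : Event.{u} τ m} (hE : Flat τ m E) : Flat τ m (fun A _ _ _ s => ¬ E A s)

namespace Flat

variable {τ : FirstOrder.Language.{v, w}} {m : ℕ} {E F : Event.{u} τ m}

theorem congr (hE : Flat τ m E)
    (h : ∀ (A : Type u) [τ.Structure A] [Fintype A] [Nontrivial A] (s : Fin m → A),
      E A s ↔ F A s) : Flat τ m F := by
  have : E = F := by
    funext A _ _ _ s
    exact propext (h A s)
  exact this ▸ hE

theorem or (hE : Flat τ m E) (hF : Flat τ m F) : Flat τ m (fun A _ _ _ s => E A s ∨ F A s) :=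
  (hE.not.and hF.not).not.congr fun A _ _ _ s => by tauto

theorem iff (hE : Flat τ m E) (hF : Flat τ m F) : Flat τ m (fun A _ _ _ s => (E A s ↔ F A s)) :=
  ((hE.and hF).or (hE.not.and hF.not)).congr fun A _ _ _ s => by tauto

theorem comap (hE : Flat τ m E) {m' : ℕ} (v : Fin m → Fin m') :
    Flat τ m' (fun A _ _ _ s => E A (fun l => s (v l))) := by
  induction hE with
  | top => exact .top
  | eq x y => exact .eq _ _
  | rel R x => exact .rel R _
  | and _ _ ihE ihF => exact ihE.and ihF
  | not _ ih => exact ih.not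

theorem tupleEq {k : ℕ} (x y : Fin k → Fin m) :
    Flat τ m (fun _ _ _ _ s => ∀ l, s (x l) = s (y l)) := by
  induction k with
  | zero => exact Flat.top.congr fun A _ _ _ s => by simp
  | succ k ih =>
    exact ((Flat.eq (x 0) (y 0)).and (ih (fun l => x l.succ) (fun l => y l.succ))).congr
      fun A _ _ _ s => by simp [Fin.forall_fin_succ]

/-- Flat events and their complements are definable in team logic. -/
theorem exists_teamForm (hE : Flat τ m E) :
    (∃ χ : TeamForm τ m, χ.AtomsIn ∅ ∧
      ∀ (A : Type u) [τ.Structure A] [Fintype A] [Nontrivial A] (Y : (Fin m → A) → ℝ),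
        (∀ s, 0 ≤ Y s) → (χ.WSat Y ↔ ∀ s, 0 < Y s → E A s)) ∧
    ∃ χ : TeamForm τ m, χ.AtomsIn ∅ ∧
      ∀ (A : Type u) [τ.Structure A] [Fintype A] [Nontrivial A] (Y : (Fin m → A) → ℝ),
        (∀ s, 0 ≤ Y s) → (χ.WSat Y ↔ ∀ s, 0 < Y s → ¬ E A s) := by
  induction hE with
  | top =>
    -- For `m = 0` there is no variable to form a literal with, so a quantifier supplies one.
    refine ⟨⟨.all (.eq (Fin.last m) (Fin.last m)), trivial, fun A _ _ _ Y hY => ?_⟩,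
      ⟨.all (.neq (Fin.last m) (Fin.last m)), trivial, fun A _ _ _ Y hY => ?_⟩⟩
    · simp [TeamForm.WSat]
    · have : (0 : ℝ) < Fintype.card A := by exact_mod_cast Fintype.card_pos
      simp [TeamForm.WSat, forall_ext, div_le_iff₀ this]
  | eq x y => exact ⟨⟨.eq x y, trivial, fun A _ _ _ Y hY => Iff.rfl⟩,
      ⟨.neq x y, trivial, fun A _ _ _ Y hY => Iff.rfl⟩⟩
  | rel R x => exact ⟨⟨.rel R x, trivial, fun A _ _ _ Y hY => Iff.rfl⟩,
      ⟨.nrel R x, trivial, fun A _ _ _ Y hY => Iff.rfl⟩⟩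
  | not _ ih =>
    obtain ⟨h1, χ, hχ, h⟩ := ih
    refine ⟨⟨χ, hχ, h⟩, ?_⟩
    simpa only [not_not] using h1
  | @and E F _ _ ihE ihF =>
    obtain ⟨⟨χ, hχ, h⟩, χ', hχ', h'⟩ := ihE
    obtain ⟨⟨θ, hθ, g⟩, θ', hθ', g'⟩ := ihF
    refine ⟨⟨.and χ θ, ⟨hχ, hθ⟩, fun A _ _ _ Y hY => ?_⟩,
      ⟨.or χ' θ', ⟨hχ', hθ'⟩, fun A _ _ _ Y hY => ?_⟩⟩
    · simp only [TeamForm.WSat, h A Y hY, g A Y hY]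
      exact ⟨fun H s hs => ⟨H.1 s hs, H.2 s hs⟩,
        fun H => ⟨fun s hs => (H s hs).1, fun s hs => (H s hs).2⟩⟩
    · constructor
      · rintro ⟨Y1, Y2, h1, h2, hs, H1, H2⟩ s hY ⟨hE, hF⟩
        rw [h' A Y1 h1] at H1
        rw [g' A Y2 h2] at H2
        have a1 : Y1 s ≤ 0 := not_lt.1 fun h => H1 s h hE
        have a2 : Y2 s ≤ 0 := not_lt.1 fun h => H2 s h hF
        have := hs s
        linarith
      · intro H
        classical
        -- Assignments satisfying `E` must violate `F`, so they go to the right part and all others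
        -- to the left.
        refine ⟨fun s => if E A s then 0 else Y s, fun s => if E A s then Y s else 0,
          fun s => ?_, fun s => ?_, fun s => ?_, (h' A _ ?_).2 fun s hs => ?_,
          (g' A _ ?_).2 fun s hs => ?_⟩
        · beta_reduce; split_ifs <;> simp [hY]
        · beta_reduce; split_ifs <;> simp [hY]
        · beta_reduce; split_ifs <;> simp
        · intro s; split_ifs <;> simp [hY]
        · intro h; simp [h] at hs
        · intro s; split_ifs <;> simp [hY]
        · intro h
          by_cases hE : E A s
          · simp only [hE, if_true] at hs
            exact H s hs ⟨hE, h⟩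
          · simp [hE] at hs

/-- Flat events and their complements are definable by quantifier-free formulae without numerical
terms, given a spare variable. -/
theorem exists_eso (hE : Flat τ m E) (Γ : List ℕ) (S : Set ℝ) :
    (∃ θ : ESO τ Γ (m + 1), θ.NumFree ∧ θ.QFree ∧
      ∀ (A : Type u) [τ.Structure A] [Fintype A] [Nontrivial A] (ρ : FEnv Γ A) (s : Fin (m + 1) → A),
        θ.Sat S ρ s ↔ E A (restr s)) ∧
    ∃ θ : ESO τ Γ (m + 1), θ.NumFree ∧ θ.QFree ∧
      ∀ (A : Type u) [τ.Structure A] [Fintype A] [Nontrivial A] (ρ : FEnv Γ A) (s : Fin (m + 1) → A),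
        θ.Sat S ρ s ↔ ¬ E A (restr s) := by
  induction hE with
  | top =>
    exact ⟨⟨.eq (Fin.last m) (Fin.last m), trivial, trivial, fun A _ _ _ ρ s => by simp [ESO.Sat]⟩,
      ⟨.neq (Fin.last m) (Fin.last m), trivial, trivial, fun A _ _ _ ρ s => by simp [ESO.Sat]⟩⟩
  | eq x y =>
    exact ⟨⟨.eq x.castSucc y.castSucc, trivial, trivial, fun A _ _ _ ρ s => Iff.rfl⟩,
      ⟨.neq x.castSucc y.castSucc, trivial, trivial, fun A _ _ _ ρ s => Iff.rfl⟩⟩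
  | rel R x =>
    exact ⟨⟨.rel R fun l => (x l).castSucc, trivial, trivial, fun A _ _ _ ρ s => Iff.rfl⟩,
      ⟨.nrel R fun l => (x l).castSucc, trivial, trivial, fun A _ _ _ ρ s => Iff.rfl⟩⟩
  | not _ ih =>
    obtain ⟨h1, h2⟩ := ih
    refine ⟨h2, ?_⟩
    simpa only [not_not] using h1
  | and _ _ ihE ihF =>
    obtain ⟨⟨χ, a1, a2, h⟩, χ', a1', a2', h'⟩ := ihE
    obtain ⟨⟨θ, b1, b2, g⟩, θ', b1', b2', g'⟩ := ihF
    refine ⟨⟨.and χ θ, ⟨a1, b1⟩, ⟨a2, b2⟩, fun A _ _ _ ρ s => ?_⟩,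
      ⟨.or χ' θ', ⟨a1', b1'⟩, ⟨a2', b2'⟩, fun A _ _ _ ρ s => ?_⟩⟩
    · simp only [ESO.Sat, h, g]
    · simp only [ESO.Sat, h', g']
      tauto

end Flat

/-- Needed for the disjunct without numerical terms in an almost conjunctive formula: its truth does
not depend on the interpretation of the function symbols. -/
theorem ESO.flat_of_qFree {τ : FirstOrder.Language.{v, w}} {Γ : List ℕ} {n : ℕ} (φ : ESO τ Γ n)
    (hN : φ.NumFree) (hQ : φ.QFree) :
    ∃ E : Event.{u} τ n, Flat τ n E ∧
      ∀ (A : Type u) [τ.Structure A] [Fintype A] [Nontrivial A] (S : Set ℝ) (ρ : FEnv Γ A)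
        (s : Fin n → A), φ.Sat S ρ s ↔ E A s := by
  induction φ with
  | eq x y => exact ⟨_, .eq x y, fun _ _ _ _ _ _ _ => Iff.rfl⟩
  | neq x y => exact ⟨_, (Flat.eq x y).not, fun _ _ _ _ _ _ _ => Iff.rfl⟩
  | rel R x => exact ⟨_, .rel R x, fun _ _ _ _ _ _ _ => Iff.rfl⟩
  | nrel R x => exact ⟨_, (Flat.rel R x).not, fun _ _ _ _ _ _ _ => Iff.rfl⟩
  | and φ ψ ihφ ihψ =>
    obtain ⟨E, hE, h⟩ := ihφ hN.1 hQ.1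
    obtain ⟨F, hF, h'⟩ := ihψ hN.2 hQ.2
    exact ⟨_, hE.and hF, fun A _ _ _ S ρ s => by simp only [Sat, h, h']⟩
  | or φ ψ ihφ ihψ =>
    obtain ⟨E, hE, h⟩ := ihφ hN.1 hQ.1
    obtain ⟨F, hF, h'⟩ := ihψ hN.2 hQ.2
    exact ⟨_, hE.or hF, fun A _ _ _ S ρ s => by simp only [Sat, h, h']⟩
  | num => exact hN.elim
  | nnum => exact hN.elim
  | ex => exact hQ.elim
  | all => exact hQ.elim
  | exF => exact hQ.elim

/-! ### Indicators -/

open Classical in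
/-- The indicator of a proposition. -/
noncomputable def ind (p : Prop) : ℝ := if p then 1 else 0

theorem ind_of {p : Prop} (h : p) : ind p = 1 := if_pos h

theorem ind_of_not {p : Prop} (h : ¬ p) : ind p = 0 := if_neg h

theorem ind_and (p q : Prop) : ind (p ∧ q) = ind p * ind q := by
  by_cases hp : p <;> by_cases hq : q <;> simp [ind, hp, hq]

theorem ind_not (p : Prop) : ind (¬ p) = 1 - ind p := by
  by_cases hp : p <;> simp [ind, hp]

theorem ind_nonneg (p : Prop) : 0 ≤ ind p := by
  by_cases hp : p <;> simp [ind, hp]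

theorem ind_le_one (p : Prop) : ind p ≤ 1 := by
  by_cases hp : p <;> simp [ind, hp]

theorem sum_mul_ind {ι : Type*} [Fintype ι] (b : ι) (F : ι → ℝ) :
    ∑ a, F a * ind (a = b) = F b := by
  classical
  rw [Finset.sum_eq_single b (fun a _ h => by rw [ind_of_not h, mul_zero]) (by simp),
    ind_of rfl, mul_one]

theorem sum_mul_ind' {ι : Type*} [Fintype ι] (b : ι) (F : ι → ℝ) :
    ∑ a, F a * ind (b = a) = F b := by
  simpa only [eq_comm] using sum_mul_ind b F

theorem sum_filter_eq_ind {ι : Type*} [Fintype ι] (p : ι → Prop) [DecidablePred p] (F : ι → ℝ) :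
    ∑ a with p a, F a = ∑ a, F a * ind (p a) := by
  rw [Finset.sum_filter]
  refine Finset.sum_congr rfl fun a _ => ?_
  by_cases h : p a <;> simp [ind, h]

theorem ext_inj {A : Type u} {n : ℕ} {s s' : Fin n → A} {a a' : A} :
    ext s a = ext s' a' ↔ s = s' ∧ a = a' :=
  Fin.snoc_inj

theorem comp_ext {A B : Type*} {n : ℕ} (f : A → B) (s : Fin n → A) (a : A) :
    (fun l => f (ext s a l)) = ext (fun l => f (s l)) (f a) := by
  funext l
  refine Fin.lastCases ?_ (fun i => ?_) l <;> simp

/-! ### Weight functions represented by fresh universally quantified variables -/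

/-- Real-valued functions of assignments for `N` variables, uniformly in the structure. -/
abbrev WeightFn (τ : FirstOrder.Language.{v, w}) (N : ℕ) :=
  ∀ (A : Type u) [τ.Structure A] [Fintype A] [Nontrivial A], (Fin N → A) → ℝ

/-- The functions which give the probability of a flat event when values for finitely many fresh
variables are drawn uniformly and independently. -/
inductive Rep (τ : FirstOrder.Language.{v, w}) : (N : ℕ) → WeightFn.{u} τ N → Prop
  | flat {N : ℕ} {E : Event.{u} τ N} (hE : Flat τ N E) : Rep τ N (fun A _ _ _ t => ind (E A t))
  | avg {N : ℕ} {p : WeightFn.{u} τ (N + 1)} (hp : Rep τ (N + 1) p) :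
      Rep τ N (fun A _ _ _ t => (∑ a, p A (ext t a)) / Fintype.card A)

theorem card_pos' (A : Type u) [Fintype A] [Nontrivial A] : (0 : ℝ) < Fintype.card A := by
  exact_mod_cast Fintype.card_pos

namespace Rep

variable {τ : FirstOrder.Language.{v, w}} {N : ℕ} {p q : WeightFn.{u} τ N}

theorem congr (hp : Rep τ N p)
    (h : ∀ (A : Type u) [τ.Structure A] [Fintype A] [Nontrivial A] (s : Fin N → A),
      p A s = q A s) : Rep τ N q := by
  have : p = q := by
    funext A _ _ _ s
    exact h A s
  exact this ▸ hp

theorem comap (hp : Rep τ N p) {M : ℕ} (v : Fin N → Fin M) :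
    Rep τ M (fun A _ _ _ s => p A (fun l => s (v l))) := by
  induction hp generalizing M with
  | flat hE => exact .flat (hE.comap v)
  | avg _ ih =>
    refine (ih (ext (fun l => (v l).castSucc) (Fin.last M))).avg.congr fun A _ _ _ s => ?_
    simp only [comp_ext]
    simp

theorem zero : Rep τ N (fun _ _ _ _ _ => 0) :=
  (Rep.flat Flat.top.not).congr fun _ _ _ _ _ => ind_of_not (by simp)

theorem one : Rep τ N (fun _ _ _ _ _ => 1) :=
  (Rep.flat Flat.top).congr fun _ _ _ _ _ => ind_of trivial

/-- The fresh variables of both functions are drawn, and `E`, which does not involve them, selects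
the event to be tested. -/
theorem ite {E : Event.{u} τ N} (hE : Flat τ N E) (hp : Rep τ N p) (hq : Rep τ N q) :
    Rep τ N (fun A _ _ _ t => ind (E A t) * p A t + (1 - ind (E A t)) * q A t) := by
  induction hp with
  | @flat N F hF =>
    induction hq with
    | @flat N G hG =>
      refine (Rep.flat ((hE.and hF).or (hE.not.and hG))).congr fun A _ _ _ s => ?_
      by_cases h1 : E A s <;> by_cases h2 : F A s <;> by_cases h3 : G A s <;>
        simp [ind, h1, h2, h3]
    | @avg N q' hq' ih =>
      refine (ih (hF.comap Fin.castSucc) (hE.comap Fin.castSucc)).avg.congr fun A _ _ _ s => ?_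
      have := card_pos' A
      simp only [ext_comp_castSucc, Finset.sum_add_distrib, ← Finset.mul_sum, Finset.sum_const,
        Finset.card_univ, nsmul_eq_mul]
      field_simp
  | @avg N p' hp' ih =>
    refine (ih (hE.comap Fin.castSucc) (hq.comap Fin.castSucc)).avg.congr fun A _ _ _ s => ?_
    have := card_pos' A
    simp only [ext_comp_castSucc, Finset.sum_add_distrib, ← Finset.mul_sum, Finset.sum_const,
      Finset.card_univ, nsmul_eq_mul]
    field_simp

/-- Independent draws multiply probabilities; for an indicator the product is a case distinction
with `0`. -/
theorem mul (hp : Rep τ N p) (hq : Rep τ N q) : Rep τ N (fun A _ _ _ t => p A t * q A t) := by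
  induction hp with
  | flat hF => exact (ite hF hq zero).congr fun A _ _ _ s => by ring
  | avg _ ih =>
    refine (ih (hq.comap Fin.castSucc)).avg.congr fun A _ _ _ s => ?_
    simp only [ext_comp_castSucc, ← Finset.sum_mul]
    ring

theorem avg_const {κ : ∀ (A : Type u) [τ.Structure A] [Fintype A] [Nontrivial A], ℝ}
    (h : Rep τ (N + 1) (fun A _ _ _ _ => κ A)) : Rep τ N (fun A _ _ _ _ => κ A) := by
  refine h.avg.congr fun A _ _ _ s => ?_
  simp

/-- Two fresh variables agree with probability `1 / |A|`. This is the biased coin from which sums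
and scalings are built. -/
theorem mix (hp : Rep τ N p) (hq : Rep τ N q) :
    Rep τ N (fun A _ _ _ t => p A t / Fintype.card A +
      (Fintype.card A - 1) / Fintype.card A * q A t) := by
  refine (Rep.ite (Flat.eq (Fin.last N).castSucc (Fin.last (N + 1)))
    ((hp.comap Fin.castSucc).comap Fin.castSucc)
    ((hq.comap Fin.castSucc).comap Fin.castSucc)).avg.avg.congr fun A _ _ _ s => ?_
  have := card_pos' A
  have h (a : A) : ∑ b, ind (a = b) = 1 := by
    simpa using sum_mul_ind' a (fun _ => (1 : ℝ))
  simp only [Fin.snoc_last, Fin.snoc_castSucc, Finset.sum_add_distrib, ← Finset.sum_mul,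
    Finset.sum_sub_distrib, h, Finset.sum_const, Finset.card_univ, nsmul_eq_mul]
  field_simp

theorem one_div_card_pow (e : ℕ) :
    Rep τ N (fun A _ _ _ _ => (1 / (Fintype.card A : ℝ)) ^ e) := by
  induction e with
  | zero => exact one.congr fun A _ _ _ s => by simp
  | succ e ih =>
    exact (ih.mul (mix one zero)).congr fun A _ _ _ s => by rw [pow_succ]; simp

end Rep

/-- The functions that are represented after multiplication with a represented positive constant. -/
def RepUpTo (τ : FirstOrder.Language.{v, w}) (N : ℕ) (p : WeightFn.{u} τ N) : Prop :=
  ∃ κ : ∀ (A : Type u) [τ.Structure A] [Fintype A] [Nontrivial A], ℝ,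
    (∀ (A : Type u) [τ.Structure A] [Fintype A] [Nontrivial A], 0 < κ A) ∧
    Rep τ N (fun A _ _ _ _ => κ A) ∧ Rep τ N (fun A _ _ _ t => κ A * p A t)

namespace RepUpTo

variable {τ : FirstOrder.Language.{v, w}} {N : ℕ} {p q : WeightFn.{u} τ N}

theorem congr (hp : RepUpTo τ N p)
    (h : ∀ (A : Type u) [τ.Structure A] [Fintype A] [Nontrivial A] (s : Fin N → A),
      p A s = q A s) : RepUpTo τ N q := by
  have : p = q := by
    funext A _ _ _ s
    exact h A s
  exact this ▸ hp

theorem of_rep (hp : Rep τ N p) : RepUpTo τ N p :=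
  ⟨fun _ _ _ _ => 1, fun _ _ _ _ => one_pos, Rep.one, hp.congr fun A _ _ _ s => by simp⟩

theorem card_pow_mul (hp : Rep τ N p) (e : ℕ) :
    RepUpTo τ N (fun A _ _ _ t => (Fintype.card A : ℝ) ^ e * p A t) := by
  refine ⟨fun A _ _ _ => (1 / (Fintype.card A : ℝ)) ^ e, fun A _ _ _ => ?_,
    Rep.one_div_card_pow e, hp.congr fun A _ _ _ s => ?_⟩
  · have := card_pos' A
    positivity
  · have := card_pos' A
    rw [← mul_assoc, ← mul_pow, one_div_mul_cancel this.ne', one_pow, one_mul]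

/-- A sum of probabilities may exceed one, so a coin chooses between the summands and the loss is
recorded in the factor. -/
theorem add (hp : RepUpTo τ N p) (hq : RepUpTo τ N q) :
    RepUpTo τ N (fun A _ _ _ t => p A t + q A t) := by
  obtain ⟨κ, hκ, h1, h2⟩ := hp
  obtain ⟨μ, hμ, g1, g2⟩ := hq
  -- The outer and inner `mix` give one summand `(1 / |A|) * ((|A| - 1) / |A|)` and the other the
  -- same product in the opposite order, so the weights are equal. They are positive because `|A| ≥
  -- 2`.
  refine ⟨fun A _ _ _ => (Fintype.card A - 1) / Fintype.card A ^ 2 * (κ A * μ A),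
    fun A _ _ _ => ?_, ?_, ?_⟩
  · have := card_pos' A
    have h : (1 : ℝ) < Fintype.card A := by exact_mod_cast Fintype.one_lt_card
    have := hκ A
    have := hμ A
    have : (0 : ℝ) < Fintype.card A - 1 := by linarith
    positivity
  · refine (Rep.mix (Rep.mix Rep.zero (h1.mul g1)) Rep.zero).congr fun A _ _ _ s => ?_
    have := card_pos' A
    field_simp
    ring
  · refine (Rep.mix (Rep.mix Rep.zero (g1.mul h2)) (Rep.mix (h1.mul g2) Rep.zero)).congr
      fun A _ _ _ s => ?_
    have := card_pos' A
    field_simp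
    ring

/-- A sum is `|A|` times an average. -/
theorem sum {p : WeightFn.{u} τ (N + 1)} (hp : RepUpTo τ (N + 1) p) :
    RepUpTo τ N (fun A _ _ _ t => ∑ a, p A (ext t a)) := by
  obtain ⟨κ, hκ, h1, h2⟩ := hp
  refine ⟨fun A _ _ _ => κ A / Fintype.card A, fun A _ _ _ => div_pos (hκ A) (card_pos' A),
    (Rep.mix h1.avg_const Rep.zero).congr fun A _ _ _ s => by simp,
    h2.avg.congr fun A _ _ _ s => ?_⟩
  rw [← Finset.mul_sum]
  ring

theorem sum_append {k : ℕ} {p : WeightFn.{u} τ (N + k)} (hp : RepUpTo τ (N + k) p) :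
    RepUpTo τ N (fun A _ _ _ t => ∑ a : Fin k → A, p A (Fin.append t a)) := by
  induction k with
  | zero => exact hp.congr fun A _ _ _ s => by simp [Fin.append_right_nil _ _ rfl]
  | succ k ih =>
    refine (ih (sum (N := N + k) hp)).congr fun A _ _ _ s => ?_
    rw [sum_ext]
    refine Finset.sum_congr rfl fun a _ => Finset.sum_congr rfl fun b _ => ?_
    rw [ext, ext, Fin.append_snoc]

end RepUpTo

open TeamForm

/-! ### Deterministic extensions -/

section DetExt

variable {A : Type u} {N : ℕ}

/-- The weights of the team extended by the variable with value `g s` at the assignment `s`. -/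
noncomputable def detExt (Y : (Fin N → A) → ℝ) (g : (Fin N → A) → A) (t : Fin (N + 1) → A) : ℝ :=
  Y (restr t) * ind (t (Fin.last N) = g (restr t))

@[simp] theorem detExt_ext (Y : (Fin N → A) → ℝ) (g : (Fin N → A) → A) (s : Fin N → A) (a : A) :
    detExt Y g (ext s a) = Y s * ind (a = g s) := by
  simp [detExt]

theorem detExt_nonneg {Y : (Fin N → A) → ℝ} (hY : ∀ s, 0 ≤ Y s) (g : (Fin N → A) → A)
    (t : Fin (N + 1) → A) : 0 ≤ detExt Y g t :=
  mul_nonneg (hY _) (ind_nonneg _)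

theorem eq_of_detExt_pos {Y : (Fin N → A) → ℝ} {g : (Fin N → A) → A}
    {t : Fin (N + 1) → A} (h : 0 < detExt Y g t) : t (Fin.last N) = g (restr t) := by
  by_contra hne
  rw [detExt, ind_of_not hne, mul_zero] at h
  exact h.false

theorem pos_of_detExt_pos {Y : (Fin N → A) → ℝ} {g : (Fin N → A) → A}
    {t : Fin (N + 1) → A} (h : 0 < detExt Y g t) : 0 < Y (restr t) := by
  rw [detExt, ind_of (eq_of_detExt_pos h), mul_one] at h
  exact h

variable [Fintype A]

theorem detExt_proj (Y : (Fin N → A) → ℝ) (g : (Fin N → A) → A) (s : Fin N → A) :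
    ∑ a, detExt Y g (ext s a) = Y s := by
  simpa using sum_mul_ind (g s) (fun _ => Y s)

theorem sum_detExt_mul (Y : (Fin N → A) → ℝ) (g : (Fin N → A) → A) (F : (Fin (N + 1) → A) → ℝ) :
    ∑ t, detExt Y g t * F t = ∑ s, Y s * F (ext s (g s)) := by
  rw [sum_ext]
  refine Finset.sum_congr rfl fun s _ => ?_
  rw [← sum_mul_ind (g s) (fun a => Y s * F (ext s a))]
  refine Finset.sum_congr rfl fun a _ => ?_
  rw [detExt_ext]
  ring

theorem sum_unif_mul (Y : (Fin N → A) → ℝ) (F : (Fin (N + 1) → A) → ℝ) :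
    ∑ t, unif Y t * F t = ∑ s, Y s * ((∑ a, F (ext s a)) / Fintype.card A) := by
  rw [sum_ext]
  refine Finset.sum_congr rfl fun s _ => ?_
  simp only [unif_ext, ← Finset.mul_sum]
  ring

/-- An assignment of positive weight has an extension of positive weight. -/
theorem exists_ext_pos {X : (Fin N → A) → ℝ} {Y : (Fin (N + 1) → A) → ℝ}
    (h : ∀ s, ∑ a, Y (ext s a) = X s) {s : Fin N → A} (hs : 0 < X s) : ∃ a, 0 < Y (ext s a) := by
  by_contra! hne
  have := Finset.sum_nonpos fun a (_ : a ∈ Finset.univ) => hne a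
  rw [h] at this
  linarith

theorem restr_pos {X : (Fin N → A) → ℝ} {Y : (Fin (N + 1) → A) → ℝ} (hY : ∀ t, 0 ≤ Y t)
    (h : ∀ s, ∑ a, Y (ext s a) = X s) {t : Fin (N + 1) → A} (ht : 0 < Y t) : 0 < X (restr t) := by
  rw [← h]
  refine Finset.sum_pos' (fun a _ => hY _) ⟨t (Fin.last N), Finset.mem_univ _, ?_⟩
  simpa using ht

end DetExt

/-! ### Comparing weights of events -/

section Compare

variable {τ : FirstOrder.Language.{v, w}}

theorem wsat_marginalIdentity {A : Type u} [τ.Structure A] [Fintype A] {N k : ℕ}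
    (x y : Fin k → Fin N) (X : (Fin N → A) → ℝ) :
    (TeamForm.marginalIdentity (τ := τ) x y).WSat X ↔ ∀ a : Fin k → A,
      ∑ s, X s * ind ((fun l => s (x l)) = a) = ∑ s, X s * ind ((fun l => s (y l)) = a) := by
  simp only [WSat, sum_filter_eq_ind]

/-- The weights of two flat events can be compared, conditionally on the values of `v`, by means of
marginal identity. -/
theorem exists_compare_flat {N n : ℕ} {E F : Event.{u} τ N} (hE : Flat τ N E) (hF : Flat τ N F)
    (v : Fin n → Fin N) :
    ∃ χ : TeamForm τ N, χ.AtomsIn {AtomKind.marginalIdentity} ∧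
      ∀ (A : Type u) [τ.Structure A] [Fintype A] [Nontrivial A] (Y : (Fin N → A) → ℝ),
        (∀ s, 0 ≤ Y s) → (χ.WSat Y ↔ ∀ c : Fin n → A,
          ∑ t, Y t * (ind ((fun l => t (v l)) = c) * ind (E A t)) =
            ∑ t, Y t * (ind ((fun l => t (v l)) = c) * ind (F A t))) := by
  -- `x` is uniform, `y` equals `x` exactly on `E`, and `z` equals `x` exactly on `F`. The atom
  -- states that `v x y` and `v x z` have the same marginals.
  let x : Fin (N + 3) := (Fin.last N).castSucc.castSucc
  let y : Fin (N + 3) := (Fin.last (N + 1)).castSucc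
  let z : Fin (N + 3) := Fin.last (N + 2)
  let up : Fin N → Fin (N + 3) := fun l => l.castSucc.castSucc.castSucc
  obtain ⟨⟨β, hβ, hβs⟩, -⟩ :=
    (((hE.comap up).iff (Flat.eq y x)).and ((hF.comap up).iff (Flat.eq z x))).exists_teamForm
  let μ : TeamForm τ (N + 3) := .marginalIdentity
    (ext (ext (fun l => up (v l)) x) y) (ext (ext (fun l => up (v l)) x) z)
  refine ⟨.all (.ex (.ex (.and β μ))), ⟨atomsIn_mono (Set.empty_subset _) hβ, rfl⟩,
    fun A _ _ _ Y hY => ⟨?_, fun H => ?_⟩⟩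
  · rintro ⟨Y2, hY2, hp2, Y3, hY3, hp3, h1, h2⟩ c
    rw [hβs A Y3 hY3] at h1
    rw [wsat_marginalIdentity] at h2
    have key (G : (Fin N → A) → ℝ) :
        ∑ s, Y3 s * G (fun l => s (up l)) = ∑ s, Y s * G s := by
      rw [← sum_mul_restr (unif_proj Y), ← sum_mul_restr hp2, ← sum_mul_restr hp3]
      rfl
    -- Adding up the marginals at the diagonal values `(c, d, d)` recovers the weight of `r = x`
    -- within `v = c`.
    have sumEq (r : Fin (N + 3)) : ∑ d, ∑ s, Y3 s *
        ind ((fun l => s (ext (ext (fun l => up (v l)) x) r l)) = ext (ext c d) d) =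
        ∑ s, Y3 s * (ind ((fun l => s (up (v l))) = c) * ind (s r = s x)) := by
      rw [Finset.sum_comm]
      refine Finset.sum_congr rfl fun s _ => ?_
      simp only [comp_ext, ext_inj, ind_and]
      rw [← sum_mul_ind' (s x) (fun d => Y3 s * (ind ((fun l => s (up (v l))) = c) * ind (s r = d)))]
      exact Finset.sum_congr rfl fun d _ => by ring
    have key2 (r : Fin (N + 3)) (D : Event.{u} τ N)
        (hD : ∀ s, 0 < Y3 s → (D A (fun l => s (up l)) ↔ s r = s x)) :
        ∑ s, Y3 s * (ind ((fun l => s (up (v l))) = c) * ind (s r = s x)) =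
        ∑ s, Y s * (ind ((fun l => s (v l)) = c) * ind (D A s)) := by
      rw [← key (fun s => ind ((fun l => s (v l)) = c) * ind (D A s))]
      refine Finset.sum_congr rfl fun s _ => ?_
      rcases (hY3 s).eq_or_lt with h | h
      · simp [← h]
      · simp only [hD s h]
    rw [← key2 y E fun s hs => (h1 s hs).1, ← key2 z F fun s hs => (h1 s hs).2,
      ← sumEq, ← sumEq]
    exact Finset.sum_congr rfl fun d _ => h2 _
  -- Off the event the new variable takes a fixed value `e a ≠ a` depending only on the value `a` of
  -- `x`. Hence the entire marginal, not only its diagonal, is controlled by the weight of the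
  -- event.
  · choose e he using fun a : A => exists_ne a
    classical
    let sel (D : Event.{u} τ N) (s : Fin N → A) (a : A) : A := if D A s then a else e a
    have hsel (D : Event.{u} τ N) (s : Fin N → A) (a : A) : D A s ↔ sel D s a = a := by
      by_cases h : D A s <;> simp [sel, h, he]
    let g2 (t : Fin (N + 1) → A) : A := sel E (restr t) (t (Fin.last N))
    let g3 (t : Fin (N + 2) → A) : A := sel F (restr (restr t)) (restr t (Fin.last N))
    have n1 := unif_nonneg hY
    have n2 := detExt_nonneg n1 g2
    have n3 := detExt_nonneg n2 g3
    refine ⟨_, n2, detExt_proj _ _, _, n3, detExt_proj _ g3, (hβs A _ n3).2 fun s hs => ?_, ?_⟩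
    · have a1 := eq_of_detExt_pos hs
      have a2 := eq_of_detExt_pos (pos_of_detExt_pos hs)
      have b1 : s z = sel F (fun l => s (up l)) (s x) := a1
      have b2 : s y = sel E (fun l => s (up l)) (s x) := a2
      refine ⟨?_, ?_⟩
      · rw [b2]; exact hsel E _ _
      · rw [b1]; exact hsel F _ _
    · rw [wsat_marginalIdentity]
      intro a
      obtain ⟨c', b, rfl⟩ : ∃ c' b, a = ext c' b := ⟨restr a, a (Fin.last _), by simp⟩
      obtain ⟨c, d, rfl⟩ : ∃ c d, c' = ext c d := ⟨restr c', c' (Fin.last _), by simp⟩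
      -- This is affine in `ind (D A s)` with coefficients depending only on `d` and `b`. The
      -- marginals therefore depend on `D` only through the weights equated by `H`.
      have hval (D : Event.{u} τ N) (s : Fin N → A) : ind (sel D s d = b) =
          ind (D A s) * (ind (d = b) - ind (e d = b)) + ind (e d = b) := by
        by_cases h : D A s <;> simp [sel, ind, h]
      have main (D : Event.{u} τ N) : ∑ s, Y s * ((∑ a, ind ((fun l => s (v l)) = c) *
          ind (a = d) * ind (sel D s a = b)) / Fintype.card A) =
          ((∑ s, Y s * (ind ((fun l => s (v l)) = c) * ind (D A s))) *
            (ind (d = b) - ind (e d = b)) +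
          (∑ s, Y s * ind ((fun l => s (v l)) = c)) * ind (e d = b)) / Fintype.card A := by
        rw [Finset.sum_mul, Finset.sum_mul, ← Finset.sum_add_distrib, Finset.sum_div]
        refine Finset.sum_congr rfl fun s _ => ?_
        have := sum_mul_ind d (fun a => ind ((fun l => s (v l)) = c) * ind (sel D s a = b))
        rw [hval] at this
        rw [show ∑ a, ind ((fun l => s (v l)) = c) * ind (a = d) * ind (sel D s a = b) = _ from
          (Finset.sum_congr rfl fun a _ => by ring).trans this]
        ring
      rw [sum_detExt_mul, sum_detExt_mul, sum_unif_mul, sum_detExt_mul, sum_detExt_mul,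
        sum_unif_mul]
      simp only [comp_ext, ext_inj, ind_and]
      have := main E
      have := main F
      rw [H c] at *
      simp only [x, y, z, up, g2, g3, Fin.snoc_last, Fin.snoc_castSucc, Fin.init_snoc]
      simp_all

/-- The conditional expectations of two represented functions, given the values of `v`, can be
compared by means of marginal identity. -/
theorem exists_compare {N n : ℕ} {p q : WeightFn.{u} τ N} (hp : Rep τ N p) (hq : Rep τ N q)
    (v : Fin n → Fin N) :
    ∃ χ : TeamForm τ N, χ.AtomsIn {AtomKind.marginalIdentity} ∧
      ∀ (A : Type u) [τ.Structure A] [Fintype A] [Nontrivial A] (Y : (Fin N → A) → ℝ),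
        (∀ s, 0 ≤ Y s) → (χ.WSat Y ↔ ∀ F : (Fin n → A) → ℝ,
          ∑ t, Y t * (F (fun l => t (v l)) * p A t) =
            ∑ t, Y t * (F (fun l => t (v l)) * q A t)) := by
  induction hp with
  | @flat N E hE =>
    induction hq with
    | @flat N D hD =>
      obtain ⟨χ, hχ, h⟩ := exists_compare_flat hE hD v
      refine ⟨χ, hχ, fun A _ _ _ Y hY => (h A Y hY).trans ⟨fun H F => ?_, fun H c => ?_⟩⟩
      -- A test function of the value of `v` is a combination of indicators of single values.
      · have key (D : Event.{u} τ N) : ∑ t, Y t * (F (fun l => t (v l)) * ind (D A t)) =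
            ∑ c, F c * ∑ t, Y t * (ind ((fun l => t (v l)) = c) * ind (D A t)) := by
          simp only [Finset.mul_sum]
          rw [Finset.sum_comm]
          refine Finset.sum_congr rfl fun t _ => ?_
          rw [← sum_mul_ind' (fun l => t (v l)) F, Finset.sum_mul, Finset.mul_sum]
          exact Finset.sum_congr rfl fun c _ => by ring
        rw [key, key]
        exact Finset.sum_congr rfl fun c _ => by rw [H c]
      · exact H (fun s => ind (s = c))
    | @avg N q' hq' ih =>
      obtain ⟨χ, hχ, h⟩ := ih (hE.comap Fin.castSucc) (fun l => (v l).castSucc)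
      -- The averaged variable is drawn by a universal quantifier; neither `F` nor the other
      -- function sees it.
      refine ⟨.all χ, hχ, fun A _ _ _ Y hY => (h A _ (unif_nonneg hY)).trans ?_⟩
      have := card_pos' A
      refine forall_congr' fun F => ?_
      rw [sum_unif_mul, sum_unif_mul]
      simp [← Finset.mul_sum, mul_div_assoc, mul_div_cancel_left₀ _ this.ne']
  | @avg N p' hp' ih =>
    obtain ⟨χ, hχ, h⟩ := ih (hq.comap Fin.castSucc) (fun l => (v l).castSucc)
    refine ⟨.all χ, hχ, fun A _ _ _ Y hY => (h A _ (unif_nonneg hY)).trans ?_⟩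
    have := card_pos' A
    refine forall_congr' fun F => ?_
    rw [sum_unif_mul, sum_unif_mul]
    simp [← Finset.mul_sum, mul_div_assoc, mul_div_cancel_left₀ _ this.ne']

end Compare

/-! ### Functions encoded by teams -/

/-- How a function of arity `k` is encoded by a team for `N` variables: the weight of the event that
`args` has value `z` and that `p` and `q` have the same value is proportional to the value of the
function at `z`; the factor is the power of the cardinality with exponent `-e`. -/
structure Sym (k N : ℕ) where
  /-- the variables for the arguments -/
  args : Fin k → Fin N
  /-- the first one of the variables to be compared -/
  p : Fin N
  /-- the second one of the variables to be compared -/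
  q : Fin N
  /-- the scaling exponent -/
  e : ℕ

/-- Encodings of all symbols of a functional vocabulary. -/
abbrev Pos (Γ : List ℕ) (N : ℕ) := (k : ℕ) → FVar Γ k → Sym k N

/-- Renaming of the variables in an encoding. -/
def Pos.map {Γ : List ℕ} {N M : ℕ} (v : Fin N → Fin M) (π : Pos Γ N) : Pos Γ M :=
  fun k f => ⟨fun l => v ((π k f).args l), v (π k f).p, v (π k f).q, (π k f).e⟩

/-- Encoding of one more function symbol. -/
def Pos.cons {Γ : List ℕ} {k N : ℕ} (σ : Sym k N) (π : Pos Γ N) : Pos (k :: Γ) N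
  | _, .here => σ
  | _, .there f => π _ f

/-- The contribution of a single assignment to the encoded functions. -/
noncomputable def pointEnv {Γ : List ℕ} {A : Type u} [Fintype A] {N : ℕ} (π : Pos Γ N)
    (t : Fin N → A) : FEnv Γ A :=
  fun k f z => (Fintype.card A : ℝ) ^ (π k f).e *
    (ind ((fun l => t ((π k f).args l)) = z) * ind (t (π k f).p = t (π k f).q))

/-- The functions `ρ c` are the conditional expectations of the contributions of the assignments
in which `v` has the value `c`. -/
def Encodes {Γ : List ℕ} {A : Type u} [Fintype A] {N n : ℕ} (Y : (Fin N → A) → ℝ)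
    (v : Fin n → Fin N) (π : Pos Γ N) (ρ : (Fin n → A) → FEnv Γ A) : Prop :=
  ∀ (k : ℕ) (f : FVar Γ k) (z : Fin k → A) (F : (Fin n → A) → ℝ),
    ∑ t, Y t * (F (fun l => t (v l)) * pointEnv π t k f z) =
      ∑ t, Y t * (F (fun l => t (v l)) * ρ (fun l => t (v l)) k f z)

section Encodes

variable {Γ : List ℕ} {A : Type u} [Fintype A] {N n : ℕ} {Y : (Fin N → A) → ℝ}
  {v : Fin n → Fin N} {π : Pos Γ N} {ρ : (Fin n → A) → FEnv Γ A}

@[simp] theorem pointEnv_map {M : ℕ} (u : Fin N → Fin M) (t : Fin M → A) :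
    pointEnv (π.map u) t = pointEnv π (fun l => t (u l)) := rfl

theorem Encodes.of_proj (h : Encodes Y v π ρ) {Y' : (Fin (N + 1) → A) → ℝ}
    (hp : ∀ s, ∑ a, Y' (ext s a) = Y s) :
    Encodes Y' (fun l => (v l).castSucc) (π.map Fin.castSucc) ρ := by
  intro k f z F
  have h1 := sum_mul_restr hp fun s => F (fun l => s (v l)) * pointEnv π s k f z
  have h2 := sum_mul_restr hp fun s => F (fun l => s (v l)) * ρ (fun l => s (v l)) k f z
  exact h1.trans ((h k f z F).trans h2.symm)

/-- Conditioning on an event determined by `v` does not change expectations given `v`. This is why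
the splittings of disjunctions have to be functions of `v`. -/
theorem Encodes.restrict (h : Encodes Y v π ρ) {Z : (Fin N → A) → ℝ} (K : (Fin n → A) → Prop)
    (hZ : ∀ t, Z t = Y t * ind (K (fun l => t (v l)))) : Encodes Z v π ρ := by
  intro k f z F
  have := h k f z (fun c => ind (K c) * F c)
  simp only [hZ]
  convert this using 2 <;> ring

/-- Numerical terms without multiplication commute with conditional expectations. -/
theorem Encodes.sum_eval (h : Encodes Y v π ρ) {O : Set NumOp} {C : Set ℝ}
    (hO : NumOp.times ∉ O) {m : ℕ} (i : NumTerm Γ m) (hi : i.Over O C)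
    (g : (Fin n → A) → Fin m → A) (F : (Fin n → A) → ℝ) :
    ∑ t, Y t * (F (fun l => t (v l)) * i.eval (pointEnv π t) (g fun l => t (v l))) =
      ∑ t, Y t * (F (fun l => t (v l)) *
        i.eval (ρ fun l => t (v l)) (g fun l => t (v l))) := by
  induction i generalizing F with
  | const c => rfl
  | @app m k f x =>
    -- The arguments are functions of `v`. Summing over their possible values `z` turns them into
    -- constants, with the indicator absorbed in the test function.
    have key (ρ' : (Fin N → A) → FEnv Γ A) :
        ∑ t, Y t * (F (fun l => t (v l)) * ρ' t k f fun l => g (fun l => t (v l)) (x l)) =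
        ∑ z, ∑ t, Y t * ((F (fun l => t (v l)) *
          ind (z = fun l => g (fun l => t (v l)) (x l))) * ρ' t k f z) := by
      rw [Finset.sum_comm]
      refine Finset.sum_congr rfl fun t _ => ?_
      rw [← sum_mul_ind _ (fun z => Y t * (F (fun l => t (v l)) * ρ' t k f z))]
      exact Finset.sum_congr rfl fun z _ => by ring
    simp only [NumTerm.eval]
    rw [key, key]
    exact Finset.sum_congr rfl fun z _ =>
      h k f z (fun c => F c * ind (z = fun l => g c (x l)))
  | plus i j ihi ihj =>
    simp only [NumTerm.eval, mul_add, Finset.sum_add_distrib]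
    rw [ihi hi.2.1, ihj hi.2.2]
  | times i j => exact (hO hi.1).elim
  | SUM k i ih =>
    simp only [NumTerm.eval, Finset.mul_sum]
    rw [Finset.sum_comm]
    conv_rhs => rw [Finset.sum_comm]
    exact Finset.sum_congr rfl fun a _ => ih hi.2 (fun c => Fin.append (g c) a) F

end Encodes

section RepEval

variable {τ : FirstOrder.Language.{v, w}}

/-- At a single assignment a function symbol is a power of `|A|` times the indicator of a flat
event; sums and constants are covered by the closure properties of `RepUpTo`. -/
theorem repUpTo_eval {Γ : List ℕ} {O : Set NumOp} (hO : NumOp.times ∉ O) {m : ℕ}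
    (i : NumTerm Γ m) (hi : i.Over O {0, 1}) {N : ℕ} (π : Pos Γ N) (x : Fin m → Fin N) :
    RepUpTo.{u} τ N (fun _ _ _ _ t => i.eval (pointEnv π t) (fun l => t (x l))) := by
  induction i generalizing N with
  | const c =>
    rcases hi with rfl | rfl
    · exact .of_rep Rep.zero
    · exact .of_rep Rep.one
  | @app m k f y =>
    refine (RepUpTo.card_pow_mul (Rep.flat ((Flat.tupleEq (π k f).args (fun l => x (y l))).and
      (Flat.eq (π k f).p (π k f).q))) (π k f).e).congr fun _ _ _ _ t => ?_
    rw [ind_and]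
    simp only [NumTerm.eval, pointEnv, funext_iff]
  | plus i j ihi ihj => exact (ihi hi.2.1 π x).add (ihj hi.2.2 π x)
  | times i j => exact (hO hi.1).elim
  | @SUM m k i ih =>
    refine (ih hi.2 (π.map (Fin.castAdd k))
      (Fin.append (fun l => Fin.castAdd k (x l)) (Fin.natAdd N))).sum_append.congr
      fun A _ _ _ t => ?_
    simp only [NumTerm.eval, pointEnv_map, Fin.append_left]
    refine Finset.sum_congr rfl fun a _ => ?_
    congr 1
    funext l
    refine Fin.addCases (fun l => ?_) (fun l => ?_) l <;> simp

end RepEval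

/-! ### Definability over encoded functions -/

/-- Properties of interpretations of the function symbols in `Γ` and assignments, uniformly in the
structure. -/
abbrev Property (τ : FirstOrder.Language.{v, w}) (Γ : List ℕ) (n : ℕ) :=
  ∀ (A : Type u) [τ.Structure A] [Fintype A] [Nontrivial A], FEnv Γ A → (Fin n → A) → Prop

/-- There is a team formula with atoms from `D` that holds in a team if and only if the functions
encoded by the team have the property `P` at all values of `v` in the team. -/
def TeamDef (τ : FirstOrder.Language.{v, w}) {Γ : List ℕ} {n : ℕ} (D : Set AtomKind)
    (P : Property.{u} τ Γ n) : Prop :=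
  ∀ (N : ℕ) (v : Fin n → Fin N) (π : Pos Γ N), ∃ χ : TeamForm τ N, χ.AtomsIn D ∧
    ∀ (A : Type u) [τ.Structure A] [Fintype A] [Nontrivial A] (Y : (Fin N → A) → ℝ)
      (ρ : (Fin n → A) → FEnv Γ A), (∀ t, 0 ≤ Y t) → Encodes Y v π ρ →
      (χ.WSat Y ↔ ∀ t, 0 < Y t → P A (ρ fun l => t (v l)) (fun l => t (v l)))

/-- The guards `β` and `γ` leave only one possible splitting. -/
theorem wsat_or_split {τ : FirstOrder.Language.{v, w}} {A : Type u} [τ.Structure A] [Fintype A]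
    {N : ℕ} {χ θ β γ : TeamForm τ N} {E : (Fin N → A) → Prop}
    (hβ : ∀ Y : (Fin N → A) → ℝ, (∀ s, 0 ≤ Y s) → (β.WSat Y ↔ ∀ s, 0 < Y s → E s))
    (hγ : ∀ Y : (Fin N → A) → ℝ, (∀ s, 0 ≤ Y s) → (γ.WSat Y ↔ ∀ s, 0 < Y s → ¬ E s))
    {Y : (Fin N → A) → ℝ} (hY : ∀ s, 0 ≤ Y s) :
    (TeamForm.or (.and β χ) (.and γ θ)).WSat Y ↔
      χ.WSat (fun s => Y s * ind (E s)) ∧ θ.WSat (fun s => Y s * ind (¬ E s)) := by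
  constructor
  · rintro ⟨Y1, Y2, h1, h2, hs, ⟨a1, a2⟩, b1, b2⟩
    rw [hβ _ h1] at a1
    rw [hγ _ h2] at b1
    have c1 : Y1 = fun s => Y s * ind (E s) := by
      funext s
      by_cases h : E s
      · have : Y2 s = 0 := le_antisymm (not_lt.1 fun h' => b1 s h' h) (h2 s)
        rw [ind_of h, ← hs, this]; ring
      · have : Y1 s = 0 := le_antisymm (not_lt.1 fun h' => h (a1 s h')) (h1 s)
        rw [ind_of_not h, this]; ring
    have c2 : Y2 = fun s => Y s * ind (¬ E s) := by
      funext s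
      have := congrFun c1 s
      rw [ind_not, mul_sub, ← this, ← hs]; ring
    exact ⟨c1 ▸ a2, c2 ▸ b2⟩
  · rintro ⟨h1, h2⟩
    have n1 (s) : 0 ≤ Y s * ind (E s) := mul_nonneg (hY s) (ind_nonneg _)
    have n2 (s) : 0 ≤ Y s * ind (¬ E s) := mul_nonneg (hY s) (ind_nonneg _)
    refine ⟨_, _, n1, n2, fun s => by rw [ind_not]; ring,
      ⟨(hβ _ n1).2 fun s hs => ?_, h1⟩, (hγ _ n2).2 fun s hs => ?_, h2⟩
    · by_contra h
      rw [ind_of_not h] at hs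
      simp at hs
    · intro h
      rw [ind_of_not (not_not.2 h)] at hs
      simp at hs

theorem mul_ind_pos {x : ℝ} {p : Prop} : 0 < x * ind p ↔ 0 < x ∧ p := by
  by_cases h : p <;> simp [ind, h]

theorem exists_fun_of_dep {α β γ : Type*} [Nonempty γ] (S : α → Prop) (u : α → β) (y : α → γ)
    (h : ∀ a a', S a → S a' → u a = u a' → y a = y a') : ∃ G : β → γ, ∀ a, S a → y a = G (u a) := by
  have (b : β) : ∃ c, ∀ a, S a → u a = b → y a = c := by
    by_cases hb : ∃ a, S a ∧ u a = b
    · obtain ⟨a, ha, rfl⟩ := hb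
      exact ⟨y a, fun a' ha' h' => h a' a ha' ha h'⟩
    · exact ⟨Classical.arbitrary γ, fun a ha h' => (hb ⟨a, ha, h'⟩).elim⟩
  choose G hG using this
  exact ⟨G, fun a ha => hG _ a ha rfl⟩

theorem exists_fun_of_exists {α β γ : Type*} [Nonempty γ] (S : α → Prop) (u : α → β)
    (R : β → γ → Prop) (h : ∀ a, S a → ∃ c, R (u a) c) : ∃ G : β → γ, ∀ a, S a → R (u a) (G (u a)) := by
  have (b : β) : ∃ c, (∃ c, R b c) → R b c := by
    by_cases hb : ∃ c, R b c
    · exact ⟨hb.choose, fun _ => hb.choose_spec⟩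
    · exact ⟨Classical.arbitrary γ, fun h => (hb h).elim⟩
  choose G hG using this
  exact ⟨G, fun a ha => hG _ (h a ha)⟩

/-! ### Closure properties of definability over encoded functions -/

namespace TeamDef

variable {τ : FirstOrder.Language.{v, w}} {Γ : List ℕ} {n : ℕ} {D : Set AtomKind}
  {P Q : Property.{u} τ Γ n}

theorem congr (hP : TeamDef τ D P)
    (h : ∀ (A : Type u) [τ.Structure A] [Fintype A] [Nontrivial A] (ρ : FEnv Γ A) (s : Fin n → A),
      P A ρ s ↔ Q A ρ s) : TeamDef τ D Q := by
  have : P = Q := by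
    funext A _ _ _ ρ s
    exact propext (h A ρ s)
  exact this ▸ hP

theorem flat {E : Event.{u} τ n} (hE : Flat τ n E) :
    TeamDef τ (Γ := Γ) D (fun A _ _ _ _ s => E A s) := by
  intro N v π
  obtain ⟨⟨χ, hχ, h⟩, -⟩ := (hE.comap v).exists_teamForm
  exact ⟨χ, atomsIn_mono (Set.empty_subset _) hχ, fun A _ _ _ Y ρ hY _ => h A Y hY⟩

theorem and (hP : TeamDef τ D P) (hQ : TeamDef τ D Q) :
    TeamDef τ D (fun A _ _ _ ρ s => P A ρ s ∧ Q A ρ s) := by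
  intro N v π
  obtain ⟨χ, hχ, h⟩ := hP N v π
  obtain ⟨θ, hθ, g⟩ := hQ N v π
  refine ⟨.and χ θ, ⟨hχ, hθ⟩, fun A _ _ _ Y ρ hY hE => ?_⟩
  simp only [WSat, h A Y ρ hY hE, g A Y ρ hY hE]
  exact ⟨fun H t ht => ⟨H.1 t ht, H.2 t ht⟩,
    fun H => ⟨fun t ht => (H t ht).1, fun t ht => (H t ht).2⟩⟩

/-- The team is split by `E`, which is a condition on the values of `v`; no dependence atom is
needed. -/
theorem flat_or {E : Event.{u} τ n} (hE : Flat τ n E) (hP : TeamDef τ D P) :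
    TeamDef τ D (fun A _ _ _ ρ s => E A s ∨ P A ρ s) := by
  intro N v π
  obtain ⟨⟨β, hβ, hβs⟩, γ, hγ, hγs⟩ := (hE.comap v).exists_teamForm
  obtain ⟨θ, hθ, g⟩ := hP N v π
  -- `β` is repeated only to match the shape of `wsat_or_split`.
  refine ⟨.or (.and β β) (.and γ θ), ⟨⟨?_, ?_⟩, ?_, hθ⟩, fun A _ _ _ Y ρ hY hE => ?_⟩
  · exact atomsIn_mono (Set.empty_subset _) hβ
  · exact atomsIn_mono (Set.empty_subset _) hβ
  · exact atomsIn_mono (Set.empty_subset _) hγ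
  rw [wsat_or_split (hβs A) (hγs A) hY, hβs A _ fun s => mul_nonneg (hY s) (ind_nonneg _),
    g A _ ρ (fun s => mul_nonneg (hY s) (ind_nonneg _))
      (hE.restrict (fun c => ¬ E A c) fun t => rfl)]
  simp only [mul_ind_pos]
  refine ⟨fun H t ht => ?_, fun H => ⟨fun t ht => ht.2, fun t ht => (H t ht.1).resolve_left ht.2⟩⟩
  by_cases h : E A fun l => t (v l)
  · exact Or.inl h
  · exact Or.inr (H.2 t ⟨ht, h⟩)

/-- The fresh variable is uniform and independent of the old ones, so conditioning on it in addition
to `v` leaves the encoded functions unchanged. -/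
theorem all {P : Property.{u} τ Γ (n + 1)} (hP : TeamDef τ D P) :
    TeamDef τ D (fun A _ _ _ ρ s => ∀ a, P A ρ (ext s a)) := by
  intro N v π
  obtain ⟨χ, hχ, h⟩ := hP (N + 1) (ext (fun l => (v l).castSucc) (Fin.last N)) (π.map Fin.castSucc)
  refine ⟨.all χ, hχ, fun A _ _ _ Y ρ hY hE => ?_⟩
  refine (h A _ (fun c => ρ (restr c)) (unif_nonneg hY) ?_).trans ?_
  · intro k f z F
    rw [sum_unif_mul, sum_unif_mul]
    have key (a : A) := hE k f z (fun c => F (ext c a))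
    simp only [comp_ext, pointEnv_map, Fin.snoc_castSucc, Fin.snoc_last, Fin.init_snoc]
    simp only [mul_div_assoc', Finset.mul_sum, ← Finset.sum_div]
    rw [Finset.sum_comm]
    conv_rhs => rw [Finset.sum_comm]
    simp only [key]
  · rw [forall_ext]
    simp only [comp_ext, unif_ext, Fin.snoc_castSucc, Fin.snoc_last, Fin.init_snoc,
      div_pos_iff_of_pos_right (card_pos' A)]
    exact ⟨fun H t ht a => H t a ht, fun H t a ht => H t ht a⟩

theorem num {O : Set NumOp} (hO : NumOp.times ∉ O) (hD : AtomKind.marginalIdentity ∈ D)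
    {i j : NumTerm Γ n} (hi : i.Over O {0, 1}) (hj : j.Over O {0, 1}) :
    TeamDef τ D (fun _ _ _ _ ρ s => i.eval ρ s = j.eval ρ s) := by
  intro N v π
  obtain ⟨κ, hκ, h1, h2⟩ := repUpTo_eval (τ := τ) hO i hi π v
  obtain ⟨μ, hμ, g1, g2⟩ := repUpTo_eval (τ := τ) hO j hj π v
  -- Cross multiplication gives both sides the common factor `κ * μ`.
  obtain ⟨χ, hχ, h⟩ := exists_compare (g1.mul h2) (h1.mul g2) v
  refine ⟨χ, atomsIn_mono (by simpa using hD) hχ, fun A _ _ _ Y ρ hY hE => (h A Y hY).trans ?_⟩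
  have e1 (F : (Fin n → A) → ℝ) := hE.sum_eval hO i hi id F
  have e2 (F : (Fin n → A) → ℝ) := hE.sum_eval hO j hj id F
  simp only [id] at e1 e2
  have c : κ A * μ A ≠ 0 := mul_ne_zero (hκ A).ne' (hμ A).ne'
  have f1 (F : (Fin n → A) → ℝ) : ∑ t, Y t * (F (fun l => t (v l)) *
      (μ A * (κ A * i.eval (pointEnv π t) (fun l => t (v l))))) = κ A * μ A *
      ∑ t, Y t * (F (fun l => t (v l)) * i.eval (ρ fun l => t (v l)) (fun l => t (v l))) := by
    rw [← e1, Finset.mul_sum]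
    exact Finset.sum_congr rfl fun t _ => by ring
  have f2 (F : (Fin n → A) → ℝ) : ∑ t, Y t * (F (fun l => t (v l)) *
      (κ A * (μ A * j.eval (pointEnv π t) (fun l => t (v l))))) = κ A * μ A *
      ∑ t, Y t * (F (fun l => t (v l)) * j.eval (ρ fun l => t (v l)) (fun l => t (v l))) := by
    rw [← e2, Finset.mul_sum]
    exact Finset.sum_congr rfl fun t _ => by ring
  simp only [f1, f2, mul_right_inj' c]
  constructor
  · intro H t ht
    -- Testing against the difference itself gives a vanishing weighted sum of squares.
    have := H (fun c => i.eval (ρ c) c - j.eval (ρ c) c)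
    rw [← sub_eq_zero, ← Finset.sum_sub_distrib] at this
    have sq : ∑ t, Y t * (i.eval (ρ fun l => t (v l)) (fun l => t (v l)) -
        j.eval (ρ fun l => t (v l)) (fun l => t (v l))) ^ 2 = 0 :=
      (Finset.sum_congr rfl fun t _ => by ring).trans this
    have hz := (Finset.sum_eq_zero_iff_of_nonneg fun t _ => mul_nonneg (hY t) (sq_nonneg _)).1
      sq t (Finset.mem_univ _)
    simpa [ht.ne', sub_eq_zero] using hz
  · intro H F
    refine Finset.sum_congr rfl fun t _ => ?_
    rcases (hY t).eq_or_lt with h | h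
    · simp [← h]
    · rw [H t h]

/-- The dependence atom makes the witness a function of `v`, so conditioning on `v` and the witness
is the same as conditioning on `v`. -/
theorem ex {P : Property.{u} τ Γ (n + 1)} (hD : AtomKind.dependence ∈ D) (hP : TeamDef τ D P) :
    TeamDef τ D (fun A _ _ _ ρ s => ∃ a, P A ρ (ext s a)) := by
  intro N v π
  obtain ⟨χ, hχ, h⟩ := hP (N + 1) (ext (fun l => (v l).castSucc) (Fin.last N)) (π.map Fin.castSucc)
  refine ⟨.ex (.and (.dependence (fun l => (v l).castSucc) (Fin.last N)) χ), ⟨hD, hχ⟩,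
    fun A _ _ _ Y ρ hY hE => ?_⟩
  have henc (Y2 : (Fin (N + 1) → A) → ℝ) (h0 : ∀ t, 0 ≤ Y2 t) (hp : ∀ s, ∑ a, Y2 (ext s a) = Y s)
      (G : (Fin n → A) → A)
      (hG : ∀ t, 0 < Y2 t → t (Fin.last N) = G (fun l => t (v l).castSucc)) :
      Encodes Y2 (ext (fun l => (v l).castSucc) (Fin.last N)) (π.map Fin.castSucc)
        (fun c => ρ (restr c)) := by
    intro k f z F
    -- On the support the new value is `G` of the old ones, so a test function of the extended tuple
    -- is one of `v` alone.
    have := hE.of_proj hp k f z (fun c => F (ext c (G c)))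
    simp only [comp_ext, Fin.init_snoc]
    have h' (t : Fin (N + 1) → A) (x : ℝ) :
        Y2 t * (F (ext (fun l => t (v l).castSucc) (t (Fin.last N))) * x) =
        Y2 t * (F (ext (fun l => t (v l).castSucc) (G (fun l => t (v l).castSucc))) * x) := by
      rcases (h0 t).eq_or_lt with h | h
      · simp [← h]
      · rw [hG t h]
    simp only [h', this]
  constructor
  · rintro ⟨Y2, h0, hp, hdep, h2⟩ t ht
    obtain ⟨G, hG⟩ := exists_fun_of_dep (fun t => 0 < Y2 t) (fun t l => t (v l).castSucc)
      (fun t => t (Fin.last N)) fun t t' ht ht' htt => hdep t t' ht ht' (congrFun htt)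
    rw [h A Y2 _ h0 (henc Y2 h0 hp G hG)] at h2
    obtain ⟨a, ha⟩ := exists_ext_pos hp ht
    have := h2 _ ha
    simp only [comp_ext, Fin.init_snoc, Fin.snoc_castSucc, Fin.snoc_last] at this
    exact ⟨a, this⟩
  · intro H
    obtain ⟨G, hG⟩ := exists_fun_of_exists (fun t => 0 < Y t) (fun t l => t (v l))
      (fun c a => P A (ρ c) (ext c a)) H
    have n2 := detExt_nonneg hY (fun t => G fun l => t (v l))
    have hp := detExt_proj Y (fun t => G fun l => t (v l))
    have hG' (t) (ht : 0 < detExt Y (fun t => G fun l => t (v l)) t) :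
        t (Fin.last N) = G (fun l => t (v l).castSucc) := eq_of_detExt_pos ht
    refine ⟨_, n2, hp, fun s s' hs hs' hss => ?_,
      (h A _ _ n2 (henc _ n2 hp G hG')).2 fun t ht => ?_⟩
    · rw [hG' s hs, hG' s' hs', funext hss]
    · simp only [comp_ext, Fin.init_snoc]
      rw [hG' t ht]
      exact hG _ (pos_of_detExt_pos ht)

end TeamDef

/-! ### Blocks of universally quantified variables -/

section Blocks

variable {A : Type u} [Fintype A] {N : ℕ}

theorem sum_append {M : Type*} [AddCommMonoid M] {k : ℕ} (F : (Fin (N + k) → A) → M) :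
    ∑ t, F t = ∑ s : Fin N → A, ∑ u : Fin k → A, F (Fin.append s u) := by
  rw [← (Fin.appendEquiv N k).sum_comp F, Fintype.sum_prod_type]
  rfl

/-- The weights of the team after universal quantification of `k` variables. -/
noncomputable def unifs (k : ℕ) (Y : (Fin N → A) → ℝ) (t : Fin (N + k) → A) : ℝ :=
  Y (fun l => t (Fin.castAdd k l)) / (Fintype.card A : ℝ) ^ k

theorem unifs_nonneg {k : ℕ} {Y : (Fin N → A) → ℝ} (hY : ∀ s, 0 ≤ Y s) (t : Fin (N + k) → A) :
    0 ≤ unifs k Y t :=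
  div_nonneg (hY _) (by positivity)

theorem sum_unifs_mul {k : ℕ} (Y : (Fin N → A) → ℝ) (F : (Fin (N + k) → A) → ℝ) :
    ∑ t, unifs k Y t * F t =
      ∑ s, Y s * ((∑ u, F (Fin.append s u)) / (Fintype.card A : ℝ) ^ k) := by
  rw [sum_append]
  refine Finset.sum_congr rfl fun s _ => ?_
  simp only [unifs, Fin.append_left, ← Finset.mul_sum]
  ring

theorem sum_fiber {ι κ : Type*} [Fintype ι] [Fintype κ] (Y : ι → ℝ) (u : ι → κ) (F : κ → ℝ)
    (X : ι → ℝ) :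
    ∑ t, Y t * (F (u t) * X t) = ∑ c, F c * ∑ t, Y t * (ind (u t = c) * X t) := by
  simp only [Finset.mul_sum]
  rw [Finset.sum_comm]
  refine Finset.sum_congr rfl fun t _ => ?_
  rw [← sum_mul_ind' (u t) F, Finset.sum_mul, Finset.mul_sum]
  exact Finset.sum_congr rfl fun c _ => by ring

end Blocks

/-- Universal quantification of `k` variables. -/
def TeamForm.alls {τ : FirstOrder.Language.{v, w}} {N : ℕ} :
    (k : ℕ) → TeamForm τ (N + k) → TeamForm τ N
  | 0, χ => χ
  | k + 1, χ => alls k (.all (n := N + k) χ)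

theorem TeamForm.atomsIn_alls {τ : FirstOrder.Language.{v, w}} {D : Set AtomKind} {N k : ℕ}
    {χ : TeamForm τ (N + k)} (h : χ.AtomsIn D) : (alls k χ).AtomsIn D := by
  induction k with
  | zero => exact h
  | succ k ih => exact ih (χ := .all (n := N + k) χ) h

theorem TeamForm.wsat_alls {τ : FirstOrder.Language.{v, w}} {A : Type u} [τ.Structure A] [Fintype A]
    {N k : ℕ} (χ : TeamForm τ (N + k)) (Y : (Fin N → A) → ℝ) :
    (alls k χ).WSat Y ↔ χ.WSat (unifs k Y) := by
  induction k with
  | zero =>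
    have : unifs 0 Y = Y := by
      funext t
      simp [unifs]
    rw [this]
    rfl
  | succ k ih =>
    refine (ih (.all (n := N + k) χ)).trans ?_
    have : unif (n := N + k) (unifs k Y) = unifs (k + 1) Y := by
      funext t
      rw [unif, unifs, unifs, pow_succ, div_div]
      rfl
    rw [← this]
    rfl

/-! ### Disjunction and function quantification over encoded functions -/

namespace TeamDef

variable {τ : FirstOrder.Language.{v, w}} {Γ : List ℕ} {n : ℕ} {D : Set AtomKind}
  {P Q : Property.{u} τ Γ n}

/-- The chosen disjunct is recorded by whether two new variables agree. Both depend on `v`, so the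
team is split by a condition on `v`. -/
theorem or (hD : AtomKind.dependence ∈ D) (hP : TeamDef τ D P) (hQ : TeamDef τ D Q) :
    TeamDef τ D (fun A _ _ _ ρ s => P A ρ s ∨ Q A ρ s) := by
  intro N v π
  let v2 : Fin n → Fin (N + 2) := fun l => (v l).castSucc.castSucc
  let y : Fin (N + 2) := (Fin.last N).castSucc
  let z : Fin (N + 2) := Fin.last (N + 1)
  obtain ⟨⟨β, hβ, hβs⟩, γ, hγ, hγs⟩ := (Flat.eq (τ := τ) y z).exists_teamForm
  obtain ⟨χ, hχ, h⟩ := hP (N + 2) v2 ((π.map Fin.castSucc).map Fin.castSucc)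
  obtain ⟨θ, hθ, g⟩ := hQ (N + 2) v2 ((π.map Fin.castSucc).map Fin.castSucc)
  refine ⟨.ex (.ex (.and (.and (.dependence v2 y) (.dependence v2 z))
    (.or (.and β χ) (.and γ θ)))), ⟨⟨hD, hD⟩, ⟨atomsIn_mono (Set.empty_subset _) hβ, hχ⟩,
      atomsIn_mono (Set.empty_subset _) hγ, hθ⟩, fun A _ _ _ Y ρ hY hE => ?_⟩
  have hsplit (Y2 : (Fin (N + 2) → A) → ℝ) (h0 : ∀ t, 0 ≤ Y2 t)
      (henc : Encodes Y2 v2 ((π.map Fin.castSucc).map Fin.castSucc) ρ) (K : (Fin n → A) → Prop)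
      (hK : ∀ t, 0 < Y2 t → (t y = t z ↔ K fun l => t (v2 l))) :
      (TeamForm.or (.and β χ) (.and γ θ)).WSat Y2 ↔
        (∀ t, 0 < Y2 t ∧ t y = t z → P A (ρ fun l => t (v2 l)) (fun l => t (v2 l))) ∧
        (∀ t, 0 < Y2 t ∧ ¬ t y = t z → Q A (ρ fun l => t (v2 l)) (fun l => t (v2 l))) := by
    have hK' (t) : Y2 t * ind (t y = t z) = Y2 t * ind (K fun l => t (v2 l)) := by
      rcases (h0 t).eq_or_lt with h | h
      · simp [← h]
      · rw [hK t h]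
    rw [wsat_or_split (hβs A) (hγs A) h0,
      h A _ ρ (fun s => mul_nonneg (h0 s) (ind_nonneg _)) (henc.restrict K hK'),
      g A _ ρ (fun s => mul_nonneg (h0 s) (ind_nonneg _)) (henc.restrict (fun c => ¬ K c)
        fun t => by rw [ind_not, ind_not, mul_sub, mul_sub, hK'])]
    simp only [mul_ind_pos]
  constructor
  · rintro ⟨Y1, h1, hp1, Y2, h2, hp2, ⟨d1, d2⟩, hor⟩ t ht
    obtain ⟨G, hG⟩ := exists_fun_of_dep (fun t => 0 < Y2 t) (fun t l => t (v2 l))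
      (fun t => t y) fun t t' ht ht' htt => d1 t t' ht ht' (congrFun htt)
    obtain ⟨G', hG'⟩ := exists_fun_of_dep (fun t => 0 < Y2 t) (fun t l => t (v2 l))
      (fun t => t z) fun t t' ht ht' htt => d2 t t' ht ht' (congrFun htt)
    rw [hsplit Y2 h2 ((hE.of_proj hp1).of_proj hp2) (fun c => G c = G' c)
      fun t ht => by rw [← hG t ht, ← hG' t ht]] at hor
    obtain ⟨a, ha⟩ := exists_ext_pos hp1 ht
    obtain ⟨b, hb⟩ := exists_ext_pos hp2 ha
    by_cases hab : a = b
    · left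
      simpa [v2] using hor.1 (ext (ext t a) b) ⟨hb, by simpa [y, z] using hab⟩
    · right
      simpa [v2] using hor.2 (ext (ext t a) b) ⟨hb, by simpa [y, z] using hab⟩
  · intro H
    obtain ⟨a, b, hab⟩ := exists_pair_ne A
    classical
    -- The first new variable is constantly `a`; the second agrees with it exactly where `P` holds.
    let G (t : Fin (N + 1) → A) : A :=
      if P A (ρ fun l => t (v l).castSucc) (fun l => t (v l).castSucc) then a else b
    have n1 := detExt_nonneg hY (fun _ => a)
    have n2 := detExt_nonneg n1 G
    have p1 := detExt_proj Y (fun _ => a)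
    have p2 := detExt_proj (detExt Y (fun _ => a)) G
    have ey (t) (ht : 0 < detExt (detExt Y (fun _ => a)) G t) : t y = a :=
      eq_of_detExt_pos (pos_of_detExt_pos ht)
    have ez (t) (ht : 0 < detExt (detExt Y (fun _ => a)) G t) :
        t z = if P A (ρ fun l => t (v2 l)) (fun l => t (v2 l)) then a else b :=
      eq_of_detExt_pos ht
    have eyz (t) (ht : 0 < detExt (detExt Y (fun _ => a)) G t) :
        t y = t z ↔ P A (ρ fun l => t (v2 l)) (fun l => t (v2 l)) := by
      rw [ey t ht, ez t ht]
      by_cases hp : P A (ρ fun l => t (v2 l)) (fun l => t (v2 l)) <;> simp [hp, hab]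
    refine ⟨_, n1, p1, _, n2, p2, ⟨fun s s' hs hs' hss => ?_, fun s s' hs hs' hss => ?_⟩,
      (hsplit _ n2 ((hE.of_proj p1).of_proj p2) (fun c => P A (ρ c) c) eyz).2
        ⟨fun t ht => ?_, fun t ht => ?_⟩⟩
    · rw [ey s hs, ey s' hs']
    · rw [ez s hs, ez s' hs', funext hss]
    · exact (eyz t ht.1).1 ht.2
    · exact (H _ (pos_of_detExt_pos (pos_of_detExt_pos ht.1))).resolve_left
        fun hp => ht.2 ((eyz t ht.1).2 hp)

/-- The value `h b` is the conditional probability of `y = z` given `v` and `x = b`, where `x` and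
`y` are uniform and `z` is existentially quantified. The exponent `k` compensates for the
probability of `x = b`. Averaging over all assignments with the same `v` makes `h` a function of `v`
without a dependence atom. -/
theorem exF {k : ℕ} {P : Property.{u} τ (k :: Γ) n} (hP : TeamDef τ D P) :
    TeamDef τ D (fun A _ _ _ ρ s =>
      ∃ h : (Fin k → A) → ℝ, (∀ a, h a ∈ Set.Icc (0 : ℝ) 1) ∧ P A (FEnv.cons h ρ) s) := by
  intro N v π
  let up : Fin N → Fin (N + k + 2) := fun l => (Fin.castAdd k l).castSucc.castSucc
  let x : Fin k → Fin (N + k + 2) := fun l => (Fin.natAdd N l).castSucc.castSucc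
  let y : Fin (N + k + 2) := (Fin.last (N + k)).castSucc
  let z : Fin (N + k + 2) := Fin.last (N + k + 1)
  obtain ⟨χ, hχ, H⟩ := hP (N + k + 2) (fun l => up (v l)) (Pos.cons ⟨x, y, z, k⟩ (π.map up))
  refine ⟨alls k (.all (.ex χ)), atomsIn_alls (χ := .all (.ex χ)) hχ, fun A _ _ _ Y ρ hY hE => ?_⟩
  rw [wsat_alls]
  have hc : (Fintype.card A : ℝ) ^ k ≠ 0 := pow_ne_zero _ (card_pos' A).ne'
  have key (Y3 : (Fin (N + k + 2) → A) → ℝ)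
      (hp : ∀ s, ∑ a, Y3 (ext s a) = unif (unifs k Y) s)
      (F : (Fin N → A) → (Fin k → A) → ℝ) :
      ∑ t, Y3 t * F (fun l => t (up l)) (fun l => t (x l)) =
        ∑ s, Y s * ((∑ u, F s u) / (Fintype.card A : ℝ) ^ k) := by
    have := sum_unifs_mul Y fun t => F (fun l => t (Fin.castAdd k l)) (fun l => t (Fin.natAdd N l))
    rw [← sum_mul_restr (unif_proj (unifs k Y)), ← sum_mul_restr hp] at this
    simp only [Fin.append_left, Fin.append_right] at this
    exact this
  have key' (Y3 : (Fin (N + k + 2) → A) → ℝ)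
      (hp : ∀ s, ∑ a, Y3 (ext s a) = unif (unifs k Y) s) (F : (Fin N → A) → ℝ) :
      ∑ t, Y3 t * F (fun l => t (up l)) = ∑ s, Y s * F s := by
    rw [key Y3 hp fun s _ => F s]
    refine Finset.sum_congr rfl fun s _ => ?_
    simp [mul_div_cancel_left₀ _ hc]
  have henc (Y3 : (Fin (N + k + 2) → A) → ℝ)
      (hp : ∀ s, ∑ a, Y3 (ext s a) = unif (unifs k Y) s) (h : (Fin n → A) → (Fin k → A) → ℝ)
      (hh : ∀ (b : Fin k → A) (F : (Fin n → A) → ℝ),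
        ∑ t, Y3 t * (F (fun l => t (up (v l))) * ((Fintype.card A : ℝ) ^ k *
          (ind ((fun l => t (x l)) = b) * ind (t y = t z)))) =
        ∑ s, Y s * (F (fun l => s (v l)) * h (fun l => s (v l)) b)) :
      Encodes Y3 (fun l => up (v l)) (Pos.cons ⟨x, y, z, k⟩ (π.map up))
        (fun c => FEnv.cons (h c) (ρ c)) := by
    intro m f b F
    cases f with
    | here =>
      have := key' Y3 hp fun s => F (fun l => s (v l)) * h (fun l => s (v l)) b
      exact (hh b F).trans this.symm
    | there f =>
      have h1 := key' Y3 hp fun s => F (fun l => s (v l)) * pointEnv π s m f b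
      have h2 := key' Y3 hp fun s => F (fun l => s (v l)) * ρ (fun l => s (v l)) m f b
      exact h1.trans ((hE m f b F).trans h2.symm)
  have n2 := unif_nonneg (unifs_nonneg (k := k) hY)
  constructor
  · rintro ⟨Y3, n3, hp, hw⟩ t ht
    -- `M c b` is the weight of `v = c`, `x = b`, `y = z`, and `m c` that of `v = c`.
    let M (c : Fin n → A) (b : Fin k → A) : ℝ := ∑ t, Y3 t *
      (ind ((fun l => t (up (v l))) = c) * (ind ((fun l => t (x l)) = b) * ind (t y = t z)))
    let m (c : Fin n → A) : ℝ := ∑ s, Y s * ind ((fun l => s (v l)) = c)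
    have hM0 (c b) : 0 ≤ M c b := Finset.sum_nonneg fun t _ => mul_nonneg (n3 t)
      (mul_nonneg (ind_nonneg _) (mul_nonneg (ind_nonneg _) (ind_nonneg _)))
    -- Since `x` is uniform and independent of `v`, the weight of `v = c`, `x = b` is `m c / |A| ^
    -- k`. This yields `h ≤ 1`.
    have hM (c b) : (Fintype.card A : ℝ) ^ k * M c b ≤ m c := by
      have h1 : M c b ≤ ∑ t, Y3 t * (ind ((fun l => t (up (v l))) = c) *
          ind ((fun l => t (x l)) = b)) := by
        refine Finset.sum_le_sum fun t _ => mul_le_mul_of_nonneg_left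
          (mul_le_mul_of_nonneg_left ?_ (ind_nonneg _)) (n3 t)
        exact mul_le_of_le_one_right (ind_nonneg _) (ind_le_one _)
      rw [key Y3 hp fun s u => ind ((fun l => s (v l)) = c) * ind (u = b)] at h1
      simp only [sum_mul_ind, mul_div_assoc'] at h1
      rw [← Finset.sum_div, le_div_iff₀ (by have := card_pos' A; positivity)] at h1
      rw [mul_comm]
      exact h1
    let h (c : Fin n → A) (b : Fin k → A) : ℝ := (Fintype.card A : ℝ) ^ k * M c b / m c
    have hm0 (c) : 0 ≤ m c := Finset.sum_nonneg fun s _ => mul_nonneg (hY s) (ind_nonneg _)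
    have hmul (c b) : h c b * m c = (Fintype.card A : ℝ) ^ k * M c b := by
      -- If `v = c` has no weight, both sides are zero.
      rcases (hm0 c).eq_or_lt with h0 | h0
      · have : (Fintype.card A : ℝ) ^ k * M c b = 0 :=
          le_antisymm ((hM c b).trans h0.ge) (mul_nonneg (by positivity) (hM0 c b))
        rw [this, ← h0, mul_zero]
      · exact div_mul_cancel₀ _ h0.ne'
    have hw' := (H A Y3 (fun c => FEnv.cons (h c) (ρ c)) n3 (henc Y3 hp h fun b F => ?_)).1 hw
    · obtain ⟨s1, hs1⟩ : ∃ s1 : Fin (N + k) → A, (fun l => s1 (Fin.castAdd k l)) = t :=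
        ⟨Fin.append t fun _ => Classical.arbitrary A, by funext l; simp⟩
      have : 0 < unifs k Y s1 := by
        rw [unifs, hs1]
        have := card_pos' A
        positivity
      obtain ⟨a1, h1⟩ := exists_ext_pos (unif_proj (unifs k Y)) this
      obtain ⟨a2, h2⟩ := exists_ext_pos hp h1
      have h3 := hw' _ h2
      have e : (fun l => ext (ext s1 a1) a2 (up (v l))) = fun l => t (v l) := by
        funext l
        simp [up, ← hs1]
      rw [e] at h3
      exact ⟨h fun l => t (v l), fun b => ⟨div_nonneg (mul_nonneg (by positivity) (hM0 _ _)) (hm0 _),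
        div_le_one_of_le₀ (hM _ _) (hm0 _)⟩, h3⟩
    · have s1 := sum_fiber Y3 (fun t l => t (up (v l))) (fun c => F c * (Fintype.card A : ℝ) ^ k)
        fun t => ind ((fun l => t (x l)) = b) * ind (t y = t z)
      have s2 := sum_fiber Y (fun t l => t (v l)) (fun c => F c * h c b) fun _ => 1
      simp only [mul_one] at s2
      rw [s2]
      refine (Finset.sum_congr rfl fun t _ => by ring).trans (s1.trans ?_)
      refine Finset.sum_congr rfl fun c _ => ?_
      rw [mul_assoc, mul_assoc]
      exact congrArg (F c * ·) (hmul c b).symm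
  · intro Hex
    obtain ⟨h, hh01, hh⟩ : ∃ h : (Fin n → A) → (Fin k → A) → ℝ,
        (∀ c b, h c b ∈ Set.Icc (0 : ℝ) 1) ∧
        ∀ t, 0 < Y t → P A (FEnv.cons (h fun l => t (v l)) (ρ fun l => t (v l))) (fun l => t (v l)) := by
      have (c : Fin n → A) : ∃ h : (Fin k → A) → ℝ, (∀ b, h b ∈ Set.Icc (0 : ℝ) 1) ∧
          ((∃ h : (Fin k → A) → ℝ, (∀ b, h b ∈ Set.Icc (0 : ℝ) 1) ∧ P A (FEnv.cons h (ρ c)) c) →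
            P A (FEnv.cons h (ρ c)) c) := by
        by_cases hex : ∃ h : (Fin k → A) → ℝ, (∀ b, h b ∈ Set.Icc (0 : ℝ) 1) ∧
            P A (FEnv.cons h (ρ c)) c
        · exact ⟨hex.choose, hex.choose_spec.1, fun _ => hex.choose_spec.2⟩
        -- An arbitrary default at values `c` without a witness; by `Hex` these do not occur in the
        -- support.
        · exact ⟨fun _ => 0, fun _ => ⟨le_rfl, zero_le_one⟩, fun h => (hex h).elim⟩
      choose h h1 h2 using this
      exact ⟨h, h1, fun t ht => h2 _ (Hex t ht)⟩
    choose e he using fun a : A => exists_ne a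
    let val (t : Fin (N + k + 1) → A) : ℝ := h (fun l => t (Fin.castAdd k (v l)).castSucc)
      (fun l => t (Fin.natAdd N l).castSucc)
    -- Given the other variables, `z` equals `y` with probability `val` and otherwise takes the
    -- different value `e y`.
    let Y3 (t : Fin (N + k + 2) → A) : ℝ := unif (unifs k Y) (restr t) *
      (val (restr t) * ind (t z = t y) + (1 - val (restr t)) * ind (t z = e (t y)))
    have hval (t) : val t ∈ Set.Icc (0 : ℝ) 1 := hh01 _ _
    have n3 (t) : 0 ≤ Y3 t := mul_nonneg (n2 _) (add_nonneg
      (mul_nonneg (hval _).1 (ind_nonneg _)) (mul_nonneg (sub_nonneg.2 (hval _).2) (ind_nonneg _)))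
    have eY3 (s : Fin (N + k + 1) → A) (a : A) : Y3 (ext s a) = unif (unifs k Y) s *
        (val s * ind (a = s (Fin.last _)) + (1 - val s) * ind (a = e (s (Fin.last _)))) := by
      simp [Y3, y, z]
    have hp (s) : ∑ a, Y3 (ext s a) = unif (unifs k Y) s := by
      simp only [eY3]
      rw [← Finset.mul_sum, Finset.sum_add_distrib, sum_mul_ind (s (Fin.last _)) fun _ => val s,
        sum_mul_ind (e (s (Fin.last _))) fun _ => 1 - val s]
      ring
    refine ⟨Y3, n3, hp, (H A Y3 (fun c => FEnv.cons (h c) (ρ c)) n3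
      (henc Y3 hp h fun b F => ?_)).2 fun t ht => ?_⟩
    · have hsum (s : Fin (N + k + 1) → A) : ∑ a, Y3 (ext s a) * ind (s (Fin.last _) = a) =
          unif (unifs k Y) s * val s := by
        rw [sum_mul_ind', eY3, ind_of rfl, ind_of_not (he _).symm]
        ring
      have h1 := sum_mul_restr (unif_proj (unifs k Y)) fun t =>
        h (fun l => t (Fin.castAdd k (v l))) (fun l => t (Fin.natAdd N l)) *
        (F (fun l => t (Fin.castAdd k (v l))) * ((Fintype.card A : ℝ) ^ k *
          ind ((fun l => t (Fin.natAdd N l)) = b)))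
      rw [sum_unifs_mul] at h1
      rw [sum_ext]
      refine Eq.trans (Finset.sum_congr rfl fun s _ => ?_) (h1.trans ?_)
      · refine Eq.trans ?_ (mul_assoc _ _ _)
        refine Eq.trans ?_ (congrArg (· * _) (hsum s))
        rw [Finset.sum_mul]
        refine Finset.sum_congr rfl fun a _ => ?_
        simp only [up, x, y, z, Fin.snoc_castSucc, Fin.snoc_last]
        simp only [Fin.init]
        ring
      · refine Finset.sum_congr rfl fun s _ => ?_
        simp only [Fin.append_left, Fin.append_right]
        have := sum_mul_ind b fun u => h (fun l => s (v l)) u * (F (fun l => s (v l)) *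
          (Fintype.card A : ℝ) ^ k)
        simp only [← mul_assoc] at this ⊢
        rw [this]
        field_simp
    · have h1 := restr_pos n2 (fun s => unif_proj (unifs k Y) s) (restr_pos n3 hp ht)
      rw [unifs, div_pos_iff_of_pos_right (by have := card_pos' A; positivity)] at h1
      exact hh _ h1

end TeamDef

/-! ### From second-order formulae to team formulae -/

section

variable {τ : FirstOrder.Language.{v, w}}

theorem ESO.teamDef_of_loose {O : Set NumOp} (hO : NumOp.times ∉ O) {D : Set AtomKind}
    (hI : AtomKind.marginalIdentity ∈ D) (hD : AtomKind.dependence ∈ D) {Γ : List ℕ} {n : ℕ}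
    (φ : ESO τ Γ n) (h : φ.Over O {NumRel.eq} {0, 1}) (hL : φ.Loose) :
    TeamDef.{u} τ D (fun _ _ _ _ ρ s => φ.Sat (Set.Icc (0 : ℝ) 1) ρ s) := by
  induction φ with
  | eq x y => exact TeamDef.flat (.eq x y)
  | neq x y => exact TeamDef.flat (Flat.eq x y).not
  | rel R x => exact TeamDef.flat (.rel R x)
  | nrel R x => exact TeamDef.flat (Flat.rel R x).not
  | num e i j =>
    obtain ⟨rfl, hi, hj⟩ := h
    exact TeamDef.num hO hI hi hj
  | nnum e i j => exact hL.elim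
  | and φ ψ ihφ ihψ => exact (ihφ h.1 hL.1).and (ihψ h.2 hL.2)
  | or φ ψ ihφ ihψ => exact (ihφ h.1 hL.1).or hD (ihψ h.2 hL.2)
  | ex φ ih => exact (ih h hL).ex hD
  | all φ ih => exact (ih h hL).all
  | exF k φ ih => exact (ih h hL).exF

theorem ESO.teamDef_of_qFree {O : Set NumOp} (hO : NumOp.times ∉ O) {D : Set AtomKind}
    (hI : AtomKind.marginalIdentity ∈ D) {Γ : List ℕ} {n : ℕ}
    (φ : ESO τ Γ n) (h : φ.Over O {NumRel.eq} {0, 1}) (hL : φ.Loose) (hA : φ.AlmostConjunctive)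
    (hQ : φ.QFree) : TeamDef.{u} τ D (fun _ _ _ _ ρ s => φ.Sat (Set.Icc (0 : ℝ) 1) ρ s) := by
  induction φ with
  | eq x y => exact TeamDef.flat (.eq x y)
  | neq x y => exact TeamDef.flat (Flat.eq x y).not
  | rel R x => exact TeamDef.flat (.rel R x)
  | nrel R x => exact TeamDef.flat (Flat.rel R x).not
  | num e i j =>
    obtain ⟨rfl, hi, hj⟩ := h
    exact TeamDef.num hO hI hi hj
  | nnum e i j => exact hL.elim
  | and φ ψ ihφ ihψ => exact (ihφ h.1 hL.1 hA.1 hQ.1).and (ihψ h.2 hL.2 hA.2 hQ.2)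
  | or φ ψ ihφ ihψ =>
    rcases hA.1 with hN | hN
    · obtain ⟨E, hE, hs⟩ := φ.flat_of_qFree hN hQ.1
      refine (TeamDef.flat_or hE (ihψ h.2 hL.2 hA.2.2 hQ.2)).congr fun A _ _ _ ρ s => ?_
      simp only [Sat, hs]
    · obtain ⟨E, hE, hs⟩ := ψ.flat_of_qFree hN hQ.2
      refine (TeamDef.flat_or hE (ihφ h.1 hL.1 hA.2.1 hQ.1)).congr fun A _ _ _ ρ s => ?_
      simp only [Sat, hs]
      exact or_comm
  | ex φ ih => exact hQ.elim
  | all φ ih => exact hQ.elim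
  | exF k φ ih => exact hQ.elim

theorem ESO.teamDef_of_prefixAll {O : Set NumOp} (hO : NumOp.times ∉ O) {D : Set AtomKind}
    (hI : AtomKind.marginalIdentity ∈ D) {Γ : List ℕ} {n : ℕ}
    {φ : ESO τ Γ n} (hP : φ.PrefixAll) (h : φ.Over O {NumRel.eq} {0, 1}) (hL : φ.Loose)
    (hA : φ.AlmostConjunctive) :
    TeamDef.{u} τ D (fun _ _ _ _ ρ s => φ.Sat (Set.Icc (0 : ℝ) 1) ρ s) := by
  induction hP with
  | qfree hQ => exact teamDef_of_qFree hO hI _ h hL hA hQ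
  | all _ ih => exact (ih h hL hA).all

theorem ESO.teamDef_of_prefixExFAll {O : Set NumOp} (hO : NumOp.times ∉ O) {D : Set AtomKind}
    (hI : AtomKind.marginalIdentity ∈ D) {Γ : List ℕ} {n : ℕ}
    {φ : ESO τ Γ n} (hP : φ.PrefixExFAll) (h : φ.Over O {NumRel.eq} {0, 1}) (hL : φ.Loose)
    (hA : φ.AlmostConjunctive) :
    TeamDef.{u} τ D (fun _ _ _ _ ρ s => φ.Sat (Set.Icc (0 : ℝ) 1) ρ s) := by
  induction hP with
  | base hP => exact teamDef_of_prefixAll hO hI hP h hL hA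
  | exF _ ih => exact (ih h hL hA).exF

/-- Encodings for the empty vocabulary. -/
def Pos.nil {N : ℕ} : Pos [] N :=
  fun _ f => nomatch f

/-- With `v` empty, conditional expectation is expectation, because the mass is one. The additional
variable is compared with itself, an event that always holds; it is there because for `n = 0` the
team has no variable to name. -/
theorem encodes_unif {A : Type u} [Fintype A] [Nonempty A] {n : ℕ} {f : (Fin n → A) → ℝ}
    (hf : ∑ s, f s = 1) :
    Encodes (unif f) Fin.elim0 (Pos.cons ⟨Fin.castSucc, Fin.last n, Fin.last n, 0⟩ Pos.nil)
      (fun _ => FEnv.cons f FEnv.nil) := by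
  intro k g z F
  cases g with
  | there g => exact nomatch g
  | here =>
    have h1 := sum_mul_restr (unif_proj f) fun s => F Fin.elim0 * ind (s = z)
    have h2 := sum_mul_restr (unif_proj f) fun _ => F Fin.elim0 * f z
    have h3 := sum_mul_ind z fun s => F Fin.elim0 * f s
    rw [← Finset.sum_mul Finset.univ f, hf, one_mul, ← h3] at h2
    have e (t : Fin (n + 1) → A) : F (fun l => t (Fin.elim0 l)) = F Fin.elim0 :=
      congrArg F (Subsingleton.elim _ _)
    refine Eq.trans (Finset.sum_congr rfl fun t _ => ?_) ((h1.trans ?_).trans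
      (h2.symm.trans (Finset.sum_congr rfl fun t _ => ?_)))
    · rw [e]
      simp [pointEnv, Pos.cons, ind_of]
      left; left; rfl
    · exact Finset.sum_congr rfl fun s _ => by ring
    · rw [e, h3]
      rfl

theorem TeamDef.exists_struc_eq {D : Set AtomKind} {n : ℕ} {ψ : ESO τ [n] 0}
    (h : TeamDef.{u} τ D (fun _ _ _ _ ρ s => ψ.Sat (Set.Icc (0 : ℝ) 1) ρ s)) :
    ∃ φ ∈ FO τ n D, TeamForm.Struc.{u} φ = ESO.Struc.{u} (Set.Icc (0 : ℝ) 1) ψ := by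
  obtain ⟨χ, hχ, H⟩ := h (n + 1) Fin.elim0
    (Pos.cons ⟨Fin.castSucc, Fin.last n, Fin.last n, 0⟩ Pos.nil)
  refine ⟨.all χ, hχ, ?_⟩
  ext M
  have h0 := M.dist.1
  have h1 := M.dist.2
  have hs := H M.A (unif M.f) _ (unif_nonneg h0) (encodes_unif h1)
  have e (t : Fin (n + 1) → M.A) : (fun l => t (Fin.elim0 l)) = Fin.elim0 := Subsingleton.elim _ _
  simp only [e] at hs
  refine (sat_iff_wsat _ (Or.inl M.dist)).trans (hs.trans ⟨fun H => ?_, fun H t _ => H⟩)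
  -- The property no longer depends on the assignment, so one assignment in the support is enough.
  obtain ⟨t, -, ht⟩ : ∃ t ∈ Finset.univ, 0 < unif M.f t := by
    apply Finset.exists_lt_of_sum_lt
    rw [sum_eq_of_proj (unif_proj M.f), h1]
    simp
  exact H t ht

end

/-! ### From team formulae to second-order formulae -/

/-- All functions have values in the unit interval. -/
def Bounded {Γ : List ℕ} {A : Type u} (ρ : FEnv Γ A) : Prop :=
  ∀ k (f : FVar Γ k) (a : Fin k → A), ρ k f a ∈ Set.Icc (0 : ℝ) 1

theorem Bounded.cons {Γ : List ℕ} {A : Type u} {ρ : FEnv Γ A} (hρ : Bounded ρ) {k : ℕ}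
    {h : (Fin k → A) → ℝ} (hh : ∀ a, h a ∈ Set.Icc (0 : ℝ) 1) : Bounded (FEnv.cons h ρ) := by
  intro m f a
  cases f with
  | here => exact hh a
  | there f => exact hρ m f a

/-- Properties of interpretations of the function symbols in `Γ`, uniformly in the structure. -/
abbrev EnvProp (τ : FirstOrder.Language.{v, w}) (Γ : List ℕ) :=
  ∀ (A : Type u) [τ.Structure A] [Fintype A] [Nontrivial A], FEnv Γ A → Prop

/-- The closure properties of a second-order logic that are needed to express team semantics. -/
structure SumLogic (τ : FirstOrder.Language.{v, w})
    (𝒞 : (Γ : List ℕ) → EnvProp.{u} τ Γ → Prop) : Prop where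
  and {Γ : List ℕ} {P Q : EnvProp.{u} τ Γ} : 𝒞 Γ P → 𝒞 Γ Q →
    𝒞 Γ (fun A _ _ _ ρ => P A ρ ∧ Q A ρ)
  exF {Γ : List ℕ} {k : ℕ} {P : EnvProp.{u} τ (k :: Γ)} : 𝒞 (k :: Γ) P →
    𝒞 Γ (fun A _ _ _ ρ =>
      ∃ h : (Fin k → A) → ℝ, (∀ a, h a ∈ Set.Icc (0 : ℝ) 1) ∧ P A (FEnv.cons h ρ))
  guardEq {Γ : List ℕ} {m k l : ℕ} {E : Event.{u} τ m} (hE : Flat τ m E) (f : FVar Γ k)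
    (x : Fin k → Fin m) (g : FVar Γ l) (y : Fin l → Fin m) :
    𝒞 Γ (fun A _ _ _ ρ => ∀ s : Fin m → A, E A s →
      ρ k f (fun i => s (x i)) = ρ l g (fun i => s (y i)))
  guardZero {Γ : List ℕ} {m k : ℕ} {E : Event.{u} τ m} (hE : Flat τ m E) (f : FVar Γ k)
    (x : Fin k → Fin m) :
    𝒞 Γ (fun A _ _ _ ρ => ∀ s : Fin m → A, E A s → ρ k f (fun i => s (x i)) = 0)
  sum {Γ : List ℕ} {m k : ℕ} (g : FVar Γ (m + 1)) (f : FVar Γ k) (y : Fin k → Fin m) :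
    𝒞 Γ (fun A _ _ _ ρ => ∀ s : Fin m → A,
      ∑ a, ρ (m + 1) g (ext s a) = ρ k f (fun i => s (y i)))

/-- There is a property in `𝒞` that agrees with `P` on bounded interpretations. -/
def DefIn {τ : FirstOrder.Language.{v, w}} (𝒞 : (Γ : List ℕ) → EnvProp.{u} τ Γ → Prop)
    {Γ : List ℕ} (P : EnvProp.{u} τ Γ) : Prop :=
  ∃ Q, 𝒞 Γ Q ∧ ∀ (A : Type u) [τ.Structure A] [Fintype A] [Nontrivial A] (ρ : FEnv Γ A),
    Bounded ρ → (Q A ρ ↔ P A ρ)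

namespace SumLogic

variable {τ : FirstOrder.Language.{v, w}} {𝒞 : (Γ : List ℕ) → EnvProp.{u} τ Γ → Prop}

/-- Sums over one variable are iterated through quantified functions holding the intermediate sums.
-/
theorem sumBlock (h𝒞 : SumLogic τ 𝒞) {Γ : List ℕ} {m k l : ℕ} (g : FVar Γ (m + k)) (f : FVar Γ l)
    (y : Fin l → Fin m) :
    DefIn 𝒞 (fun A _ _ _ (ρ : FEnv Γ A) => ∀ s : Fin m → A,
      ∑ u : Fin k → A, ρ (m + k) g (Fin.append s u) = ρ l f (fun i => s (y i))) := by
  induction k generalizing Γ with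
  | zero =>
    refine ⟨_, h𝒞.guardEq Flat.top g id f y, fun A _ _ _ ρ _ => ?_⟩
    simp [Fin.append_right_nil _ _ rfl]
  | succ k ih =>
    obtain ⟨Q, hQ, h⟩ := ih (Γ := (m + k) :: Γ) .here (.there f)
    refine ⟨_, h𝒞.exF (h𝒞.and (h𝒞.sum (m := m + k) (.there g) .here id) hQ),
      fun A _ _ _ ρ hρ => ?_⟩
    have hs (s : Fin m → A) : ∑ u : Fin (k + 1) → A, ρ (m + (k + 1)) g (Fin.append s u) =
        ∑ u : Fin k → A, ∑ a, ρ (m + (k + 1)) g (ext (Fin.append s u) a) := by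
      rw [sum_ext]
      refine Finset.sum_congr rfl fun u _ => Finset.sum_congr rfl fun b _ => ?_
      rw [ext, ext, Fin.append_snoc]
    simp only [hs]
    constructor
    · rintro ⟨e, he, h1, h2⟩ s
      rw [h A _ (hρ.cons he)] at h2
      exact (Finset.sum_congr rfl fun u _ => h1 _).trans (h2 s)
    · intro H
      have h0 (t : Fin (m + k) → A) : 0 ≤ ∑ a, ρ (m + (k + 1)) g (ext t a) :=
        Finset.sum_nonneg fun a _ => (hρ _ _ _).1
      have he (t : Fin (m + k) → A) : ∑ a, ρ (m + (k + 1)) g (ext t a) ∈ Set.Icc (0 : ℝ) 1 := by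
        -- An intermediate sum is a nonnegative part of a total that equals a value of `f`, hence is
        -- at most one.
        refine ⟨h0 t, le_trans ?_ ((H fun l => t (Fin.castAdd k l)).le.trans (hρ _ _ _).2)⟩
        have := Finset.single_le_sum (f := fun u => ∑ a, ρ (m + (k + 1)) g
          (ext (Fin.append (fun l => t (Fin.castAdd k l)) u) a)) (fun u _ => h0 _)
          (Finset.mem_univ fun l => t (Fin.natAdd m l))
        simpa only [Fin.append_castAdd_natAdd] using this
      exact ⟨_, he, fun s => rfl, (h A _ (hρ.cons he)).2 fun s => H s⟩

/-- A quantified function holds the weight of `s` at `(a, s)` if `s` has the value `a` at `x`, and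
zero otherwise; it is then summed over `s`. -/
theorem marginal (h𝒞 : SumLogic τ 𝒞) {Γ : List ℕ} {n k : ℕ} (X : FVar Γ n) (M : FVar Γ k)
    (x : Fin k → Fin n) :
    DefIn 𝒞 (fun A _ _ _ (ρ : FEnv Γ A) => ∀ a : Fin k → A,
      ∑ s, ρ n X s * ind ((fun l => s (x l)) = a) = ρ k M a) := by
  have hE := Flat.tupleEq.{v, w, u} (τ := τ) (fun l => Fin.natAdd k (x l)) (fun l => Fin.castAdd n l)
  obtain ⟨Q, hQ, h⟩ := h𝒞.sumBlock (Γ := (k + n) :: Γ) .here (.there M) id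
  refine ⟨_, h𝒞.exF (h𝒞.and (h𝒞.and
    (h𝒞.guardEq hE .here id (.there X) (Fin.natAdd k))
    (h𝒞.guardZero hE.not .here id)) hQ), fun A _ _ _ ρ hρ => ?_⟩
  constructor
  · rintro ⟨g, hg, ⟨h1, h2⟩, h3⟩ a
    rw [h A _ (hρ.cons hg)] at h3
    refine Eq.trans (Finset.sum_congr rfl fun s _ => ?_) (h3 a)
    by_cases hs : (fun l => s (x l)) = a
    · rw [ind_of hs, mul_one]
      have := h1 (Fin.append a s) fun l => by simpa using congrFun hs l
      simp only [Fin.append_right] at this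
      exact this.symm
    · rw [ind_of_not hs, mul_zero]
      exact (h2 (Fin.append a s) fun h => hs (funext fun l => by simpa using h l)).symm
  · intro H
    have hg (t : Fin (k + n) → A) : ρ n X (fun l => t (Fin.natAdd k l)) *
        ind ((fun l => t (Fin.natAdd k (x l))) = fun l => t (Fin.castAdd n l)) ∈
          Set.Icc (0 : ℝ) 1 :=
      ⟨mul_nonneg (hρ _ _ _).1 (ind_nonneg _),
        mul_le_one₀ (hρ _ _ _).2 (ind_nonneg _) (ind_le_one _)⟩
    refine ⟨_, hg, ⟨fun t ht => ?_, fun t ht => ?_⟩, (h A _ (hρ.cons hg)).2 fun a => ?_⟩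
    · refine (congrArg _ (ind_of (funext ht))).trans (mul_one _)
    · refine (congrArg _ (ind_of_not fun h => ht (congrFun h))).trans (mul_zero _)
    · refine Eq.trans (Finset.sum_congr rfl fun s _ => ?_) (H a)
      simp [FEnv.cons]

/-- Addition from sums alone: `g` and `g'` have two additional arguments and agree off their
diagonal, where `g` is `Y` and `g'` is zero. Their sums over the last argument, `X` and `Z`,
therefore differ by `Y`. -/
theorem add (h𝒞 : SumLogic τ 𝒞) {Γ : List ℕ} {n : ℕ} (X Y Z : FVar Γ n) :
    DefIn 𝒞 (fun A _ _ _ (ρ : FEnv Γ A) => ∀ s, ρ n Y s + ρ n Z s = ρ n X s) := by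
  let d : Fin (n + 2) → Fin (n + 1) := ext id (Fin.last n)
  refine ⟨_, h𝒞.exF (h𝒞.exF (Γ := (n + 2) :: Γ) (k := n + 2) (h𝒞.and
    (h𝒞.and (h𝒞.sum (m := n + 1) (.there .here) (.there (.there X)) Fin.castSucc)
      (h𝒞.sum (m := n + 1) .here (.there (.there Z)) Fin.castSucc))
    (h𝒞.and (h𝒞.and
      (h𝒞.guardEq Flat.top (.there .here) d (.there (.there Y)) Fin.castSucc)
      (h𝒞.guardEq (Flat.eq (Fin.last n).castSucc (Fin.last (n + 1))).not (.there .here) id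
        .here id))
      (h𝒞.guardZero Flat.top .here d)))), fun A _ _ _ ρ hρ => ?_⟩
  have hd (s : Fin (n + 1) → A) : (fun l => s (d l)) = ext s (s (Fin.last n)) := comp_ext s _ _
  constructor
  · rintro ⟨g, hg, g', hg', ⟨h1, h2⟩, ⟨h3, h4⟩, h5⟩ s
    let b : A := Classical.arbitrary A
    have e1 : ∑ a, g (ext (ext s b) a) = ρ n X s := by
      have := h1 (ext s b)
      simp only [Fin.snoc_castSucc] at this
      exact this
    have e2 : ∑ a, g' (ext (ext s b) a) = ρ n Z s := by
      have := h2 (ext s b)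
      simp only [Fin.snoc_castSucc] at this
      exact this
    have e3 : g (ext (ext s b) b) = ρ n Y s := by
      have := h3 (ext s b) trivial
      simp only [Fin.snoc_castSucc, hd, Fin.snoc_last] at this
      exact this
    have e5 : g' (ext (ext s b) b) = 0 := by
      have := h5 (ext s b) trivial
      simp only [hd, Fin.snoc_last] at this
      exact this
    rw [← e1, ← e2, ← sum_mul_ind b fun _ => ρ n Y s, ← Finset.sum_add_distrib]
    refine Finset.sum_congr rfl fun a _ => ?_
    by_cases hab : a = b
    · rw [hab, ind_of rfl, e3, e5]; ring
    · have : g (ext (ext s b) a) = g' (ext (ext s b) a) :=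
        h4 (ext (ext s b) a) (by simpa using Ne.symm hab)
      rw [this, ind_of_not hab]; ring
  · intro H
    -- All of `Z` is placed at one off-diagonal point, so every value is a value of `Y`, a value of
    -- `Z`, or zero.
    choose e he using fun a : A => exists_ne a
    let old (t : Fin (n + 2) → A) : Fin n → A := restr (restr t)
    let g' (t : Fin (n + 2) → A) : ℝ :=
      ρ n Z (old t) * ind (t (Fin.last (n + 1)) = e (t (Fin.last n).castSucc))
    let g (t : Fin (n + 2) → A) : ℝ :=
      ρ n Y (old t) * ind (t (Fin.last (n + 1)) = t (Fin.last n).castSucc) + g' t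
    have hg' (t) : g' t ∈ Set.Icc (0 : ℝ) 1 := ⟨mul_nonneg (hρ _ _ _).1 (ind_nonneg _),
        mul_le_one₀ (hρ _ _ _).2 (ind_nonneg _) (ind_le_one _)⟩
    have hg (t) : g t ∈ Set.Icc (0 : ℝ) 1 := by
      by_cases h : t (Fin.last (n + 1)) = t (Fin.last n).castSucc
      · have h' : ¬ t (Fin.last (n + 1)) = e (t (Fin.last n).castSucc) := by
          rw [h]; exact (he _).symm
        simp only [g, g', ind_of h, ind_of_not h', mul_one, mul_zero, add_zero]
        exact hρ _ _ _
      · simp only [g, ind_of_not h, mul_zero, zero_add]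
        exact hg' t
    have s2 (s : Fin (n + 1) → A) : ∑ a, g' (ext s a) = ρ n Z (restr s) := by
      simp only [g', old, Fin.init_snoc, Fin.snoc_last, Fin.snoc_castSucc]
      rw [sum_mul_ind (e (s (Fin.last n))) fun _ => ρ n Z (restr s)]
    have s1 (s : Fin (n + 1) → A) : ∑ a, g (ext s a) = ρ n X (restr s) := by
      simp only [g, Finset.sum_add_distrib, s2, ← H]
      simp only [old, Fin.init_snoc, Fin.snoc_last, Fin.snoc_castSucc]
      rw [sum_mul_ind (s (Fin.last n)) fun _ => ρ n Y (restr s)]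
    refine ⟨g, hg, g', hg', ⟨s1, s2⟩, ⟨fun s _ => ?_, fun t ht => ?_⟩, fun s _ => ?_⟩
    · rw [hd]
      change g (ext s (s (Fin.last n))) = ρ n Y (restr s)
      simp [g, g', old, ind_of, ind_of_not (he _).symm]
    · change g t = g' t
      simp only [g]
      rw [ind_of_not (Ne.symm ht)]
      ring
    · rw [hd]
      change g' (ext s (s (Fin.last n))) = 0
      simp [g', ind_of_not (he _).symm]

/-- Team semantics can be expressed in every logic with the closure properties. -/
theorem exists_wsat (h𝒞 : SumLogic τ 𝒞) {D : Set AtomKind}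
    (hD : AtomKind.dependence ∈ D → ∀ {Γ : List ℕ} {n k : ℕ} (X : FVar Γ n) (x : Fin k → Fin n)
      (y : Fin n), 𝒞 Γ (fun A _ _ _ ρ => ∀ s s' : Fin n → A, ρ n X s = 0 ∨ ρ n X s' = 0 ∨
        ¬ (∀ l, s (x l) = s' (x l)) ∨ s y = s' y))
    {n : ℕ} (φ : TeamForm τ n) (hφ : φ.AtomsIn D) {Γ : List ℕ} (X : FVar Γ n) :
    ∃ P, 𝒞 Γ P ∧ ∀ (A : Type u) [τ.Structure A] [Fintype A] [Nontrivial A] (ρ : FEnv Γ A),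
      Bounded ρ → ∑ s, ρ n X s ≤ 1 → (P A ρ ↔ φ.WSat (ρ n X)) := by
  have lit {n : ℕ} {Γ : List ℕ} (X : FVar Γ n) {E : Event.{u} τ n} (hE : Flat τ n E) :
      ∃ P, 𝒞 Γ P ∧ ∀ (A : Type u) [τ.Structure A] [Fintype A] [Nontrivial A] (ρ : FEnv Γ A),
        Bounded ρ → ∑ s, ρ n X s ≤ 1 → (P A ρ ↔ ∀ s, 0 < ρ n X s → E A s) := by
    refine ⟨_, h𝒞.guardZero hE.not X id, fun A _ _ _ ρ hρ _ => forall_congr' fun s => ?_⟩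
    have h0 := (hρ n X s).1
    constructor
    · intro H hs
      by_contra h
      exact hs.ne' (H h)
    · intro H h
      exact le_antisymm (not_lt.1 fun hs => h (H hs)) h0
  induction φ generalizing Γ with
  | eq x y => exact lit X (.eq x y)
  | neq x y => exact lit X (Flat.eq x y).not
  | rel R x => exact lit X (.rel R x)
  | nrel R x => exact lit X (Flat.rel R x).not
  | @marginalIdentity n k x y =>
    obtain ⟨P, hP, h⟩ := h𝒞.marginal (Γ := k :: Γ) (.there X) .here x
    obtain ⟨Q, hQ, h'⟩ := h𝒞.marginal (Γ := k :: Γ) (.there X) .here y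
    refine ⟨_, h𝒞.exF (h𝒞.and hP hQ), fun A _ _ _ ρ hρ hX => ?_⟩
    rw [wsat_marginalIdentity]
    constructor
    · rintro ⟨M, hM, h1, h2⟩ a
      rw [h A _ (hρ.cons hM)] at h1
      rw [h' A _ (hρ.cons hM)] at h2
      exact (h1 a).trans (h2 a).symm
    · intro H
      -- The bound on the total mass keeps the marginals in the range of the function quantifier.
      have hM (a : Fin k → A) : ∑ s, ρ n X s * ind ((fun l => s (x l)) = a) ∈ Set.Icc (0 : ℝ) 1 :=
        ⟨Finset.sum_nonneg fun s _ => mul_nonneg (hρ _ _ _).1 (ind_nonneg _),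
          (Finset.sum_le_sum fun s _ => mul_le_of_le_one_right (hρ _ _ _).1 (ind_le_one _)).trans hX⟩
      exact ⟨_, hM, (h A _ (hρ.cons hM)).2 fun a => rfl,
        (h' A _ (hρ.cons hM)).2 fun a => (H a).symm⟩
  | @dependence n k x y =>
    refine ⟨_, hD hφ X x y, fun A _ _ _ ρ hρ _ => forall_congr' fun s => forall_congr' fun s' => ?_⟩
    have h0 := (hρ n X s).1
    have h1 := (hρ n X s').1
    rw [h0.lt_iff_ne', h1.lt_iff_ne']
    tauto
  | and φ ψ ihφ ihψ =>
    obtain ⟨P, hP, h⟩ := ihφ hφ.1 X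
    obtain ⟨Q, hQ, h'⟩ := ihψ hφ.2 X
    refine ⟨_, h𝒞.and hP hQ, fun A _ _ _ ρ hρ hX => ?_⟩
    simp only [WSat, h A ρ hρ hX, h' A ρ hρ hX]
  | @or n φ ψ ihφ ihψ =>
    obtain ⟨P, hP, h⟩ := ihφ hφ.1 (Γ := n :: n :: Γ) (.there .here)
    obtain ⟨Q, hQ, h'⟩ := ihψ hφ.2 (Γ := n :: n :: Γ) .here
    obtain ⟨R, hR, hadd⟩ := h𝒞.add (Γ := n :: n :: Γ) (.there (.there X)) (.there .here) .here
    refine ⟨_, h𝒞.exF (h𝒞.exF (h𝒞.and hR (h𝒞.and hP hQ))), fun A _ _ _ ρ hρ hX => ?_⟩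
    constructor
    · rintro ⟨Y, hY, Z, hZ, h1, h2, h3⟩
      have hb := (hρ.cons hY).cons hZ
      have hs : ∀ s, Y s + Z s = ρ n X s := (hadd A _ hb).1 h1
      have sY : ∑ s, Y s ≤ 1 := (Finset.sum_le_sum fun s _ => by
        rw [← hs s]; exact le_add_of_nonneg_right (hZ s).1).trans hX
      have sZ : ∑ s, Z s ≤ 1 := (Finset.sum_le_sum fun s _ => by
        rw [← hs s]; exact le_add_of_nonneg_left (hY s).1).trans hX
      exact ⟨Y, Z, fun s => (hY s).1, fun s => (hZ s).1, hs, (h A _ hb sY).1 h2,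
        (h' A _ hb sZ).1 h3⟩
    · rintro ⟨Y, Z, hY, hZ, hs, h2, h3⟩
      have leY (s) : Y s ≤ ρ n X s := by rw [← hs s]; exact le_add_of_nonneg_right (hZ s)
      have leZ (s) : Z s ≤ ρ n X s := by rw [← hs s]; exact le_add_of_nonneg_left (hY s)
      have hY1 (s) : Y s ∈ Set.Icc (0 : ℝ) 1 := ⟨hY s, (leY s).trans (hρ _ _ _).2⟩
      have hZ1 (s) : Z s ∈ Set.Icc (0 : ℝ) 1 := ⟨hZ s, (leZ s).trans (hρ _ _ _).2⟩
      have hb := (hρ.cons hY1).cons hZ1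
      exact ⟨Y, hY1, Z, hZ1, (hadd A _ hb).2 hs,
        (h A _ hb ((Finset.sum_le_sum fun s _ => leY s).trans hX)).2 h2,
        (h' A _ hb ((Finset.sum_le_sum fun s _ => leZ s).trans hX)).2 h3⟩
  | @ex n φ ih =>
    obtain ⟨P, hP, h⟩ := ih hφ (Γ := (n + 1) :: Γ) .here
    refine ⟨_, h𝒞.exF (h𝒞.and (h𝒞.sum (m := n) .here (.there X) id) hP),
      fun A _ _ _ ρ hρ hX => ?_⟩
    constructor
    · rintro ⟨Y, hY, h1, h2⟩
      have hp : ∀ s, ∑ a, Y (ext s a) = ρ n X s := h1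
      exact ⟨Y, fun t => (hY t).1, hp,
        (h A _ (hρ.cons hY) ((sum_eq_of_proj hp).le.trans hX)).1 h2⟩
    · rintro ⟨Y, hY, hp, h2⟩
      have hY1 (t) : Y t ∈ Set.Icc (0 : ℝ) 1 := by
        refine ⟨hY t, le_trans ?_ (hρ n X (restr t)).2⟩
        have := Finset.single_le_sum (f := fun a => Y (ext (restr t) a)) (fun a _ => hY _)
          (Finset.mem_univ (t (Fin.last n)))
        rw [hp] at this
        simpa using this
      exact ⟨Y, hY1, hp, (h A _ (hρ.cons hY1) ((sum_eq_of_proj hp).le.trans hX)).2 h2⟩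
  | @all n φ ih =>
    obtain ⟨P, hP, h⟩ := ih hφ (Γ := (n + 1) :: Γ) .here
    -- An extension that projects to `X` and is constant in the last argument is the uniform one.
    refine ⟨_, h𝒞.exF (h𝒞.and (h𝒞.and (h𝒞.sum (m := n) .here (.there X) id)
      (h𝒞.guardEq (m := n + 2) Flat.top .here Fin.castSucc .here
        (ext (fun l => l.castSucc.castSucc) (Fin.last (n + 1))))) hP), fun A _ _ _ ρ hρ hX => ?_⟩
    constructor
    · rintro ⟨Y, hY, ⟨h1, h3⟩, h2⟩
      have hp : ∀ s, ∑ a, Y (ext s a) = ρ n X s := h1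
      have hc (s : Fin n → A) (a b : A) : Y (ext s a) = Y (ext s b) := by
        have := h3 (ext (ext s a) b) trivial
        simp only [comp_ext, Fin.snoc_castSucc, Fin.snoc_last] at this
        exact this
      have : Y = unif (ρ n X) := by
        funext t
        have h4 := hp (restr t)
        rw [Finset.sum_congr rfl fun a _ => hc (restr t) a (t (Fin.last n))] at h4
        simp only [Finset.sum_const, Finset.card_univ, nsmul_eq_mul] at h4
        rw [unif, ← h4, mul_div_cancel_left₀ _ (card_pos' A).ne']
        simp
      have := (h A _ (hρ.cons hY) ((sum_eq_of_proj hp).le.trans hX)).1 h2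
      simp only [WSat]
      convert this using 1
      exact ‹Y = _›.symm
    · intro h2
      have hp := unif_proj (ρ n X)
      have hY1 (t) : unif (ρ n X) t ∈ Set.Icc (0 : ℝ) 1 := by
        refine ⟨unif_nonneg (fun s => (hρ n X s).1) t, ?_⟩
        have h1 : (1 : ℝ) < Fintype.card A := by exact_mod_cast Fintype.one_lt_card
        exact div_le_one_of_le₀ ((hρ _ _ _).2.trans h1.le) (by positivity)
      refine ⟨_, hY1, ⟨hp, fun s _ => ?_⟩,
        (h A _ (hρ.cons hY1) ((sum_eq_of_proj hp).le.trans hX)).2 h2⟩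
      change unif (ρ n X) _ = unif (ρ n X) _
      rw [comp_ext, unif_ext]
      rfl

end SumLogic

/-! ### Renaming, universal closure and guarded equations -/

section Rename

/-- Renamings of function symbols. -/
abbrev FRen (Γ Δ : List ℕ) := (k : ℕ) → FVar Γ k → FVar Δ k

/-- The renaming of a vocabulary with one more symbol. -/
def FRen.lift {Γ Δ : List ℕ} (r : FRen Γ Δ) (k : ℕ) : FRen (k :: Γ) (k :: Δ)
  | _, .here => .here
  | _, .there f => .there (r _ f)

/-- The reduct of an interpretation along a renaming. -/
abbrev FEnv.comap {Γ Δ : List ℕ} {A : Type u} (r : FRen Γ Δ) (ρ : FEnv Δ A) : FEnv Γ A :=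
  fun k f => ρ k (r k f)

theorem FEnv.comap_lift {Γ Δ : List ℕ} {A : Type u} (r : FRen Γ Δ) {k : ℕ}
    (h : (Fin k → A) → ℝ) (ρ : FEnv Δ A) :
    FEnv.comap (r.lift k) (FEnv.cons h ρ) = FEnv.cons h (FEnv.comap r ρ) := by
  funext m f
  cases f <;> rfl

theorem NumTerm.exists_rename {Γ Δ : List ℕ} (r : FRen Γ Δ) {n : ℕ} (i : NumTerm Γ n) {m : ℕ}
    (v : Fin n → Fin m) :
    ∃ j : NumTerm Δ m, (∀ O C, i.Over O C → j.Over O C) ∧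
      ∀ (A : Type u) [Fintype A] (ρ : FEnv Δ A) (s : Fin m → A),
        j.eval ρ s = i.eval (FEnv.comap r ρ) (fun l => s (v l)) := by
  induction i generalizing m with
  | const c => exact ⟨.const c, fun _ _ h => h, fun _ _ _ _ => rfl⟩
  | app f x => exact ⟨.app (r _ f) fun l => v (x l), fun _ _ h => h, fun _ _ _ _ => rfl⟩
  | plus i i' ih ih' =>
    obtain ⟨j, hj, h⟩ := ih v
    obtain ⟨j', hj', h'⟩ := ih' v
    exact ⟨.plus j j', fun O C h => ⟨h.1, hj O C h.2.1, hj' O C h.2.2⟩,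
      fun A _ ρ s => by simp only [eval, h, h']⟩
  | times i i' ih ih' =>
    obtain ⟨j, hj, h⟩ := ih v
    obtain ⟨j', hj', h'⟩ := ih' v
    exact ⟨.times j j', fun O C h => ⟨h.1, hj O C h.2.1, hj' O C h.2.2⟩,
      fun A _ ρ s => by simp only [eval, h, h']⟩
  | SUM k i ih =>
    obtain ⟨j, hj, h⟩ := ih (Fin.append (fun l => Fin.castAdd k (v l)) (Fin.natAdd m))
    refine ⟨.SUM k j, fun O C h => ⟨h.1, hj O C h.2⟩, fun A _ ρ s => ?_⟩
    simp only [eval, h]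
    refine Finset.sum_congr rfl fun a _ => ?_
    congr 1
    funext l
    refine Fin.addCases (fun l => ?_) (fun l => ?_) l <;> simp

namespace ESO

variable {τ : FirstOrder.Language.{v, w}}

/-- Almost conjunctive loose formulae with equalities of numerical terms over `O` and `0`, `1`. -/
def IsSimple (O : Set NumOp) {Γ : List ℕ} {n : ℕ} (φ : ESO τ Γ n) : Prop :=
  φ.Over O {NumRel.eq} {0, 1} ∧ φ.Loose ∧ φ.AlmostConjunctive

theorem NumFree.isSimple {O : Set NumOp} {Γ : List ℕ} {n : ℕ} {φ : ESO τ Γ n} (h : φ.NumFree) :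
    φ.IsSimple O := by
  induction φ with
  | num => exact h.elim
  | nnum => exact h.elim
  | and φ ψ ihφ ihψ =>
    have h1 := ihφ h.1
    have h2 := ihψ h.2
    exact ⟨⟨h1.1, h2.1⟩, ⟨h1.2.1, h2.2.1⟩, h1.2.2, h2.2.2⟩
  | or φ ψ ihφ ihψ =>
    have h1 := ihφ h.1
    have h2 := ihψ h.2
    exact ⟨⟨h1.1, h2.1⟩, ⟨h1.2.1, h2.2.1⟩, Or.inl h.1, h1.2.2, h2.2.2⟩
  | ex φ ih => exact ih h
  | all φ ih => exact ih h
  | exF k φ ih => exact ih h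
  | _ => exact ⟨trivial, trivial, trivial⟩

theorem exists_rename {Γ Δ : List ℕ} (r : FRen Γ Δ) {n : ℕ} (φ : ESO τ Γ n) (hφ : φ.QFree) {m : ℕ}
    (v : Fin n → Fin m) :
    ∃ ψ : ESO τ Δ m, ψ.QFree ∧ (φ.NumFree → ψ.NumFree) ∧
      (∀ O, φ.IsSimple O → ψ.IsSimple O) ∧
      ∀ (A : Type u) [τ.Structure A] [Fintype A] (S : Set ℝ) (ρ : FEnv Δ A) (s : Fin m → A),
        ψ.Sat S ρ s ↔ φ.Sat S (FEnv.comap r ρ) (fun l => s (v l)) := by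
  induction φ generalizing m with
  | eq x y => exact ⟨.eq (v x) (v y), trivial, id, fun _ h => h, fun _ _ _ _ _ _ => Iff.rfl⟩
  | neq x y => exact ⟨.neq (v x) (v y), trivial, id, fun _ h => h, fun _ _ _ _ _ _ => Iff.rfl⟩
  | rel R x =>
    exact ⟨.rel R fun l => v (x l), trivial, id, fun _ h => h, fun _ _ _ _ _ _ => Iff.rfl⟩
  | nrel R x =>
    exact ⟨.nrel R fun l => v (x l), trivial, id, fun _ h => h, fun _ _ _ _ _ _ => Iff.rfl⟩
  | num e i j =>
    obtain ⟨i', hi, h⟩ := i.exists_rename.{u} r v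
    obtain ⟨j', hj, h'⟩ := j.exists_rename.{u} r v
    exact ⟨.num e i' j', trivial, id,
      fun O H => ⟨⟨H.1.1, hi _ _ H.1.2.1, hj _ _ H.1.2.2⟩, H.2⟩,
      fun A _ _ S ρ s => by simp only [Sat, h, h']⟩
  | nnum e i j =>
    obtain ⟨i', hi, h⟩ := i.exists_rename.{u} r v
    obtain ⟨j', hj, h'⟩ := j.exists_rename.{u} r v
    exact ⟨.nnum e i' j', trivial, id,
      fun O H => ⟨⟨H.1.1, hi _ _ H.1.2.1, hj _ _ H.1.2.2⟩, H.2⟩,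
      fun A _ _ S ρ s => by simp only [Sat, h, h']⟩
  | and φ ψ ihφ ihψ =>
    obtain ⟨φ', h1, h2, h3, h4⟩ := ihφ r hφ.1 v
    obtain ⟨ψ', g1, g2, g3, g4⟩ := ihψ r hφ.2 v
    refine ⟨.and φ' ψ', ⟨h1, g1⟩, fun H => ⟨h2 H.1, g2 H.2⟩, fun O H => ?_,
      fun A _ _ S ρ s => by simp only [Sat, h4, g4]⟩
    have a := h3 O ⟨H.1.1, H.2.1.1, H.2.2.1⟩
    have b := g3 O ⟨H.1.2, H.2.1.2, H.2.2.2⟩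
    exact ⟨⟨a.1, b.1⟩, ⟨a.2.1, b.2.1⟩, a.2.2, b.2.2⟩
  | or φ ψ ihφ ihψ =>
    obtain ⟨φ', h1, h2, h3, h4⟩ := ihφ r hφ.1 v
    obtain ⟨ψ', g1, g2, g3, g4⟩ := ihψ r hφ.2 v
    refine ⟨.or φ' ψ', ⟨h1, g1⟩, fun H => ⟨h2 H.1, g2 H.2⟩, fun O H => ?_,
      fun A _ _ S ρ s => by simp only [Sat, h4, g4]⟩
    have a := h3 O ⟨H.1.1, H.2.1.1, H.2.2.2.1⟩
    have b := g3 O ⟨H.1.2, H.2.1.2, H.2.2.2.2⟩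
    exact ⟨⟨a.1, b.1⟩, ⟨a.2.1, b.2.1⟩, H.2.2.1.imp h2 g2, a.2.2, b.2.2⟩
  | ex φ ih => exact hφ.elim
  | all φ ih => exact hφ.elim
  | exF k φ ih => exact hφ.elim

/-- Universal quantification of all first-order variables. -/
def alls {Γ : List ℕ} : (m : ℕ) → ESO τ Γ m → ESO τ Γ 0
  | 0, φ => φ
  | m + 1, φ => alls m φ.all

theorem sat_alls {A : Type u} [τ.Structure A] [Fintype A] {S : Set ℝ} {Γ : List ℕ} {m : ℕ}
    (φ : ESO τ Γ m) (ρ : FEnv Γ A) :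
    (alls m φ).Sat S ρ Fin.elim0 ↔ ∀ s, φ.Sat S ρ s := by
  induction m with
  | zero =>
    refine ⟨fun h s => ?_, fun h => h _⟩
    rw [Subsingleton.elim s Fin.elim0]
    exact h
  | succ m ih =>
    rw [forall_ext]
    exact ih φ.all

theorem isSimple_alls {O : Set NumOp} {Γ : List ℕ} {m : ℕ} {φ : ESO τ Γ m} (h : φ.IsSimple O) :
    (alls m φ).IsSimple O := by
  induction m with
  | zero => exact h
  | succ m ih => exact ih (φ := φ.all) h

theorem prefixAll_alls {Γ : List ℕ} {m : ℕ} {φ : ESO τ Γ m} (h : φ.PrefixAll) :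
    (alls m φ).PrefixAll := by
  induction m with
  | zero => exact h
  | succ m ih => exact ih (.all h)

/-- The implication is a disjunction whose left side has no numerical terms, so it is almost
conjunctive. -/
theorem exists_guard {m : ℕ} {E : Event.{u} τ m} (hE : Flat τ m E) {Γ : List ℕ} (O : Set NumOp)
    (S : Set ℝ) (i j : NumTerm Γ (m + 1)) (hi : i.Over O {0, 1}) (hj : j.Over O {0, 1}) :
    ∃ θ : ESO τ Γ (m + 1), θ.QFree ∧ θ.IsSimple O ∧
      ∀ (A : Type u) [τ.Structure A] [Fintype A] [Nontrivial A] (ρ : FEnv Γ A) (s : Fin (m + 1) → A),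
        θ.Sat S ρ s ↔ (E A (restr s) → i.eval ρ s = j.eval ρ s) := by
  obtain ⟨-, θ, hN, hQ, h⟩ := hE.exists_eso Γ S
  obtain ⟨h1, h2, h3⟩ := hN.isSimple (O := O)
  refine ⟨.or θ (.num .eq i j), ⟨hQ, trivial⟩, ⟨⟨h1, rfl, hi, hj⟩, ⟨h2, trivial⟩, Or.inl hN, h3,
    trivial⟩, fun A _ _ _ ρ s => ?_⟩
  simp only [Sat, h, NumRel.Holds]
  tauto

end ESO

end Rename

/-! ### Prefix formulae with sums -/

/-- The properties defined by almost conjunctive loose formulae with prefix `∃̈*∀*`. -/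
inductive PrefixDef (τ : FirstOrder.Language.{v, w}) (O : Set NumOp) :
    (Γ : List ℕ) → EnvProp.{u} τ Γ → Prop
  | base {Γ : List ℕ} {m : ℕ} (θ : ESO τ Γ m) (hQ : θ.QFree) (hθ : θ.IsSimple O) :
      PrefixDef τ O Γ (fun _ _ _ _ ρ => ∀ s, θ.Sat (Set.Icc (0 : ℝ) 1) ρ s)
  | exF {Γ : List ℕ} {k : ℕ} {P : EnvProp.{u} τ (k :: Γ)} (hP : PrefixDef τ O (k :: Γ) P) :
      PrefixDef τ O Γ (fun A _ _ _ ρ =>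
        ∃ h : (Fin k → A) → ℝ, (∀ a, h a ∈ Set.Icc (0 : ℝ) 1) ∧ P A (FEnv.cons h ρ))

namespace PrefixDef

variable {τ : FirstOrder.Language.{v, w}} {O : Set NumOp} {Γ Δ : List ℕ} {P Q : EnvProp.{u} τ Γ}

theorem congr (hP : PrefixDef τ O Γ P)
    (h : ∀ (A : Type u) [τ.Structure A] [Fintype A] [Nontrivial A] (ρ : FEnv Γ A),
      P A ρ ↔ Q A ρ) : PrefixDef τ O Γ Q := by
  have : P = Q := by
    funext A _ _ _ ρ
    exact propext (h A ρ)
  exact this ▸ hP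

theorem comap (hP : PrefixDef τ O Γ P) (r : FRen Γ Δ) :
    PrefixDef τ O Δ (fun A _ _ _ ρ => P A (FEnv.comap r ρ)) := by
  induction hP generalizing Δ with
  | base θ hQ hθ =>
    obtain ⟨ψ, h1, -, h3, h4⟩ := θ.exists_rename.{u} r hQ id
    exact (base ψ h1 (h3 O hθ)).congr fun A _ _ _ ρ => by simp only [h4]; rfl
  | exF _ ih =>
    refine (ih (r.lift _)).exF.congr fun A _ _ _ ρ => ?_
    simp only [FEnv.comap_lift]

/-- Prenexing: function quantifiers are pulled out after weakening the other conjunct, then the two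
universal blocks are placed side by side. -/
theorem and (hP : PrefixDef τ O Γ P) (hQ : PrefixDef τ O Γ Q) :
    PrefixDef τ O Γ (fun A _ _ _ ρ => P A ρ ∧ Q A ρ) := by
  induction hP with
  | @base Γ m θ hQ1 hθ =>
    induction hQ with
    | @base Γ m' θ' hQ1' hθ' =>
      obtain ⟨ψ, h1, -, h3, h4⟩ := θ.exists_rename.{u} (fun _ f => f) hQ1 (Fin.castAdd m')
      obtain ⟨ψ', h1', -, h3', h4'⟩ := θ'.exists_rename.{u} (fun _ f => f) hQ1' (Fin.natAdd m)
      obtain ⟨a1, a2, a3⟩ := h3 O hθ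
      obtain ⟨b1, b2, b3⟩ := h3' O hθ'
      refine (base (.and ψ ψ') ⟨h1, h1'⟩ ⟨⟨a1, b1⟩, ⟨a2, b2⟩, a3, b3⟩).congr
        fun A _ _ _ ρ => ?_
      simp only [ESO.Sat, h4, h4']
      refine ⟨fun H => ⟨fun s => ?_, fun s => ?_⟩, fun H s => ⟨H.1 _, H.2 _⟩⟩
      · simpa using (H (Fin.append s fun _ => Classical.arbitrary A)).1
      · simpa using (H (Fin.append (fun _ => Classical.arbitrary A) s)).2
    | exF _ ih =>
      obtain ⟨ψ, h1, -, h3, h4⟩ := θ.exists_rename.{u} (fun _ f => .there f) hQ1 id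
      refine (ih ψ h1 (h3 O hθ)).exF.congr fun A _ _ _ ρ => ?_
      simp only [h4]
      exact ⟨fun ⟨h, hh, H1, H2⟩ => ⟨H1, h, hh, H2⟩, fun ⟨H1, h, hh, H2⟩ => ⟨h, hh, H1, H2⟩⟩
  | exF _ ih =>
    refine (ih (hQ.comap fun _ f => .there f)).exF.congr fun A _ _ _ ρ => ?_
    exact ⟨fun ⟨h, hh, H1, H2⟩ => ⟨⟨h, hh, H1⟩, H2⟩, fun ⟨⟨h, hh, H1⟩, H2⟩ => ⟨h, hh, H1, H2⟩⟩

theorem exists_eso (hP : PrefixDef τ O Γ P) :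
    ∃ ψ : ESO τ Γ 0, ψ.IsSimple O ∧ ψ.PrefixExFAll ∧
      ∀ (A : Type u) [τ.Structure A] [Fintype A] [Nontrivial A] (ρ : FEnv Γ A),
        ψ.Sat (Set.Icc (0 : ℝ) 1) ρ Fin.elim0 ↔ P A ρ := by
  induction hP with
  | base θ hQ hθ =>
    exact ⟨.alls _ θ, ESO.isSimple_alls hθ, .base (ESO.prefixAll_alls (.qfree hQ)),
      fun A _ _ _ ρ => ESO.sat_alls θ ρ⟩
  | exF _ ih =>
    obtain ⟨ψ, h1, h2, h3⟩ := ih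
    exact ⟨.exF _ ψ, h1, .exF h2, fun A _ _ _ ρ => by simp only [ESO.Sat, h3]⟩

theorem sumLogic : SumLogic.{u} τ (PrefixDef τ {NumOp.SUM}) where
  and := and
  exF := exF
  guardEq hE f x g y := by
    obtain ⟨θ, h1, h2, h3⟩ := ESO.exists_guard hE {NumOp.SUM} (Set.Icc 0 1)
      (.app f fun l => (x l).castSucc) (.app g fun l => (y l).castSucc) trivial trivial
    refine (base θ h1 h2).congr fun A _ _ _ ρ => ?_
    simp only [h3, forall_ext]
    simp [NumTerm.eval]
  guardZero hE f x := by
    obtain ⟨θ, h1, h2, h3⟩ := ESO.exists_guard hE {NumOp.SUM} (Set.Icc 0 1)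
      (.app f fun l => (x l).castSucc) (.const 0) trivial (Or.inl rfl)
    refine (base θ h1 h2).congr fun A _ _ _ ρ => ?_
    simp only [h3, forall_ext]
    simp [NumTerm.eval]
  sum {Γ m k} g f y := by
    refine (base (τ := τ) (O := {NumOp.SUM}) (Γ := Γ) (m := m) (.num .eq (.SUM 1 (.app g id)) (.app f y)) trivial
      ⟨⟨rfl, ⟨rfl, trivial⟩, trivial⟩, trivial, trivial⟩).congr fun A _ _ _ ρ => ?_
    refine forall_congr' fun s => ?_
    simp only [ESO.Sat, NumRel.Holds, NumTerm.eval]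
    rw [← (Equiv.funUnique (Fin 1) A).symm.sum_comp]
    refine Eq.congr (Finset.sum_congr rfl fun a _ => congrArg _ ?_) rfl
    funext l
    simp only [id]
    rw [Fin.append_right_eq_snoc]
    rfl

end PrefixDef

/-! ### Loose formulae with addition -/

/-- Partial sums along a strict linear order are determined by their recursion. -/
theorem eq_partialSum {A : Type u} [Fintype A] {lt : A → A → Prop} (hirr : ∀ a, ¬ lt a a)
    (htr : ∀ a b c, lt a b → lt b c → lt a c) {G h : A → ℝ}
    (hrec : ∀ y, (∃ z, lt z y ∧ (∀ w, ¬ lt w y ∨ w = z ∨ lt w z) ∧ h y = h z + G y) ∨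
      ((∀ w, ¬ lt w y) ∧ h y = G y)) (y : A) :
    h y = ∑ w, G w * ind (w = y ∨ lt w y) := by
  have : IsTrans A lt := ⟨htr⟩
  have : Std.Irrefl lt := ⟨hirr⟩
  induction y using (Finite.wellFounded_of_trans_of_irrefl lt).induction with
  | _ y ih =>
    rcases hrec y with ⟨z, hzy, hz, hy⟩ | ⟨hmin, hy⟩
    · rw [hy, ih z hzy, ← sum_mul_ind y G, ← Finset.sum_add_distrib]
      refine Finset.sum_congr rfl fun w _ => ?_
      by_cases hw : w = y
      · subst hw
        have : ¬ (w = z ∨ lt w z) := by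
          rintro (rfl | h)
          · exact hirr _ hzy
          · exact hirr _ (htr _ _ _ h hzy)
        rw [ind_of_not this, ind_of rfl, ind_of (Or.inl rfl)]
        ring
      · rw [ind_of_not hw]
        have : (w = y ∨ lt w y) ↔ (w = z ∨ lt w z) := by
          constructor
          · rintro (h | h)
            · exact (hw h).elim
            · exact (hz w).resolve_left (not_not.2 h)
          · rintro (rfl | h)
            · exact Or.inr hzy
            · exact Or.inr (htr _ _ _ h hzy)
        rw [this]
        ring
    · rw [hy, ← sum_mul_ind y G]
      refine Finset.sum_congr rfl fun w _ => ?_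
      have : (w = y ∨ lt w y) ↔ w = y := by simp [hmin w]
      rw [this]

theorem exists_maximal_of_strictOrder {A : Type u} [Finite A] [Nonempty A] {lt : A → A → Prop}
    (hirr : ∀ a, ¬ lt a a) (htr : ∀ a b c, lt a b → lt b c → lt a c) : ∃ y, ∀ w, ¬ lt y w := by
  have : IsTrans A (fun a b => lt b a) := ⟨fun a b c h1 h2 => htr _ _ _ h2 h1⟩
  have : Std.Irrefl (fun a b => lt b a) := ⟨hirr⟩
  obtain ⟨y, -, hy⟩ := (Finite.wellFounded_of_trans_of_irrefl (fun a b => lt b a)).has_min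
    Set.univ Set.univ_nonempty
  exact ⟨y, fun w => hy w trivial⟩

/-- The properties defined on bounded interpretations by loose formulae with addition. -/
def LooseDef (τ : FirstOrder.Language.{v, w}) {Γ : List ℕ} {n : ℕ} (P : Property.{u} τ Γ n) : Prop :=
  ∃ ψ : ESO τ Γ n, ψ.Over {NumOp.plus} {NumRel.eq} {0, 1} ∧ ψ.Loose ∧
    ∀ (A : Type u) [τ.Structure A] [Fintype A] [Nontrivial A] (ρ : FEnv Γ A) (s : Fin n → A),
      Bounded ρ → (ψ.Sat (Set.Icc (0 : ℝ) 1) ρ s ↔ P A ρ s)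

namespace LooseDef

variable {τ : FirstOrder.Language.{v, w}} {Γ : List ℕ} {n : ℕ} {P Q : Property.{u} τ Γ n}

theorem congr (hP : LooseDef τ P)
    (h : ∀ (A : Type u) [τ.Structure A] [Fintype A] [Nontrivial A] (ρ : FEnv Γ A) (s : Fin n → A),
      Bounded ρ → (P A ρ s ↔ Q A ρ s)) : LooseDef τ Q := by
  obtain ⟨ψ, h1, h2, h3⟩ := hP
  exact ⟨ψ, h1, h2, fun A _ _ _ ρ s hρ => (h3 A ρ s hρ).trans (h A ρ s hρ)⟩

theorem and (hP : LooseDef τ P) (hQ : LooseDef τ Q) :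
    LooseDef τ (fun A _ _ _ ρ s => P A ρ s ∧ Q A ρ s) := by
  obtain ⟨ψ, h1, h2, h3⟩ := hP
  obtain ⟨θ, g1, g2, g3⟩ := hQ
  exact ⟨.and ψ θ, ⟨h1, g1⟩, ⟨h2, g2⟩, fun A _ _ _ ρ s hρ => by
    simp only [ESO.Sat, h3 A ρ s hρ, g3 A ρ s hρ]⟩

theorem or (hP : LooseDef τ P) (hQ : LooseDef τ Q) :
    LooseDef τ (fun A _ _ _ ρ s => P A ρ s ∨ Q A ρ s) := by
  obtain ⟨ψ, h1, h2, h3⟩ := hP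
  obtain ⟨θ, g1, g2, g3⟩ := hQ
  exact ⟨.or ψ θ, ⟨h1, g1⟩, ⟨h2, g2⟩, fun A _ _ _ ρ s hρ => by
    simp only [ESO.Sat, h3 A ρ s hρ, g3 A ρ s hρ]⟩

theorem ex {P : Property.{u} τ Γ (n + 1)} (hP : LooseDef τ P) :
    LooseDef τ (fun A _ _ _ ρ s => ∃ a, P A ρ (ext s a)) := by
  obtain ⟨ψ, h1, h2, h3⟩ := hP
  exact ⟨.ex ψ, h1, h2, fun A _ _ _ ρ s hρ => exists_congr fun a => h3 A ρ _ hρ⟩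

theorem all {P : Property.{u} τ Γ (n + 1)} (hP : LooseDef τ P) :
    LooseDef τ (fun A _ _ _ ρ s => ∀ a, P A ρ (ext s a)) := by
  obtain ⟨ψ, h1, h2, h3⟩ := hP
  exact ⟨.all ψ, h1, h2, fun A _ _ _ ρ s hρ => forall_congr' fun a => h3 A ρ _ hρ⟩

theorem exF {k : ℕ} {P : Property.{u} τ (k :: Γ) n} (hP : LooseDef τ P) :
    LooseDef τ (fun A _ _ _ ρ s =>
      ∃ h : (Fin k → A) → ℝ, (∀ a, h a ∈ Set.Icc (0 : ℝ) 1) ∧ P A (FEnv.cons h ρ) s) := by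
  obtain ⟨ψ, h1, h2, h3⟩ := hP
  exact ⟨.exF k ψ, h1, h2, fun A _ _ _ ρ s hρ => exists_congr fun h =>
    and_congr_right fun hh => h3 A _ s (hρ.cons hh)⟩

theorem num {i j : NumTerm Γ n} (hi : i.Over {NumOp.plus} {0, 1})
    (hj : j.Over {NumOp.plus} {0, 1}) :
    LooseDef τ (fun _ _ _ _ ρ s => i.eval ρ s = j.eval ρ s) :=
  ⟨.num .eq i j, ⟨rfl, hi, hj⟩, trivial, fun _ _ _ _ _ _ _ => Iff.rfl⟩

theorem flat {E : Event.{u} τ n} (hE : Flat τ n E) :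
    LooseDef τ (Γ := Γ) (fun A _ _ _ _ s => E A s) := by
  obtain ⟨⟨θ, hN, -, h⟩, -⟩ := hE.exists_eso Γ (Set.Icc 0 1)
  obtain ⟨h1, h2, -⟩ := hN.isSimple (O := {NumOp.plus})
  -- The spare variable is closed by a vacuous quantifier.
  exact ⟨.all θ, h1, h2, fun A _ _ _ ρ s _ => by simp [ESO.Sat, h]⟩

theorem alls {m : ℕ} {P : Property.{u} τ Γ m} (hP : LooseDef τ P) :
    LooseDef τ (n := 0) (fun A _ _ _ ρ _ => ∀ s, P A ρ s) := by
  induction m with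
  | zero => exact hP.congr fun A _ _ _ ρ s _ =>
      ⟨fun h t => Subsingleton.elim s t ▸ h, fun h => h s⟩
  | succ m ih => exact (ih hP.all).congr fun A _ _ _ ρ s _ => forall_ext.symm

/-- The sum over the last argument can be expressed by partial sums along a linear order. -/
theorem sum {m k : ℕ} (g : FVar Γ (m + 1)) (f : FVar Γ k) (y : Fin k → Fin m) :
    LooseDef.{u} τ (n := 0) (fun A _ _ _ (ρ : FEnv Γ A) _ => ∀ s : Fin m → A,
      ∑ a, ρ (m + 1) g (ext s a) = ρ k f (fun i => s (y i))) := by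
  -- The order is guessed as a binary function with values `0` and `1`. The negation of `a < b`
  -- becomes the positive atom with value `0`, as looseness requires.
  let L {N : ℕ} {Δ : List ℕ} (ℓ : FVar Δ 2) (a b : Fin N) (c : ℝ) : Property.{u} τ Δ N :=
    fun A _ _ _ ρ s => ρ 2 ℓ ![s a, s b] = c
  have hL {N : ℕ} {Δ : List ℕ} (ℓ : FVar Δ 2) (a b : Fin N) (c : ℝ) (hc : c ∈ ({0, 1} : Set ℝ)) :
      LooseDef τ (L ℓ a b c) := by
    refine (num (i := .app ℓ ![a, b]) (j := .const c) trivial hc).congr fun A _ _ _ ρ s _ => ?_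
    have : (fun l => s (![a, b] l)) = ![s a, s b] := by
      funext l
      fin_cases l <;> rfl
    simp only [NumTerm.eval, this, L]
  have one_mem : (1 : ℝ) ∈ ({0, 1} : Set ℝ) := Or.inr rfl
  have zero_mem : (0 : ℝ) ∈ ({0, 1} : Set ℝ) := Or.inl rfl
  have hbit : LooseDef τ (n := 0) (fun A _ _ _ (ρ : FEnv (2 :: Γ) A) _ =>
      ∀ s : Fin 2 → A, ρ 2 .here ![s 0, s 1] = 0 ∨ ρ 2 .here ![s 0, s 1] = 1) :=
    ((hL .here 0 1 0 zero_mem).or (hL .here 0 1 1 one_mem)).alls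
  have hirr : LooseDef τ (n := 0) (fun A _ _ _ (ρ : FEnv (2 :: Γ) A) _ =>
      ∀ s : Fin 1 → A, ρ 2 .here ![s 0, s 0] = 0) :=
    (hL .here 0 0 0 zero_mem).alls
  have htr : LooseDef τ (n := 0) (fun A _ _ _ (ρ : FEnv (2 :: Γ) A) _ =>
      ∀ s : Fin 3 → A, ρ 2 .here ![s 0, s 1] = 0 ∨ ρ 2 .here ![s 1, s 2] = 0 ∨
        ρ 2 .here ![s 0, s 2] = 1) :=
    ((hL .here 0 1 0 zero_mem).or ((hL .here 1 2 0 zero_mem).or (hL .here 0 2 1 one_mem))).alls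
  have htot : LooseDef τ (n := 0) (fun A _ _ _ (ρ : FEnv (2 :: Γ) A) _ =>
      ∀ s : Fin 2 → A, s 0 = s 1 ∨ ρ 2 .here ![s 0, s 1] = 1 ∨ ρ 2 .here ![s 1, s 0] = 1) :=
    ((flat (Flat.eq 0 1)).or ((hL .here 0 1 1 one_mem).or (hL .here 1 0 1 one_mem))).alls
  let ℓ : FVar ((m + 1) :: 2 :: Γ) 2 := .there .here
  let H : FVar ((m + 1) :: 2 :: Γ) (m + 1) := .here
  let G : FVar ((m + 1) :: 2 :: Γ) (m + 1) := .there (.there g)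
  let F : FVar ((m + 1) :: 2 :: Γ) k := .there (.there f)
  let a2 : Fin (m + 2) := (Fin.last m).castSucc
  let b2 : Fin (m + 2) := Fin.last (m + 1)
  let a3 : Fin (m + 3) := (Fin.last m).castSucc.castSucc
  let b3 : Fin (m + 3) := (Fin.last (m + 1)).castSucc
  let c3 : Fin (m + 3) := Fin.last (m + 2)
  -- Recursion for the partial sums: add the current summand to the value at the immediate
  -- predecessor, or start with it at the least element.
  have hstep := ((hL ℓ b2 a2 1 one_mem).and
    (((hL ℓ c3 a3 0 zero_mem).or ((flat (Flat.eq c3 b3)).or (hL ℓ c3 b3 1 one_mem))).all.and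
    (num (τ := τ) (Γ := (m + 1) :: 2 :: Γ) (n := m + 2) (i := .app H Fin.castSucc)
      (j := .plus (.app H (ext (fun l => l.castSucc.castSucc) b2)) (.app G Fin.castSucc))
      trivial ⟨rfl, trivial, trivial⟩))).ex.or ((hL ℓ b2 a2 0 zero_mem).all.and
    (num (τ := τ) (Γ := (m + 1) :: 2 :: Γ) (n := m + 1) (i := .app H id) (j := .app G id)
      trivial trivial))
  -- At an element without a larger one, the partial sum is the required total.
  have hfin := (hL ℓ a2 b2 1 one_mem).ex.or (num (τ := τ) (Γ := (m + 1) :: 2 :: Γ) (n := m + 1)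
    (i := .app H id) (j := .app F fun l => (y l).castSucc) trivial trivial)
  refine ((((hbit.and hirr).and htr).and htot).and (hstep.and hfin).alls.exF).exF.congr
    fun A _ _ _ ρ _ hρ => ?_
  have comp3 (s : Fin m → A) (a b : A) : (fun l => ext (ext s a) b
      (ext (fun l : Fin m => l.castSucc.castSucc) (Fin.last (m + 1)) l)) = ext s b := by
    rw [comp_ext]
    simp
  have fcons {k l : ℕ} (f : FVar Γ k) (h : (Fin l → A) → ℝ) (L : (Fin 2 → A) → ℝ) :
      FEnv.cons h (FEnv.cons L ρ) k (.there (.there f)) = ρ k f := rfl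
  have ℓcons (h : (Fin (m + 1) → A) → ℝ) (L : (Fin 2 → A) → ℝ) :
      FEnv.cons h (FEnv.cons L ρ) 2 (.there .here) = L := rfl
  have Hcons (h : (Fin (m + 1) → A) → ℝ) (L : (Fin 2 → A) → ℝ) :
      FEnv.cons h (FEnv.cons L ρ) (m + 1) .here = h := rfl
  constructor
  · rintro ⟨L', -, ⟨⟨⟨hb, hi⟩, ht⟩, htot⟩, h, -, hrec⟩ s
    have hb (a b) : L' ![a, b] = 0 ∨ L' ![a, b] = 1 := hb ![a, b]
    have hi (a) : L' ![a, a] = 0 := hi ![a]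
    have ht (a b c) : L' ![a, b] = 0 ∨ L' ![b, c] = 0 ∨ L' ![a, c] = 1 := ht ![a, b, c]
    have htot (a b) : a = b ∨ L' ![a, b] = 1 ∨ L' ![b, a] = 1 := htot ![a, b]
    have hne (a b) : ¬ L' ![a, b] = 1 ↔ L' ![a, b] = 0 := by
      rcases hb a b with h | h <;> simp [h]
    have hirr (a) : ¬ L' ![a, a] = 1 := (hne a a).2 (hi a)
    have htr (a b c) (h1 : L' ![a, b] = 1) (h2 : L' ![b, c] = 1) : L' ![a, c] = 1 := by
      have := ht a b c
      simpa [h1, h2] using this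
    have hrec (a) := hrec (ext s a)
    simp only [L, H, G, F, a2, b2, a3, b3, c3, ℓ, NumTerm.eval, Fin.snoc_castSucc, Fin.snoc_last,
      comp3, id, fcons, ℓcons, Hcons] at hrec
    obtain ⟨y', hy'⟩ := exists_maximal_of_strictOrder (lt := fun a b => L' ![a, b] = 1) hirr htr
    have hsum := eq_partialSum (lt := fun a b => L' ![a, b] = 1) hirr htr
      (G := fun a => ρ (m + 1) g (ext s a)) (h := fun a => h (ext s a))
      (fun a => by simpa only [hne] using (hrec a).1) y'
    have hlast := (hrec y').2.resolve_left fun ⟨w, hw⟩ => hy' w hw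
    refine Eq.trans ?_ (hsum.symm.trans hlast)
    refine Finset.sum_congr rfl fun w _ => ?_
    rw [ind_of (by have := htot w y'; have := hy' w; tauto), mul_one]
  · intro hsum
    -- An enumeration of the universe supplies the order.
    let e := Fintype.equivFin A
    have g0 (s) (a : A) : 0 ≤ ρ (m + 1) g (ext s a) := (hρ _ _ _).1
    let h (t : Fin (m + 1) → A) : ℝ :=
      ∑ w, ρ (m + 1) g (ext (restr t) w) * ind (w = t (Fin.last m) ∨ e w < e (t (Fin.last m)))
    have hext (s) (a : A) : h (ext s a) = ∑ w, ρ (m + 1) g (ext s w) * ind (w = a ∨ e w < e a) := by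
      simp [h]
    have lt_or (p q : Prop) (h : ¬ (p ∧ q)) : ind (p ∨ q) = ind q + ind p := by
      by_cases hp : p <;> by_cases hq : q <;> simp_all [ind]
    have lt_iff (a b : A) : ind (e a < e b) = 0 ↔ ¬ e a < e b := by
      by_cases h : e a < e b <;> simp [ind, h]
    have lt_iff' (a b : A) : ind (e a < e b) = 1 ↔ e a < e b := by
      by_cases h : e a < e b <;> simp [ind, h]
    refine ⟨fun p => ind (e (p 0) < e (p 1)), fun p => ⟨ind_nonneg _, ind_le_one _⟩,
      ⟨⟨⟨fun p => ?_, fun p => ind_of_not (lt_irrefl _)⟩, fun p => ?_⟩, fun p => ?_⟩,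
      h, fun t => ⟨?_, ?_⟩, forall_ext.2 fun s a => ?_⟩
    · change ind (e (p 0) < e (p 1)) = 0 ∨ ind (e (p 0) < e (p 1)) = 1
      rw [lt_iff, lt_iff']
      exact (em _).symm
    · change ind (e (p 0) < e (p 1)) = 0 ∨ ind (e (p 1) < e (p 2)) = 0 ∨
        ind (e (p 0) < e (p 2)) = 1
      rw [lt_iff, lt_iff, lt_iff']
      by_contra! H
      exact absurd (H.1.trans H.2.1) (not_lt.2 H.2.2)
    · change p 0 = p 1 ∨ ind (e (p 0) < e (p 1)) = 1 ∨ ind (e (p 1) < e (p 0)) = 1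
      rw [lt_iff', lt_iff', ← e.injective.eq_iff]
      rcases lt_trichotomy (e (p 0)) (e (p 1)) with H | H | H <;> simp [H]
    · exact Finset.sum_nonneg fun w _ => mul_nonneg (g0 _ _) (ind_nonneg _)
    -- Partial sums of nonnegative numbers are at most the total, which is a value of `f`.
    · refine le_trans (Finset.sum_le_sum fun w _ =>
        mul_le_of_le_one_right (g0 _ _) (ind_le_one _)) ?_
      rw [hsum]
      exact (hρ _ _ _).2
    · simp only [L, H, G, F, a2, b2, a3, b3, c3, ℓ, NumTerm.eval, Fin.snoc_castSucc,
        Fin.snoc_last, comp3, id, fcons, ℓcons, Hcons, Matrix.cons_val_zero, Matrix.cons_val_one,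
        lt_iff, lt_iff']
      change ((∃ z, e z < e a ∧ (∀ w, ¬ e w < e a ∨ w = z ∨ e w < e z) ∧
        h (ext s a) = h (ext s z) + ρ (m + 1) g (ext s a)) ∨
        (∀ w, ¬ e w < e a) ∧ h (ext s a) = ρ (m + 1) g (ext s a)) ∧
        ((∃ w, e a < e w) ∨ h (ext s a) = ρ k f fun l => s (y l))
      have hsplit : h (ext s a) =
          ∑ w, ρ (m + 1) g (ext s w) * ind (e w < e a) + ρ (m + 1) g (ext s a) := by
        rw [hext, ← sum_mul_ind a fun w => ρ (m + 1) g (ext s w), ← Finset.sum_add_distrib]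
        refine Finset.sum_congr rfl fun w _ => ?_
        rw [lt_or _ _ (by rintro ⟨rfl, h⟩; exact lt_irrefl _ h), mul_add]
      constructor
      · by_cases hmin : ∀ w, ¬ e w < e a
        · refine Or.inr ⟨hmin, ?_⟩
          simp [hsplit, ind, hmin]
        · refine Or.inl ?_
          obtain ⟨w₀, hw₀⟩ := not_forall_not.1 hmin
          have hpos : 0 < (e a : ℕ) := (Nat.zero_le _).trans_lt hw₀
          let z : A := e.symm ⟨e a - 1, (Nat.sub_le _ _).trans_lt (e a).2⟩
          have hz : (e z : ℕ) = e a - 1 := by simp [z]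
          have hiff (w : A) : e w < e a ↔ w = z ∨ e w < e z := by
            rw [← e.injective.eq_iff, Fin.ext_iff, Fin.lt_def, Fin.lt_def]
            omega
          refine ⟨z, (hiff z).2 (Or.inl rfl), fun w => ?_, ?_⟩
          · rw [← hiff]
            exact (em _).symm
          · rw [hsplit, hext]
            simp only [hiff]
      · by_cases hmax : ∃ w, e a < e w
        · exact Or.inl hmax
        · refine Or.inr (Eq.trans ?_ (hsum s))
          rw [hext]
          refine Finset.sum_congr rfl fun w _ => ?_
          rw [ind_of, mul_one]
          rw [← e.injective.eq_iff]
          exact eq_or_lt_of_le (not_lt.1 (not_exists.1 hmax w))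

theorem sumLogic : SumLogic.{u} τ (fun Γ P => LooseDef τ (n := 0) (fun A _ _ _ (ρ : FEnv Γ A) _ => P A ρ)) where
  and := and
  exF := exF
  guardEq {Γ m k l E} hE f x g y := by
    refine ((flat hE.not).or (num (i := .app f x) (j := .app g y) trivial trivial)).alls.congr
      fun A _ _ _ ρ _ _ => forall_congr' fun s => ?_
    simp only [NumTerm.eval]
    tauto
  guardZero {Γ m k E} hE f x := by
    refine ((flat hE.not).or (num (i := .app f x) (j := .const 0) trivial (Or.inl rfl))).alls.congr
      fun A _ _ _ ρ _ _ => forall_congr' fun s => ?_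
    simp only [NumTerm.eval]
    tauto
  sum := sum

/-- Two disjuncts are numerical, so this formula is loose but not almost conjunctive. -/
theorem dependence {n k : ℕ} (X : FVar Γ n) (x : Fin k → Fin n) (y : Fin n) :
    LooseDef.{u} τ (n := 0) (fun A _ _ _ (ρ : FEnv Γ A) _ => ∀ s s' : Fin n → A,
      ρ n X s = 0 ∨ ρ n X s' = 0 ∨ ¬ (∀ l, s (x l) = s' (x l)) ∨ s y = s' y) := by
  have z (v : Fin n → Fin (n + n)) : LooseDef.{u} τ _ :=
    num (τ := τ) (Γ := Γ) (i := .app X v) (j := .const 0) trivial (Or.inl rfl)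
  refine ((z (Fin.castAdd n)).or ((z (Fin.natAdd n)).or ((flat (Flat.tupleEq
    (fun l => Fin.castAdd n (x l)) (fun l => Fin.natAdd n (x l))).not).or
      (flat (Flat.eq (Fin.castAdd n y) (Fin.natAdd n y)))))).alls.congr fun A _ _ _ ρ _ _ => ?_
  refine ⟨fun H s s' => ?_, fun H t => H _ _⟩
  have := H (Fin.append s s')
  simp only [NumTerm.eval, Fin.append_left, Fin.append_right] at this
  exact this

end LooseDef

/-! ### The two equivalences -/

theorem DStruc.bounded {τ : FirstOrder.Language.{v, w}} {n : ℕ} (M : DStruc.{u} τ n) :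
    Bounded (FEnv.cons M.f FEnv.nil) := by
  have hnil : Bounded (FEnv.nil : FEnv [] M.A) := fun _ f => nomatch f
  refine hnil.cons fun a => ⟨M.dist.1 a, ?_⟩
  rw [← M.dist.2]
  exact Finset.single_le_sum (fun s _ => M.dist.1 s) (Finset.mem_univ a)

/-- Team formulae are expressible in every second-order logic with the required closure
properties. -/
theorem SumLogic.exists_struc {τ : FirstOrder.Language.{v, w}}
    {𝒞 : (Γ : List ℕ) → EnvProp.{u} τ Γ → Prop} (h𝒞 : SumLogic τ 𝒞) {D : Set AtomKind}
    (hD : AtomKind.dependence ∈ D → ∀ {Γ : List ℕ} {n k : ℕ} (X : FVar Γ n) (x : Fin k → Fin n)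
      (y : Fin n), 𝒞 Γ (fun A _ _ _ ρ => ∀ s s' : Fin n → A,
        ρ n X s = 0 ∨ ρ n X s' = 0 ∨ ¬ (∀ l, s (x l) = s' (x l)) ∨ s y = s' y))
    {n : ℕ} {φ : TeamForm τ n} (hφ : φ ∈ FO τ n D) :
    ∃ P, 𝒞 [n] P ∧ ∀ M : DStruc.{u} τ n,
      M ∈ TeamForm.Struc φ ↔ P M.A (FEnv.cons M.f FEnv.nil) := by
  obtain ⟨P, hP, h⟩ := h𝒞.exists_wsat hD φ hφ (Γ := [n]) .here
  refine ⟨P, hP, fun M => ?_⟩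
  rw [h M.A _ M.bounded M.dist.2.le]
  exact φ.sat_iff_wsat (Or.inl M.dist)

end ProbTeam

theorem mainTheorem2 (τ : FirstOrder.Language.{v, w}) [τ.IsRelational] (n : ℕ) :
    ProbTeam.Equiexpressive.{u}
        (ProbTeam.FO τ n {ProbTeam.AtomKind.marginalIdentity, ProbTeam.AtomKind.dependence})
        (Set.Icc (0 : ℝ) 1)
        (ProbTeam.LooseESO τ n {ProbTeam.NumOp.plus} {ProbTeam.NumRel.eq} {0, 1}) ∧
      ProbTeam.Equiexpressive.{u}
        (ProbTeam.FO τ n {ProbTeam.AtomKind.marginalIdentity})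
        (Set.Icc (0 : ℝ) 1)
        (ProbTeam.AlmostConjLooseEA τ n {ProbTeam.NumOp.SUM} {ProbTeam.NumRel.eq} {0, 1}) := by
  refine ⟨⟨fun φ hφ => ?_, fun ψ hψ => ?_⟩, fun φ hφ => ?_, fun ψ hψ => ?_⟩
  · obtain ⟨P, ⟨ψ, h1, h2, h3⟩, h⟩ := ProbTeam.LooseDef.sumLogic.exists_struc
      (fun _ => ProbTeam.LooseDef.dependence) hφ
    refine ⟨ψ, ⟨h1, h2⟩, Set.ext fun M => (h M).trans ?_⟩
    exact (h3 M.A _ Fin.elim0 M.bounded).symm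
  · exact (ProbTeam.ESO.teamDef_of_loose (by simp) (by simp) (by simp) ψ hψ.1 hψ.2).exists_struc_eq
  -- The closure condition for dependence atoms is vacuous here.
  · obtain ⟨P, hP, h⟩ := ProbTeam.PrefixDef.sumLogic.exists_struc (fun h => by simp at h) hφ
    obtain ⟨ψ, ⟨h1, h2, h3⟩, h4, h5⟩ := hP.exists_eso
    refine ⟨ψ, ⟨⟨h1, h2⟩, h3, h4⟩, Set.ext fun M => (h M).trans ?_⟩
    exact (h5 M.A _).symm
  · exact (ProbTeam.ESO.teamDef_of_prefixExFAll (by simp) (by simp) hψ.2.2 hψ.1.1 hψ.1.2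
      hψ.2.1).exists_struc_eq
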